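/- For a string $x$ over $\{0,1\}$ let $\mathrm{SA}$ be its suffix array (starting positions of the nonempty suffixes in lexicographic order), let $\mathrm{BWT}(x)[i]$ be the symbol preceding position $\mathrm{SA}[i]$ (cyclically, so position $1$ is preceded by the last symbol), and let $r(x)$ be the number of runs (maximal blocks of equal adjacent symbols) of $\mathrm{BWT}(x)$. For $x=a_1\cdots a_q$ put $\widetilde{x}=a_1 10\,a_2 10\cdots a_q 10$. **(1)** Let $T\in\{0,1\}^n$ be a nonempty text and let $P_1,\dots,P_k\in\{0,1\}^m$ be $k\ge 0$ pairwise distinct patterns of common length $m\ge 1$. Let $$S_1=10\,\widetilde T\cdot\prod_{i=1}^{k}\big(10\,\widetilde{P_i}\,0^7 1^4\cdot 00\,\widetilde{P_i}\,0^6 1^5\cdot 00\,\widetilde{P_i}\,1^3 0^3 1^5\cdot 00\,\widetilde{P_i}\,1^4 0^3 1^4\cdot 00\,\widetilde{P_i}\,0^8 1^3\big),$$ $$S_2=10\,\widetilde T\cdot\prod_{i=1}^{k}\big(10\,\widetilde{P_i}\,0^6 1^5\cdot 00\,\widetilde{P_i}\,0^7 1^4\cdot 00\,\widetilde{P_i}\,1^3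 0^3 1^5\cdot 00\,\widetilde{P_i}\,1^4 0^3 1^4\cdot 00\,\widetilde{P_i}\,0^8 1^3\big),$$ where products denote concatenation. Then $r(S_2)-r(S_1)=2\,|\{i\in\{1,\dots,k\} : P_i \text{ does not occur in } T\}|$. For (2) and (3), the model is the word RAM: unit-cost arithmetic, bitwise, shift and comparison operations on $w$-bit words and random access to a constant number of arrays of words. An algorithm is a fixed program that must work for every word length $w\ge c\log N$, where $N$ is the length of the input string (for Dictionary Matching: of the text) and $c$ is a constant; its time and space bounds do not depend on $w$. Working space is measured in words and includes the input. Strings are given in packed representation, with $\lfloor\log_2 N\rfloor+1$ symbols per word (each pattern starting at a new word), together with their lengths. An algorithm for a problem on one nonempty binary string is said to take time $T(u)$ and space $S(u)$, where $T,S:\mathbb N\to\mathbb R$, if for every constant $C$ it takes $O(T(u))$ time and $O(S(u))$ working space on every input of at most $C u$ bits, $u\ge 2$. *Dictionary Matching* is the problem of deciding, given a nonempty text $T\in\{0,1\}^n$ and $k=\Theta(n/\log n)$ pairwise distinct nonempty patterns $P_1,\dots,P_k$ of common length $m=\Theta(\log n)$, whether some $P_i$ occurs in $T$. **(2)** If there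 is an algorithm that, given a binary string $x$, computes $r(x)$ (problem *RLBWT Size*) in time $T_{\rm RLBWT}(u)$ and working space $S_{\rm RLBWT}(u)$, then there is an algorithm that solves Dictionary Matching in $O(T_{\rm RLBWT}(n))$ time and $O(S_{\rm RLBWT}(n))$ working space, for all choices of the constants in the two $\Theta$ conditions (the constant $c$ and the constants in these bounds may depend on that choice). **(3)** If there is an algorithm that, given a binary string $x$, computes the packed representation of $\mathrm{BWT}(x)$ (problem *BWT Construction*) in time $T_{\rm BWT}(u)$ and working space $S_{\rm BWT}(u)$, then there is an algorithm that solves Dictionary Matching in $O(T_{\rm BWT}(n))$ time and $O(S_{\rm BWT}(n))$ working space, for all choices of the constants in the two $\Theta$ conditions, as in (2). -/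

import Mathlib

/-!
Binary strings are lists of Booleans: `false` is the symbol 0 and `true` is the symbol 1, with
`false < true`; lists carry the lexicographic order in which a proper prefix is smaller.
-/

namespace BWTReduction

/-! ### Burrows-Wheeler transform -/

/-- The suffix array with positions counted from 0: the starting positions of all nonempty
suffixes of `x`, sorted by the lexicographic order of the suffixes. -/
def suffixArray (x : List Bool) : List ℕ :=
  (List.range x.length).insertionSort (fun i j => x.drop i ≤ x.drop j)

/-- The Burrows-Wheeler transform: for each suffix in lexicographic order, the symbol that
precedes it (cyclically, so the whole string is preceded by its own last symbol). -/
def bwt (x : List Bool) : List Bool :=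
  (suffixArray x).map (fun i => x.getD ((i + (x.length - 1)) % x.length) false)

/-- The number of runs (maximal blocks of equal adjacent symbols) of a string. -/
def runs : List Bool → ℕ
  | [] => 0
  | [_] => 1
  | a :: b :: l => (if a = b then 0 else 1) + runs (b :: l)

/-- The number `r(x)` of runs in the Burrows-Wheeler transform of `x`. -/
def rlbwtSize (x : List Bool) : ℕ := runs (bwt x)

/-! ### The two strings of the reduction -/

/-- `a₁ 10 a₂ 10 ⋯ a_q 10` for the string `a₁ a₂ ⋯ a_q`. -/
def spread (x : List Bool) : List Bool := x.flatMap (fun a => [a, true, false])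

/-- The string `0^j`. -/
def zeros (j : ℕ) : List Bool := List.replicate j false

/-- The string `1^j`. -/
def ones (j : ℕ) : List Bool := List.replicate j true

def gadget₁ (p : List Bool) : List Bool :=
  ([true, false] ++ spread p ++ zeros 7 ++ ones 4) ++
  ([false, false] ++ spread p ++ zeros 6 ++ ones 5) ++
  ([false, false] ++ spread p ++ ones 3 ++ zeros 3 ++ ones 5) ++
  ([false, false] ++ spread p ++ ones 4 ++ zeros 3 ++ ones 4) ++
  ([false, false] ++ spread p ++ zeros 8 ++ ones 3)

def gadget₂ (p : List Bool) : List Bool :=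
  ([true, false] ++ spread p ++ zeros 6 ++ ones 5) ++
  ([false, false] ++ spread p ++ zeros 7 ++ ones 4) ++
  ([false, false] ++ spread p ++ ones 3 ++ zeros 3 ++ ones 5) ++
  ([false, false] ++ spread p ++ ones 4 ++ zeros 3 ++ ones 4) ++
  ([false, false] ++ spread p ++ zeros 8 ++ ones 3)

def string₁ (x : List Bool) (D : List (List Bool)) : List Bool :=
  [true, false] ++ spread x ++ D.flatMap gadget₁

def string₂ (x : List Bool) (D : List (List Bool)) : List Bool :=
  [true, false] ++ spread x ++ D.flatMap gadget₂

/-! ### Word RAM -/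

/-- Binary operations on machine words. -/
inductive BinOp
  | add | sub | mul | div | mod | and | or | xor | shl | shr | lt | eq

/-- All operations are on unsigned `w`-bit words, modulo `2 ^ w`; comparisons return 0 or 1;
division by zero returns 0 with remainder `x`. -/
def BinOp.eval {w : ℕ} : BinOp → BitVec w → BitVec w → BitVec w
  | .add, x, y => x + y
  | .sub, x, y => x - y
  | .mul, x, y => x * y
  | .div, x, y => x / y
  | .mod, x, y => x % y
  | .and, x, y => x &&& y
  | .or, x, y => x ||| y
  | .xor, x, y => x ^^^ y
  | .shl, x, y => x <<< y
  | .shr, x, y => x >>> y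
  | .lt, x, y => if x.toNat < y.toNat then BitVec.ofNat w 1 else BitVec.ofNat w 0
  | .eq, x, y => if x = y then BitVec.ofNat w 1 else BitVec.ofNat w 0

/-- Word RAM programs. A program is a finite text, independent of the input and of the word
length; it names finitely many registers and finitely many arrays of words. An array cell is
addressed by the content of a register. -/
inductive Program
  /-- do nothing -/
  | skip
  /-- `reg d := v` for a constant `v` -/
  | const (d v : ℕ)
  /-- `reg d := reg a ∘ reg b` -/
  | op (o : BinOp) (d a b : ℕ)
  /-- `reg d := arr[reg a]` -/
  | load (d arr a : ℕ)
  /-- `arr[reg a] := reg b` -/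
  | store (arr a b : ℕ)
  /-- sequential composition -/
  | seq (p q : Program)
  /-- if `reg a ≠ 0` then `p` else `q` -/
  | ite (a : ℕ) (p q : Program)
  /-- while `reg a ≠ 0` do `p` -/
  | loop (a : ℕ) (p : Program)

/-- The state of a machine with `w`-bit words: the registers and the memory. -/
structure State (w : ℕ) where
  reg : ℕ → BitVec w
  mem : ℕ → BitVec w → BitVec w

def State.setReg {w : ℕ} (σ : State w) (d : ℕ) (v : BitVec w) : State w :=
  { σ with reg := Function.update σ.reg d v }

def State.setMem {w : ℕ} (σ : State w) (arr : ℕ) (i v : BitVec w) : State w :=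
  { σ with mem := Function.update σ.mem arr (Function.update (σ.mem arr) i v) }

/-- `Exec s p σ t σ'`: started in `σ`, the program `p` halts in `σ'` after exactly `t` unit-cost
steps, and each array cell it ever reads or writes has an index below `s`, that is, it can be run
with `s` words of memory per array. As a program names a constant number of arrays, the number of
memory words it uses is `O(s)`. Cells holding the input are counted like all others. -/
inductive Exec {w : ℕ} (s : ℕ) : Program → State w → ℕ → State w → Prop
  | skip (σ : State w) : Exec s .skip σ 1 σ
  | const (σ : State w) (d v : ℕ) :
      Exec s (.const d v) σ 1 (σ.setReg d (BitVec.ofNat w v))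
  | op (σ : State w) (o : BinOp) (d a b : ℕ) :
      Exec s (.op o d a b) σ 1 (σ.setReg d (o.eval (σ.reg a) (σ.reg b)))
  | load (σ : State w) (d arr a : ℕ) (h : (σ.reg a).toNat < s) :
      Exec s (.load d arr a) σ 1 (σ.setReg d (σ.mem arr (σ.reg a)))
  | store (σ : State w) (arr a b : ℕ) (h : (σ.reg a).toNat < s) :
      Exec s (.store arr a b) σ 1 (σ.setMem arr (σ.reg a) (σ.reg b))
  | seq {p q : Program} {σ σ₁ σ₂ : State w} {t₁ t₂ : ℕ}
      (h₁ : Exec s p σ t₁ σ₁) (h₂ : Exec s q σ₁ t₂ σ₂) :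
      Exec s (.seq p q) σ (t₁ + t₂) σ₂
  | ite_true {a : ℕ} {p q : Program} {σ σ₁ : State w} {t : ℕ}
      (h : σ.reg a ≠ 0) (h₁ : Exec s p σ t σ₁) : Exec s (.ite a p q) σ (t + 1) σ₁
  | ite_false {a : ℕ} {p q : Program} {σ σ₁ : State w} {t : ℕ}
      (h : σ.reg a = 0) (h₁ : Exec s q σ t σ₁) : Exec s (.ite a p q) σ (t + 1) σ₁
  | loop_done {a : ℕ} {p : Program} {σ : State w}
      (h : σ.reg a = 0) : Exec s (.loop a p) σ 1 σ
  | loop_step {a : ℕ} {p : Program} {σ σ₁ σ₂ : State w} {t₁ t₂ : ℕ}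
      (h : σ.reg a ≠ 0) (h₁ : Exec s p σ t₁ σ₁) (h₂ : Exec s (.loop a p) σ₁ t₂ σ₂) :
      Exec s (.loop a p) σ (t₁ + t₂ + 1) σ₂

/-! ### Packed representation -/

/-- The number `⌊log₂ n⌋ + 1` of symbols stored in one machine word when the input parameter
is `n`. -/
def blockSize (n : ℕ) : ℕ := Nat.log 2 n + 1

/-- The `i`-th word of the packed representation of `x` with `b` symbols per word: its `j`-th
least significant bit is the symbol of `x` at position `i * b + j` (counted from 0), and bits
past the end of `x` are 0. -/
def packedWord (b : ℕ) (x : List Bool) (i : ℕ) : ℕ :=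
  ∑ j ∈ Finset.range b, if x.getD (i * b + j) false then 2 ^ j else 0

/-- The number `⌈length / b⌉` of words of the packed representation of a string. -/
def packedLength (b length : ℕ) : ℕ := (length + (b - 1)) / b

/-- Initial state for a single binary string `x`: register 0 holds its length and array 0 holds
its packed representation; everything else is 0. -/
def stringInput (w : ℕ) (x : List Bool) : State w where
  reg r := if r = 0 then BitVec.ofNat w x.length else 0
  mem arr i := if arr = 0 then BitVec.ofNat w (packedWord (blockSize x.length) x i.toNat) else 0

/-- Initial state for a text `x` and a list `D` of patterns of common length `m`: registers 0, 1, 2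
hold the length of `x`, the number `m` and the number of patterns; array 0 holds the packed
representation of `x`, and array 1 holds the packed representations of the patterns one after
another, each starting at a new word; everything else is 0. -/
def dictInput (w : ℕ) (x : List Bool) (D : List (List Bool)) (m : ℕ) : State w where
  reg r :=
    if r = 0 then BitVec.ofNat w x.length
    else if r = 1 then BitVec.ofNat w m
    else if r = 2 then BitVec.ofNat w D.length
    else 0
  mem arr i :=
    if arr = 0 then BitVec.ofNat w (packedWord (blockSize x.length) x i.toNat)
    else if arr = 1 then
      BitVec.ofNat w (packedWord (blockSize x.length)
        (D.getD (i.toNat / packedLength (blockSize x.length) m) [])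
        (i.toNat % packedLength (blockSize x.length) m))
    else 0

/-! ### The computational problems -/

/-- On every nonempty binary string `x` and for every sufficiently large word length `w`
(at least a constant `c` times the logarithm of the input length), the program `A` halts in a state
that satisfies `Output`; on instances of at most `C * u` bits, for any constant `C`, it takes
`O(T u)` time and `O(S u)` working space. -/
def SolvesStringProblem (Output : (w : ℕ) → List Bool → State w → Prop)
    (A : Program) (T S : ℕ → ℝ) : Prop :=
  ∃ c : ℕ, ∀ C : ℕ, ∃ K : ℕ, ∀ u : ℕ, 2 ≤ u → ∀ x : List Bool, x ≠ [] → x.length ≤ C * u →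
    ∀ w : ℕ, c * blockSize x.length ≤ w →
      ∃ (s t : ℕ) (σ : State w), Exec s A (stringInput w x) t σ ∧
        (t : ℝ) ≤ K * T u ∧ (s : ℝ) ≤ K * S u ∧ Output w x σ

/-- RLBWT Size: register 0 holds the number of runs in the BWT of the input. -/
def SolvesRLBWTSize (A : Program) (T S : ℕ → ℝ) : Prop :=
  SolvesStringProblem (fun _ x σ => (σ.reg 0).toNat = rlbwtSize x) A T S

/-- BWT Construction: array 1 holds the packed representation of the BWT of the input. -/
def SolvesBWTConstruction (A : Program) (T S : ℕ → ℝ) : Prop :=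
  SolvesStringProblem
    (fun w x σ => ∀ i < packedLength (blockSize x.length) x.length,
      (σ.mem 1 (BitVec.ofNat w i)).toNat = packedWord (blockSize x.length) (bwt x) i) A T S

/-- `D` lists pairwise distinct patterns of common length `m ≥ 1`, and `x` is a nonempty text. -/
structure IsDictionary (x : List Bool) (D : List (List Bool)) (m : ℕ) : Prop where
  text_ne : x ≠ []
  pos : 1 ≤ m
  nodup : D.Nodup
  length_eq : ∀ p ∈ D, p.length = m

/-- Dictionary Matching instances with `|D| = Θ(n / log n)` patterns of common length
`m = Θ(log n)`, where `n` is the length of the text, with explicit constants `a` and `b`. -/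
structure IsDMInstance (a b : ℝ) (x : List Bool) (D : List (List Bool)) (m : ℕ) : Prop
    extends IsDictionary x D m where
  card_ge : a * (x.length / Real.logb 2 x.length) ≤ D.length
  card_le : (D.length : ℝ) ≤ b * (x.length / Real.logb 2 x.length)
  length_ge : a * Real.logb 2 x.length ≤ m
  length_le : (m : ℝ) ≤ b * Real.logb 2 x.length

/-- The program `P` decides Dictionary Matching: for all constants `a`, `b` hidden in the `Θ` there
are a word length factor `c` and a constant `K` such that, on every instance and for every
word length of at least `c` times the logarithm of the text length `n`, it halts within `K * T n`
steps, using at most `K * S n` words, with register 0 equal to 1 if some pattern occurs in the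
text and to 0 otherwise. -/
def SolvesDictionaryMatching (P : Program) (T S : ℕ → ℝ) : Prop :=
  ∀ a b : ℝ, 0 < a → 0 < b → ∃ c K : ℕ, ∀ (x : List Bool) (D : List (List Bool)) (m : ℕ),
    IsDMInstance a b x D m → ∀ w : ℕ, c * blockSize x.length ≤ w →
      ∃ (s t : ℕ) (σ : State w), Exec s P (dictInput w x D m) t σ ∧
        (t : ℝ) ≤ K * T x.length ∧ (s : ℝ) ≤ K * S x.length ∧
        (σ.reg 0).toNat = if ∃ p ∈ D, p <:+: x then 1 else 0

end BWTReduction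

/-!
The number of runs. A suffix of `string₁ t D` is matched with a suffix of `string₂ t D`
(`suffixPairs`) that starts at the same place, except that, in the first two pieces of a gadget, the
spread pattern and the zeros after it follow the exchange of these pieces: the one with seven zeros
is matched with the one with seven zeros, while the last four symbols `1111` are matched place by
place. This matching preserves the lexicographic order
(`snd_le_of_fst_le`), because the common prefix of two matched suffixes suffices to compare them with
nearly all other suffixes (`IsKey`, `exists_isKey`): the patterns are spread by `10`, so that a spread
pattern preceded by `00` or `10` occurs only in the gadget of the pattern, or in the text if the
pattern occurs there. Therefore both transforms list the symbols preceding matched suffixes in the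
same order, and these symbols agree with the exception of four per pattern (`fst_ne_iff_special`).
The four suffixes form two pairs of neighbours in the suffix array. At the pair that starts with
ones, the exchange of symbols always creates two runs (`exists_ones_neighbours`). At the pair that
starts with `0` and the spread pattern, it removes two runs if the next suffix is preceded by `1`,
which happens if and only if that suffix lies in the text, that is, if the pattern occurs
(`exists_core_neighbours`), and has no effect otherwise. Summing over the patterns gives
`rlbwtSize_string₂_sub`.

Dictionary Matching by RLBWT Size. Some pattern occurs if and only if the difference of the two
numbers of runs is less than twice the number of patterns. The program `matchBySize` writes both
strings, applies two renamed copies of the given program to them (`Exec.rename`) and compares.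
Writing them takes time `O(n / log n)` (`runs_buildInputs`), since a whole word of symbols is spread
at once with two accesses to a table of about `√n` entries. This is within the allowed bounds, as
every algorithm for RLBWT Size has to read all words of its input (`packedLength_le_of_solves`).
Programs are verified in a calculus of total correctness with time bounds (`Runs`) on machine states
with natural numbers for words (`NState`), in which the absence of overflow is a side condition.

RLBWT Size by BWT Construction. The runs of a transform in packed representation are counted word by
word with a table of bit counts (`runs_countRuns`), so that an algorithm for BWT Construction gives
one for RLBWT Size with the same bounds (`solvesRLBWTSize_sizeByBWT`).
-/

namespace BWTReduction

/-! ### Lexicographic order -/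

theorem append_lt_append_left_iff (A : List Bool) {a b : List Bool} : A ++ a < A ++ b ↔ a < b := by
  induction A with
  | nil => simp
  | cons c A ih => simpa [List.cons_lt_cons_iff] using ih

theorem lt_append_of_ne_nil (A : List Bool) {a : List Bool} (h : a ≠ []) : A < A ++ a := by
  obtain ⟨c, l, rfl⟩ := List.exists_cons_of_ne_nil h
  simpa using (append_lt_append_left_iff A (a := []) (b := c :: l)).2 (List.nil_lt_cons c l)

theorem lt_of_isPrefix_of_ne {a b : List Bool} (h : a <+: b) (hne : a ≠ b) : a < b := by
  obtain ⟨t, rfl⟩ := h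
  exact lt_append_of_ne_nil a (by rintro rfl; simp at hne)

/-- Two strings between which neither is a prefix of the other are ordered by their first
mismatch, whatever follows. -/
theorem lt_iff_of_not_isPrefix {K J : List Bool} (h₁ : ¬ K <+: J) (h₂ : ¬ J <+: K)
    (a b : List Bool) : K ++ a < J ++ b ↔ K < J := by
  induction K generalizing J with
  | nil => simp at h₁
  | cons c K ih =>
    cases J with
    | nil => simp at h₂
    | cons d J =>
      simp only [List.cons_append, List.cons_lt_cons_iff]
      by_cases hcd : c = d
      · subst hcd
        simp only [List.cons_prefix_cons, true_and] at h₁ h₂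
        simp [ih h₁ h₂]
      · simp [hcd]

/-- A string lying between two strings with a common prefix has that prefix. -/
theorem isPrefix_of_lt_of_lt {A a b y : List Bool} (h₁ : A ++ a < y) (h₂ : y < A ++ b) :
    A <+: y := by
  induction A generalizing y with
  | nil => simp
  | cons c A ih =>
    cases y with
    | nil => simp at h₁
    | cons d y =>
      simp only [List.cons_append, List.cons_lt_cons_iff] at h₁ h₂
      rcases h₁ with h₁ | ⟨rfl, h₁⟩
      · rcases h₂ with h₂ | ⟨rfl, h₂⟩
        · exact absurd (h₁.trans h₂) (lt_irrefl _)
        · exact absurd h₁ (lt_irrefl _)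
      · rcases h₂ with h₂ | ⟨-, h₂⟩
        · exact absurd h₂ (lt_irrefl _)
        · exact List.cons_prefix_cons.2 ⟨rfl, ih h₁ h₂⟩

/-! ### The transform as a sort of annotated suffixes -/

/-- The pairs `(c, z ++ R)`, where `z` runs through the nonempty suffixes of `Z` from the longest
to the shortest and `c` is the symbol that precedes it in `Z`, respectively the symbol `c` for
`z = Z`. -/
def annotated : Bool → List Bool → List Bool → List (Bool × List Bool)
  | _, [], _ => []
  | c, a :: Z, R => (c, a :: Z ++ R) :: annotated a Z R

theorem annotated_append (c : Bool) (Z Z' R : List Bool) :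
    annotated c (Z ++ Z') R = annotated c Z (Z' ++ R) ++ annotated (Z.getLastD c) Z' R := by
  induction Z generalizing c with
  | nil => simp [annotated]
  | cons a Z ih =>
    simp [annotated, ih, List.getLast?_cons]

theorem mem_annotated {c : Bool} {Z R : List Bool} {x : Bool × List Bool}
    (h : x ∈ annotated c Z R) :
    x = (c, Z ++ R) ∨ x.1 :: x.2 <:+ Z ++ R := by
  induction Z generalizing c with
  | nil => simp [annotated] at h
  | cons a Z ih =>
    simp only [annotated, List.mem_cons] at h
    rcases h with rfl | h
    · simp
    · rcases ih h with rfl | h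
      · right; simp
      · right; exact h.trans (List.suffix_cons _ _)

theorem annotated_eq_map (c : Bool) (Z R : List Bool) :
    annotated c Z R =
      (List.range Z.length).map (fun i => ((c :: Z).getD i false, Z.drop i ++ R)) := by
  induction Z generalizing c with
  | nil => simp [annotated]
  | cons a Z ih =>
    rw [annotated, ih, List.length_cons, List.range_succ_eq_map]
    simp

theorem getD_cyclic_pred (x : List Bool) (i : ℕ) (h : i < x.length) :
    x.getD ((i + (x.length - 1)) % x.length) false = (x.getLastD false :: x).getD i false := by
  have hx : x ≠ [] := by rintro rfl; simp at h
  cases i with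
  | zero =>
    rw [Nat.zero_add, Nat.mod_eq_of_lt (by omega)]
    simp [List.getLastD_eq_getLast?, List.getLast?_eq_getElem?]
  | succ i =>
    have : i + 1 + (x.length - 1) = i + x.length := by omega
    rw [this, Nat.add_mod_right, Nat.mod_eq_of_lt (by omega)]
    simp

/-- The transform of `x` is read off any sorted arrangement of its annotated suffixes. -/
theorem bwt_eq_map_fst {x : List Bool} {E : List (Bool × List Bool)}
    (hp : E.Perm (annotated (x.getLastD false) x []))
    (hs : E.Pairwise (fun p q => p.2 ≤ q.2)) : bwt x = E.map Prod.fst := by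
  set F : ℕ → Bool × List Bool := fun i => ((x.getLastD false :: x).getD i false, x.drop i) with hF
  have hann : annotated (x.getLastD false) x [] = (List.range x.length).map F := by
    rw [annotated_eq_map]; simp [hF]
  have hE : E = (suffixArray x).map F := by
    refine List.Perm.eq_of_pairwise (le := fun p q : Bool × List Bool => p.2 ≤ q.2) ?_ hs ?_ ?_
    · intro p q hp' hq' h₁ h₂
      have h₃ : p.2 = q.2 := le_antisymm h₁ h₂
      have hp'' := hp.mem_iff.1 hp'
      have hq'' : q ∈ (List.range x.length).map F := by
        have := List.Perm.map F (List.perm_insertionSort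
          (fun i j => x.drop i ≤ x.drop j) (List.range x.length))
        exact this.mem_iff.1 hq'
      rw [hann] at hp''
      simp only [List.mem_map, List.mem_range] at hp'' hq''
      obtain ⟨i, hi, rfl⟩ := hp''
      obtain ⟨j, hj, rfl⟩ := hq''
      have := congrArg List.length h₃
      simp only [hF, List.length_drop] at this
      have : i = j := by omega
      rw [this]
    · rw [List.pairwise_map]
      have := List.pairwise_insertionSort (fun i j => x.drop i ≤ x.drop j) (List.range x.length)
      exact this
    · refine (hp.trans (by rw [hann])).trans ?_
      exact (List.Perm.map F (List.perm_insertionSort _ _)).symm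
  rw [hE, bwt, List.map_map]
  refine List.map_congr_left ?_
  intro i hi
  have : i < x.length := by
    have := (List.perm_insertionSort (fun i j => x.drop i ≤ x.drop j) (List.range x.length)).mem_iff.1 hi
    simpa using this
  simp only [hF, Function.comp, getD_cyclic_pred x i this]

/-! ### Runs -/

theorem runs_cons_cons (a b : Bool) (l : List Bool) :
    runs (a :: b :: l) = (if a = b then 0 else 1) + runs (b :: l) := rfl

theorem runs_append_cons (X : List Bool) (a : Bool) (Z : List Bool) :
    runs (X ++ a :: Z) + 1 = runs (X ++ [a]) + runs (a :: Z) := by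
  induction X with
  | nil => simp [runs]; omega
  | cons c X ih =>
    cases X with
    | nil => simp only [List.cons_append, List.nil_append, runs_cons_cons, runs] at *; omega
    | cons d X => simp only [List.cons_append, runs_cons_cons] at *; omega

/-! ### Spread patterns inside strings -/

theorem spread_cons (a : Bool) (x : List Bool) :
    spread (a :: x) = a :: true :: false :: spread x := rfl

@[simp] theorem spread_nil : spread [] = [] := rfl

theorem spread_append (x y : List Bool) : spread (x ++ y) = spread x ++ spread y := by
  simp [spread]

theorem length_spread (x : List Bool) : (spread x).length = 3 * x.length := by
  induction x with
  | nil => rfl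
  | cons a x ih => simp [spread_cons, ih]; ring

theorem isPrefix_of_spread_isPrefix {p q r : List Bool} (hr : ∀ x, ¬ [x, true, false] <+: r)
    (h : spread p <+: spread q ++ r) : p <+: q := by
  induction p generalizing q with
  | nil => simp
  | cons a p ih =>
    cases q with
    | nil =>
      refine absurd (List.IsPrefix.trans ?_ h) (hr a)
      simp [spread_cons]
    | cons b q =>
      simp only [spread_cons, List.cons_append, List.cons_prefix_cons, true_and] at h
      exact List.cons_prefix_cons.2 ⟨h.1, ih h.2⟩

theorem eq_of_spread_isPrefix {p q r : List Bool} (hl : p.length = q.length)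
    (h : spread p <+: spread q ++ r) : p = q := by
  induction p generalizing q with
  | nil => exact (List.eq_nil_of_length_eq_zero hl.symm).symm
  | cons a p ih =>
    cases q with
    | nil => simp at hl
    | cons b q =>
      simp only [spread_cons, List.cons_append, List.cons_prefix_cons, true_and] at h
      rw [h.1, ih (by simpa using hl) h.2]

/-! ### The suffixes of the two strings that start a gadget piece -/

/-- The fifth piece of the gadget of `p`, followed by `r`. -/
def piece₅ (p r : List Bool) : List Bool :=
  false :: false :: (spread p ++ (zeros 8 ++ (ones 3 ++ r)))

/-- The last two pieces of the gadget of `p`, followed by `r`. -/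
def piece₄ (p r : List Bool) : List Bool :=
  false :: false :: (spread p ++ (ones 4 ++ (zeros 3 ++ (ones 4 ++ piece₅ p r))))

/-- The last three pieces of the gadget of `p`, followed by `r`. -/
def piece₃ (p r : List Bool) : List Bool :=
  false :: false :: (spread p ++ (ones 3 ++ (zeros 3 ++ (ones 5 ++ piece₄ p r))))

/-- The last four pieces of `gadget₁ p`, followed by `r`. -/
def piece₂ (p r : List Bool) : List Bool :=
  false :: false :: (spread p ++ (zeros 6 ++ (ones 5 ++ piece₃ p r)))

/-- The last four pieces of `gadget₂ p`, followed by `r`. -/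
def piece₂' (p r : List Bool) : List Bool :=
  false :: false :: (spread p ++ (zeros 7 ++ (ones 4 ++ piece₃ p r)))

theorem gadget₁_append (p r : List Bool) : gadget₁ p ++ r =
    true :: false :: (spread p ++ (zeros 7 ++ (ones 4 ++ piece₂ p r))) := by
  simp [gadget₁, piece₂, piece₃, piece₄, piece₅]

theorem gadget₂_append (p r : List Bool) : gadget₂ p ++ r =
    true :: false :: (spread p ++ (zeros 6 ++ (ones 5 ++ piece₂' p r))) := by
  simp [gadget₂, piece₂', piece₃, piece₄, piece₅]

theorem string₁_eq (x : List Bool) (D : List (List Bool)) :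
    string₁ x D = true :: false :: (spread x ++ D.flatMap gadget₁) := by
  simp [string₁]

theorem string₂_eq (x : List Bool) (D : List (List Bool)) :
    string₂ x D = true :: false :: (spread x ++ D.flatMap gadget₂) := by
  simp [string₂]

/-! ### Occurrences of `00` followed by a spread pattern -/

section Windows

variable {x : Bool} {u : List Bool}

theorem suffix_of_window_spread {p r : List Bool}
    (hr : ¬ [false, false, x, true, false] <+: false :: r)
    (hw : [false, false, x, true, false] <+: u) (hu : u <:+ spread p ++ r) : u <:+ r := by
  induction p with
  | nil => simpa using hu
  | cons a p ih =>
    simp only [spread_cons, List.cons_append, List.suffix_cons_iff] at hu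
    rcases hu with rfl | rfl | rfl | hu
    · simp at hw
    · simp at hw
    · cases p with
      | nil => exact absurd (by simpa using hw) hr
      | cons b p => simp [spread_cons] at hw
    · exact ih hu

theorem suffix_of_window_ones {j : ℕ} {r : List Bool}
    (hw : [false, false, x, true, false] <+: u) (hu : u <:+ ones j ++ r) : u <:+ r := by
  induction j with
  | zero => simpa [ones] using hu
  | succ j ih =>
    simp only [ones, List.replicate_succ, List.cons_append, List.suffix_cons_iff] at hu
    rcases hu with rfl | hu
    · simp at hw
    · exact ih hu

theorem suffix_of_window_zeros {j : ℕ} {r : List Bool}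
    (hw : [false, false, x, true, false] <+: u)
    (hu : u <:+ zeros j ++ (ones 3 ++ r)) : u <:+ ones 3 ++ r := by
  induction j with
  | zero => simpa [zeros] using hu
  | succ j ih =>
    simp only [zeros, List.replicate_succ, List.cons_append, List.suffix_cons_iff] at hu
    rcases hu with rfl | hu
    · exfalso
      rcases j with _ | _ | _ | j <;> simp [ones, List.replicate_succ] at hw
    · exact ih hu

theorem ones_add_append (i j : ℕ) (r : List Bool) : ones (i + j) ++ r = ones i ++ (ones j ++ r) := by
  rw [ones, List.replicate_add, List.append_assoc]; rfl

theorem zeros_add_append (i j : ℕ) (r : List Bool) :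
    zeros (i + j) ++ r = zeros i ++ (zeros j ++ r) := by
  rw [zeros, List.replicate_add, List.append_assoc]; rfl

theorem suffix_of_window_zeros_ones {i j : ℕ} {r : List Bool}
    (hw : [false, false, x, true, false] <+: u)
    (hu : u <:+ zeros i ++ (ones (3 + j) ++ r)) : u <:+ r := by
  rw [ones_add_append] at hu
  exact suffix_of_window_ones hw (suffix_of_window_ones hw (suffix_of_window_zeros hw hu))

theorem suffix_of_window_piece_zeros {p r : List Bool} {i j : ℕ} (hi : 6 ≤ i) (hj : 3 ≤ j)
    (hw : [false, false, x, true, false] <+: u)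
    (hu : u <:+ spread p ++ (zeros i ++ (ones j ++ r))) : u <:+ r := by
  obtain ⟨i, rfl⟩ := Nat.exists_eq_add_of_le hi
  obtain ⟨j, rfl⟩ := Nat.exists_eq_add_of_le hj
  refine suffix_of_window_zeros_ones hw (suffix_of_window_spread ?_ hw hu)
  rw [zeros_add_append]
  simp [zeros, List.replicate_succ]

theorem suffix_of_window_piece_ones {p r : List Bool} {i j : ℕ} (hi : 3 ≤ i) (hj : 3 ≤ j)
    (hw : [false, false, x, true, false] <+: u)
    (hu : u <:+ spread p ++ (ones i ++ (zeros 3 ++ (ones j ++ r)))) : u <:+ r := by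
  obtain ⟨i, rfl⟩ := Nat.exists_eq_add_of_le hi
  obtain ⟨j, rfl⟩ := Nat.exists_eq_add_of_le hj
  refine suffix_of_window_zeros_ones hw (suffix_of_window_ones hw
    (suffix_of_window_spread ?_ hw hu))
  rw [ones_add_append]
  simp [ones, List.replicate_succ]

theorem window_gadget₁ {p r : List Bool}
    (hw : [false, false, x, true, false] <+: u) (hu : u <:+ gadget₁ p ++ r) :
    u = piece₂ p r ∨ u = piece₃ p r ∨ u = piece₄ p r ∨ u = piece₅ p r ∨ u <:+ r := by
  have z : ∀ {i j : ℕ} {l : List Bool}, 6 ≤ i → 3 ≤ j →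
      u <:+ false :: (spread p ++ (zeros i ++ (ones j ++ l))) → u <:+ l := by
    intro i j l hi hj h
    rcases List.suffix_cons_iff.1 h with rfl | h
    · exfalso
      obtain ⟨i, rfl⟩ := Nat.exists_eq_add_of_le hi
      cases p with
      | nil => rw [zeros_add_append] at hw; simp [zeros, List.replicate_succ] at hw
      | cons a p => simp [spread_cons] at hw
    · exact suffix_of_window_piece_zeros hi hj hw h
  have o : ∀ {i j : ℕ} {l : List Bool}, 3 ≤ i → 3 ≤ j →
      u <:+ false :: (spread p ++ (ones i ++ (zeros 3 ++ (ones j ++ l)))) → u <:+ l := by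
    intro i j l hi hj h
    rcases List.suffix_cons_iff.1 h with rfl | h
    · exfalso
      obtain ⟨i, rfl⟩ := Nat.exists_eq_add_of_le hi
      cases p with
      | nil => rw [ones_add_append] at hw; simp [ones, List.replicate_succ] at hw
      | cons a p => simp [spread_cons] at hw
    · exact suffix_of_window_piece_ones hi hj hw h
  rw [gadget₁_append] at hu
  rcases List.suffix_cons_iff.1 hu with rfl | hu
  · simp at hw
  have hu := z (by norm_num) (by norm_num) hu
  rcases List.suffix_cons_iff.1 hu with hu | hu
  · exact Or.inl hu
  have hu := z (by norm_num) (by norm_num) hu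
  rcases List.suffix_cons_iff.1 hu with hu | hu
  · exact Or.inr (Or.inl hu)
  have hu := o (by norm_num) (by norm_num) hu
  rcases List.suffix_cons_iff.1 hu with hu | hu
  · exact Or.inr (Or.inr (Or.inl hu))
  have hu := o (by norm_num) (by norm_num) hu
  rcases List.suffix_cons_iff.1 hu with hu | hu
  · exact Or.inr (Or.inr (Or.inr (Or.inl hu)))
  exact Or.inr (Or.inr (Or.inr (Or.inr (z (by norm_num) (by norm_num) hu))))

end Windows

section Occurrences

variable {x : Bool} {u p t : List Bool} {D : List (List Bool)} {m : ℕ}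

theorem window_flatMap_gadget₁ (hw : [false, false, x, true, false] <+: u)
    (hu : u <:+ D.flatMap gadget₁) : ∃ q E, q :: E <:+ D ∧
      (u = piece₂ q (E.flatMap gadget₁) ∨ u = piece₃ q (E.flatMap gadget₁) ∨
        u = piece₄ q (E.flatMap gadget₁) ∨ u = piece₅ q (E.flatMap gadget₁)) := by
  induction D with
  | nil => simp at hu; simp [hu] at hw
  | cons q D ih =>
    rw [List.flatMap_cons] at hu
    have h := window_gadget₁ hw hu
    simp only [← or_assoc] at h
    rcases h with h | h
    · exact ⟨q, D, List.suffix_refl _, by simpa only [← or_assoc] using h⟩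
    · obtain ⟨q', E, hE, h'⟩ := ih h
      exact ⟨q', E, hE.trans (List.suffix_cons _ _), h'⟩

theorem not_window_flatMap_gadget₁ (D : List (List Bool)) (g : List Bool → List Bool)
    (hg : ∀ q, ∃ l, g q = true :: false :: l) :
    ¬ [x, true, false] <+: D.flatMap g := by
  cases D with
  | nil => simp
  | cons q D =>
    obtain ⟨l, hl⟩ := hg q
    simp [List.flatMap_cons, hl]

theorem gadget₁_eq_cons (q : List Bool) : ∃ l, gadget₁ q = true :: false :: l := ⟨_, rfl⟩

/-- The occurrences of `00` followed by the spread of a pattern are the gadget pieces of this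
pattern that start with `00`. -/
theorem eq_piece_of_isPrefix (hm : 1 ≤ m) (hD : ∀ q ∈ D, q.length = m) (hp : p.length = m)
    (hu : u <:+ string₁ t D) (hpu : false :: false :: spread p <+: u) :
    ∃ E, p :: E <:+ D ∧
      (u = piece₂ p (E.flatMap gadget₁) ∨ u = piece₃ p (E.flatMap gadget₁) ∨
        u = piece₄ p (E.flatMap gadget₁) ∨ u = piece₅ p (E.flatMap gadget₁)) := by
  obtain ⟨a, p', rfl⟩ := List.exists_cons_of_ne_nil (List.ne_nil_of_length_pos (by omega : 0 < p.length))
  have hw : [false, false, a, true, false] <+: u := by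
    refine List.IsPrefix.trans ?_ hpu
    simp [spread_cons]
  rw [string₁_eq] at hu
  have hu' : u <:+ D.flatMap gadget₁ := by
    rcases List.suffix_cons_iff.1 hu with rfl | hu
    · simp at hw
    rcases List.suffix_cons_iff.1 hu with rfl | hu
    · exfalso
      cases t with
      | nil =>
        cases D with
        | nil => simp at hw
        | cons q D => simp [List.flatMap_cons, gadget₁] at hw
      | cons b t => simp [spread_cons] at hw
    · refine suffix_of_window_spread ?_ hw hu
      cases D with
      | nil => simp
      | cons q D => simp [List.flatMap_cons, gadget₁]
  obtain ⟨q, E, hE, h⟩ := window_flatMap_gadget₁ hw hu'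
  have hq : q.length = m := hD q (hE.subset (by simp))
  have : a :: p' = q := by
    rcases h with rfl | rfl | rfl | rfl <;>
    · simp only [piece₂, piece₃, piece₄, piece₅, List.cons_prefix_cons, true_and] at hpu
      exact eq_of_spread_isPrefix (by omega) hpu
  subst this
  exact ⟨E, hE, h⟩

/-! ### Occurrences of `10` followed by a spread pattern -/

theorem suffix_or_eq_of_isPrefix_spread {q r : List Bool}
    (hw : true :: false :: spread p <+: u) (hu : u <:+ spread q ++ r) :
    u <:+ r ∨ ∃ q', q' <:+ q ∧ q'.length < q.length ∧
      u = true :: false :: (spread q' ++ r) := by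
  induction q with
  | nil => left; simpa using hu
  | cons b q ih =>
    simp only [spread_cons, List.cons_append, List.suffix_cons_iff] at hu
    rcases hu with rfl | rfl | rfl | hu
    · simp at hw
    · exact Or.inr ⟨q, List.suffix_cons _ _, by simp, rfl⟩
    · simp at hw
    · rcases ih hu with h | ⟨q', h, hl, h'⟩
      · exact Or.inl h
      · exact Or.inr ⟨q', h.trans (List.suffix_cons _ _), by simp; omega, h'⟩

theorem suffix_of_isPrefix_ones {i : ℕ} {r : List Bool} (hp : p ≠ [])
    (hr : ∀ x, ¬ [false, x, true, false] <+: r) (hw : true :: false :: spread p <+: u)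
    (hu : u <:+ ones i ++ r) : u <:+ r := by
  obtain ⟨a, p', rfl⟩ := List.exists_cons_of_ne_nil hp
  induction i with
  | zero => simpa [ones] using hu
  | succ i ih =>
    simp only [ones, List.replicate_succ, List.cons_append, List.suffix_cons_iff] at hu
    rcases hu with rfl | hu
    · exfalso
      cases i with
      | zero =>
        refine hr a (List.IsPrefix.trans ?_ (List.cons_prefix_cons.1 hw).2)
        simp [spread_cons]
      | succ i => simp [List.replicate_succ] at hw
    · exact ih hu

theorem suffix_of_isPrefix_zeros {i : ℕ} {r : List Bool}
    (hw : true :: false :: spread p <+: u) (hu : u <:+ zeros i ++ r) : u <:+ r := by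
  induction i with
  | zero => simpa [zeros] using hu
  | succ i ih =>
    simp only [zeros, List.replicate_succ, List.cons_append, List.suffix_cons_iff] at hu
    rcases hu with rfl | hu
    · simp at hw
    · exact ih hu

theorem eq_gadget₁_of_isPrefix {q r : List Bool} (hp : p ≠ []) (hl : p.length = q.length)
    (hr : ∀ x, ¬ [false, x, true, false] <+: r) (hw : true :: false :: spread p <+: u)
    (hu : u <:+ gadget₁ q ++ r) : (q = p ∧ u = gadget₁ q ++ r) ∨ u <:+ r := by
  have s : ∀ {l}, (∀ x, ¬ [x, true, false] <+: l) → u <:+ spread q ++ l → u <:+ l := by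
    intro l hl' h
    rcases suffix_or_eq_of_isPrefix_spread hw h with h | ⟨q', -, h₁, rfl⟩
    · exact h
    · simp only [List.cons_prefix_cons, true_and] at hw
      have := (isPrefix_of_spread_isPrefix hl' hw).length_le
      omega
  have z : ∀ {i j l}, (∀ x, ¬ [false, x, true, false] <+: l) →
      u <:+ spread q ++ (zeros (2 + i) ++ (ones j ++ l)) → u <:+ l := by
    intro i j l hl' h
    refine suffix_of_isPrefix_ones hp hl' hw (suffix_of_isPrefix_zeros hw (s ?_ h))
    intro x
    rw [zeros_add_append]
    simp [zeros, List.replicate_succ]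
  have o : ∀ {i j l}, (∀ x, ¬ [false, x, true, false] <+: l) →
      u <:+ spread q ++ (ones (3 + i) ++ (zeros 3 ++ (ones j ++ l))) → u <:+ l := by
    intro i j l hl' h
    refine suffix_of_isPrefix_ones hp hl' hw (suffix_of_isPrefix_zeros hw
      (suffix_of_isPrefix_ones hp ?_ hw (s ?_ h)))
    · intro x; simp [zeros, List.replicate_succ]
    · intro x
      rw [ones_add_append]
      simp [ones, List.replicate_succ]
  have c : ∀ {l}, (∀ x, ¬ [false, x, true, false] <+: false :: false :: (spread q ++ l)) := by
    intro l x
    obtain ⟨a, q', rfl⟩ := List.exists_cons_of_ne_nil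
      (List.ne_nil_of_length_pos (by rw [← hl]; exact List.length_pos_of_ne_nil hp))
    simp [spread_cons]
  have d : ∀ {l}, u <:+ false :: l → u <:+ l := by
    intro l h
    rcases List.suffix_cons_iff.1 h with rfl | h
    · simp at hw
    · exact h
  rw [gadget₁_append] at hu ⊢
  rcases List.suffix_cons_iff.1 hu with rfl | hu
  · simp only [List.cons_prefix_cons, true_and] at hw
    exact Or.inl ⟨(eq_of_spread_isPrefix hl hw).symm, rfl⟩
  right
  have hu := d (d (z (i := 5) c (d hu)))
  have hu := d (d (z (i := 4) c hu))
  have hu := d (d (o (i := 0) c hu))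
  have hu := d (d (o (i := 1) c hu))
  exact z (i := 6) hr hu

/-- The occurrences of `10` followed by the spread of a pattern are the gadget of this pattern
and those that come from an occurrence of the pattern in the text. -/
theorem eq_spread_or_eq_gadget₁ (hm : 1 ≤ m) (hD : ∀ q ∈ D, q.length = m) (hp : p.length = m)
    (hu : u <:+ string₁ t D) (hpu : true :: false :: spread p <+: u) :
    (∃ q, q <:+ t ∧ p <+: q ∧ u = true :: false :: (spread q ++ D.flatMap gadget₁)) ∨
      ∃ E, p :: E <:+ D ∧ u = (p :: E).flatMap gadget₁ := by
  have hp0 : p ≠ [] := List.ne_nil_of_length_pos (by omega)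
  have hD1 : ∀ x, ¬ [x, true, false] <+: D.flatMap gadget₁ := fun x =>
    not_window_flatMap_gadget₁ D _ gadget₁_eq_cons
  rw [string₁_eq] at hu
  rcases List.suffix_cons_iff.1 hu with rfl | hu
  · simp only [List.cons_prefix_cons, true_and] at hpu
    exact Or.inl ⟨t, List.suffix_refl _, isPrefix_of_spread_isPrefix hD1 hpu, rfl⟩
  rcases List.suffix_cons_iff.1 hu with rfl | hu
  · simp at hpu
  rcases suffix_or_eq_of_isPrefix_spread hpu hu with hu' | ⟨q', h₁, -, rfl⟩
  · right
    clear * - hD hp hpu hp0 hu'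
    induction D with
    | nil => simp at hu'; simp [hu'] at hpu
    | cons q D ih =>
      rw [List.flatMap_cons] at hu'
      have hr : ∀ x, ¬ [false, x, true, false] <+: D.flatMap gadget₁ := by
        intro x
        cases D with
        | nil => simp
        | cons q D => simp [List.flatMap_cons, gadget₁]
      rcases eq_gadget₁_of_isPrefix hp0 (by rw [hp, hD q (by simp)]) hr hpu hu' with
        ⟨rfl, h⟩ | h
      · exact ⟨D, List.suffix_refl _, by rw [List.flatMap_cons, h]⟩
      · obtain ⟨E, hE, h'⟩ := ih (fun q hq => hD q (by simp [hq])) h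
        exact ⟨E, hE.trans (List.suffix_cons _ _), h'⟩
  · simp only [List.cons_prefix_cons, true_and] at hpu
    exact Or.inl ⟨q', h₁, isPrefix_of_spread_isPrefix hD1 hpu, rfl⟩

theorem eq_of_cons_suffix {α : Type*} {p : α} {D E F : List α} (hD : D.Nodup)
    (hE : p :: E <:+ D) (hF : p :: F <:+ D) : E = F := by
  have aux : ∀ {E F : List α}, p :: E <:+ p :: F → (p :: F).Nodup → E = F := by
    intro E F h hn
    rcases List.suffix_cons_iff.1 h with h | h
    · exact (List.cons.inj h).2
    · exact absurd (h.subset (by simp)) (List.nodup_cons.1 hn).1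
  rcases List.suffix_or_suffix_of_suffix hE hF with h | h
  · exact aux h (hD.sublist hF.sublist)
  · exact (aux h (hD.sublist hE.sublist)).symm

end Occurrences

/-! ### Matching the suffixes of the two strings -/

/-- A pair of annotated suffixes, the first one of `string₁ t D` and the second one of
`string₂ t D`. -/
abbrev SuffixPair := (Bool × List Bool) × (Bool × List Bool)

/-- The pairs of annotated suffixes `z ++ R₁` and `z ++ R₂`, where `z` runs through the nonempty
suffixes of `Z`; the annotations for `z = Z` are `c₁` and `c₂`. -/
def paired : Bool → Bool → List Bool → List Bool → List Bool → List SuffixPair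
  | _, _, [], _, _ => []
  | c₁, c₂, a :: Z, R₁, R₂ => ((c₁, a :: Z ++ R₁), (c₂, a :: Z ++ R₂)) :: paired a a Z R₁ R₂

theorem map_fst_paired (c₁ c₂ : Bool) (Z R₁ R₂ : List Bool) :
    (paired c₁ c₂ Z R₁ R₂).map Prod.fst = annotated c₁ Z R₁ := by
  induction Z generalizing c₁ c₂ with
  | nil => rfl
  | cons a Z ih => simp [paired, annotated, ih]

theorem map_snd_paired (c₁ c₂ : Bool) (Z R₁ R₂ : List Bool) :
    (paired c₁ c₂ Z R₁ R₂).map Prod.snd = annotated c₂ Z R₂ := by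
  induction Z generalizing c₁ c₂ with
  | nil => rfl
  | cons a Z ih => simp [paired, annotated, ih]

theorem fst_eq_of_mem_paired {c : Bool} {Z R₁ R₂ : List Bool} {x : SuffixPair}
    (h : x ∈ paired c c Z R₁ R₂) : x.1.1 = x.2.1 := by
  induction Z generalizing c with
  | nil => simp [paired] at h
  | cons a Z ih =>
    simp only [paired, List.mem_cons] at h
    rcases h with rfl | h
    · rfl
    · exact ih h

theorem exists_of_mem_paired {c₁ c₂ : Bool} {Z R₁ R₂ : List Bool} {x : SuffixPair}
    (h : x ∈ paired c₁ c₂ Z R₁ R₂) :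
    ∃ z, z ≠ [] ∧ z <:+ Z ∧ x.1.2 = z ++ R₁ ∧ x.2.2 = z ++ R₂ ∧ (x.1.1 ≠ x.2.1 → z = Z) := by
  induction Z generalizing c₁ c₂ with
  | nil => simp [paired] at h
  | cons a Z ih =>
    simp only [paired, List.mem_cons] at h
    rcases h with rfl | h
    · exact ⟨a :: Z, by simp, List.suffix_refl _, rfl, rfl, fun _ => rfl⟩
    · obtain ⟨z, h₁, h₂, h₃, h₄, -⟩ := ih h
      exact ⟨z, h₁, h₂.trans (List.suffix_cons _ _), h₃, h₄,
        fun hne => absurd (fst_eq_of_mem_paired h) hne⟩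

theorem exists_mem_paired {c₁ c₂ : Bool} {Z R₁ R₂ z : List Bool} (hz : z ≠ []) (h : z <:+ Z) :
    ∃ x ∈ paired c₁ c₂ Z R₁ R₂, x.1.2 = z ++ R₁ ∧ x.2.2 = z ++ R₂ := by
  induction Z generalizing c₁ c₂ with
  | nil => simp at h; exact absurd h hz
  | cons a Z ih =>
    rcases List.suffix_cons_iff.1 h with rfl | h
    · exact ⟨_, List.mem_cons_self, rfl, rfl⟩
    · obtain ⟨x, hx, h'⟩ := ih h (c₁ := a) (c₂ := a)
      exact ⟨x, List.mem_cons_of_mem _ hx, h'⟩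

theorem mem_paired_self {c₁ c₂ : Bool} {Z R₁ R₂ : List Bool} (hZ : Z ≠ []) :
    ((c₁, Z ++ R₁), (c₂, Z ++ R₂)) ∈ paired c₁ c₂ Z R₁ R₂ := by
  cases Z with
  | nil => exact absurd rfl hZ
  | cons a Z => exact List.mem_cons_self

/-- The part of the first piece of `gadget₁ p` between its first symbol and its last four. -/
def core₇ (p : List Bool) : List Bool := false :: (spread p ++ zeros 7)

/-- The part of the first piece of `gadget₂ p` between its first symbol and its last four. -/
def core₆ (p : List Bool) : List Bool := false :: (spread p ++ (zeros 6 ++ [true]))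

theorem ones_five (r : List Bool) : ones 5 ++ r = true :: (ones 4 ++ r) := rfl

theorem piece₂_eq (p r : List Bool) :
    piece₂ p r = false :: (core₆ p ++ (ones 4 ++ piece₃ p r)) := by
  simp [piece₂, core₆, ones_five]

theorem piece₂'_eq (p r : List Bool) :
    piece₂' p r = false :: (core₇ p ++ (ones 4 ++ piece₃ p r)) := by
  simp [piece₂', core₇]

theorem piece₃_nil_append (p r : List Bool) : piece₃ p [] ++ r = piece₃ p r := by
  simp [piece₃, piece₄, piece₅]

/-- The matching of the suffixes that start in a gadget. Suffixes that start in the cores of the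
first two pieces are matched across these pieces, all others position by position. -/
def gadgetPairs (c : Bool) (p r₁ r₂ : List Bool) : List SuffixPair :=
  paired c c [true] (core₇ p ++ (ones 4 ++ piece₂ p r₁)) (core₆ p ++ (ones 4 ++ piece₂' p r₂)) ++
  (paired true false (core₇ p) (ones 4 ++ piece₂ p r₁) (ones 4 ++ piece₃ p r₂) ++
  (paired false true (ones 4 ++ [false]) (core₆ p ++ (ones 4 ++ piece₃ p r₁))
    (core₇ p ++ (ones 4 ++ piece₃ p r₂)) ++
  (paired false true (core₆ p) (ones 4 ++ piece₃ p r₁) (ones 4 ++ piece₂' p r₂) ++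
  paired true false (ones 4 ++ piece₃ p []) r₁ r₂)))

theorem getLastD_append (a b : List Bool) (c : Bool) :
    (a ++ b).getLastD c = b.getLastD (a.getLastD c) := by
  cases b using List.reverseRecOn <;> simp

theorem getLastD_core₇ (p : List Bool) (c : Bool) : (core₇ p).getLastD c = false := by
  rw [core₇, ← List.cons_append, getLastD_append]; rfl

theorem getLastD_core₆ (p : List Bool) (c : Bool) : (core₆ p).getLastD c = true := by
  simp [core₆, List.getLast?_cons, List.getLast?_append]

theorem map_fst_gadgetPairs (c : Bool) (p r₁ r₂ : List Bool) :
    (gadgetPairs c p r₁ r₂).map Prod.fst = annotated c (gadget₁ p) r₁ := by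
  have : gadget₁ p = [true] ++ (core₇ p ++ ((ones 4 ++ [false]) ++
      (core₆ p ++ (ones 4 ++ piece₃ p [])))) := by
    have := gadget₁_append p []
    rw [List.append_nil] at this
    rw [this, piece₂_eq]
    simp [core₇]
  rw [this, annotated_append _ [true], annotated_append _ (core₇ p),
    annotated_append _ (ones 4 ++ [false]), annotated_append _ (core₆ p)]
  simp only [gadgetPairs, List.map_append, map_fst_paired, getLastD_core₇, getLastD_core₆]
  simp [piece₂_eq, piece₃_nil_append, ones]

theorem map_snd_gadgetPairs (c : Bool) (p r₁ r₂ : List Bool) :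
    ((gadgetPairs c p r₁ r₂).map Prod.snd).Perm (annotated c (gadget₂ p) r₂) := by
  have : gadget₂ p = [true] ++ (core₆ p ++ ((ones 4 ++ [false]) ++
      (core₇ p ++ (ones 4 ++ piece₃ p [])))) := by
    have := gadget₂_append p []
    rw [List.append_nil] at this
    rw [this, piece₂'_eq]
    simp [core₆, ones_five]
  rw [this, annotated_append _ [true], annotated_append _ (core₆ p),
    annotated_append _ (ones 4 ++ [false]), annotated_append _ (core₇ p)]
  simp only [gadgetPairs, List.map_append, map_snd_paired, getLastD_core₇, getLastD_core₆]
  simp only [piece₂'_eq, List.append_assoc, piece₃_nil_append,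
    List.cons_append, List.nil_append]
  have perm : ∀ b c d e : List (Bool × List Bool),
      (b ++ (c ++ (d ++ e))).Perm (d ++ (c ++ (b ++ e))) := by
    intro b c d e
    simp only [← List.append_assoc]
    refine List.Perm.append_right e ?_
    rw [List.append_assoc, List.append_assoc d]
    refine List.perm_append_comm.trans ?_
    rw [List.append_assoc]
    refine (List.Perm.append_left _ (List.Perm.refl _)).trans ?_
    exact ((List.perm_append_comm (l₁ := c) (l₂ := d ++ b)).trans (by
      rw [List.append_assoc]
      exact List.Perm.append_left d List.perm_append_comm))
  exact List.Perm.append_left _ (perm _ _ _ _)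

theorem getLastD_gadget₁ (p : List Bool) (c : Bool) : (gadget₁ p).getLastD c = true := by
  simp [gadget₁, ones, List.getLast?_cons, List.getLast?_append, List.replicate_succ]

theorem getLastD_gadget₂ (p : List Bool) (c : Bool) : (gadget₂ p).getLastD c = true := by
  simp [gadget₂, ones, List.getLast?_cons, List.getLast?_append, List.replicate_succ]

/-- The matching of the suffixes that start in the gadgets of the patterns in `D`. -/
def gadgetsPairs : Bool → List (List Bool) → List SuffixPair
  | _, [] => []
  | c, p :: D =>
    gadgetPairs c p (D.flatMap gadget₁) (D.flatMap gadget₂) ++ gadgetsPairs true D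

theorem map_fst_gadgetsPairs (c : Bool) (D : List (List Bool)) :
    (gadgetsPairs c D).map Prod.fst = annotated c (D.flatMap gadget₁) [] := by
  induction D generalizing c with
  | nil => rfl
  | cons p D ih =>
    rw [List.flatMap_cons, annotated_append, gadgetsPairs, List.map_append, map_fst_gadgetPairs,
      ih, getLastD_gadget₁, List.append_nil]

theorem map_snd_gadgetsPairs (c : Bool) (D : List (List Bool)) :
    ((gadgetsPairs c D).map Prod.snd).Perm (annotated c (D.flatMap gadget₂) []) := by
  induction D generalizing c with
  | nil => exact List.Perm.refl _
  | cons p D ih =>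
    rw [List.flatMap_cons, annotated_append, gadgetsPairs, List.map_append, getLastD_gadget₂,
      List.append_nil]
    exact (map_snd_gadgetPairs _ _ _ _).append (ih true)

/-- The matching of the suffixes of `string₁ t D` with those of `string₂ t D`. -/
def suffixPairs (t : List Bool) (D : List (List Bool)) : List SuffixPair :=
  paired true true (true :: false :: spread t) (D.flatMap gadget₁) (D.flatMap gadget₂) ++
    gadgetsPairs false D

theorem getLastD_spread (t : List Bool) (c : Bool) :
    (true :: false :: spread t).getLastD c = false := by
  induction t generalizing c with
  | nil => rfl
  | cons a t ih =>
    have := ih true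
    simp [spread_cons] at this ⊢
    exact this

theorem getLastD_flatMap {D : List (List Bool)} (hD : D ≠ []) (g : List Bool → List Bool)
    (hg : ∀ p c, (g p).getLastD c = true) (c : Bool) : (D.flatMap g).getLastD c = true := by
  induction D generalizing c with
  | nil => exact absurd rfl hD
  | cons p D ih =>
    rw [List.flatMap_cons]
    rw [getLastD_append, hg]
    cases D with
    | nil => rfl
    | cons q D => exact ih (by simp) true

theorem map_fst_suffixPairs {D : List (List Bool)} (hD : D ≠ []) (t : List Bool) :
    (suffixPairs t D).map Prod.fst =
      annotated ((string₁ t D).getLastD false) (string₁ t D) [] := by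
  have hl : (string₁ t D).getLastD false = true := by
    rw [string₁, getLastD_append, getLastD_flatMap hD _ getLastD_gadget₁]
  rw [hl, suffixPairs, List.map_append, map_fst_paired, map_fst_gadgetsPairs, string₁_eq,
    ← List.cons_append, ← List.cons_append, annotated_append, getLastD_spread, List.append_nil]

theorem map_snd_suffixPairs {D : List (List Bool)} (hD : D ≠ []) (t : List Bool) :
    ((suffixPairs t D).map Prod.snd).Perm
      (annotated ((string₂ t D).getLastD false) (string₂ t D) []) := by
  have hl : (string₂ t D).getLastD false = true := by
    rw [string₂, getLastD_append, getLastD_flatMap hD _ getLastD_gadget₂]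
  rw [hl, suffixPairs, List.map_append, map_snd_paired, string₂_eq,
    ← List.cons_append, ← List.cons_append, annotated_append, getLastD_spread, List.append_nil]
  exact List.Perm.append_left _ (map_snd_gadgetsPairs _ _)

theorem exists_of_mem_gadgetsPairs {c : Bool} {D : List (List Bool)} {x : SuffixPair}
    (h : x ∈ gadgetsPairs c D) : ∃ c' p E, p :: E <:+ D ∧
      x ∈ gadgetPairs c' p (E.flatMap gadget₁) (E.flatMap gadget₂) := by
  induction D generalizing c with
  | nil => simp [gadgetsPairs] at h
  | cons p D ih =>
    rw [gadgetsPairs, List.mem_append] at h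
    rcases h with h | h
    · exact ⟨c, p, D, List.suffix_refl _, h⟩
    · obtain ⟨c', p', E, hE, h'⟩ := ih h
      exact ⟨c', p', E, hE.trans (List.suffix_cons _ _), h'⟩

theorem exists_gadgetPairs_subset {D E : List (List Bool)} {p : List Bool} (t : List Bool)
    (h : p :: E <:+ D) : ∃ c', ∀ x ∈ gadgetPairs c' p (E.flatMap gadget₁) (E.flatMap gadget₂),
      x ∈ suffixPairs t D := by
  have aux : ∀ c, ∃ c', ∀ x ∈ gadgetPairs c' p (E.flatMap gadget₁) (E.flatMap gadget₂),
      x ∈ gadgetsPairs c D := by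
    induction D with
    | nil => simp at h
    | cons q D ih =>
      intro c
      rcases List.suffix_cons_iff.1 h with h | h
      · obtain ⟨rfl, rfl⟩ := List.cons.inj h
        exact ⟨c, fun x hx => by rw [gadgetsPairs]; exact List.mem_append_left _ hx⟩
      · obtain ⟨c', h'⟩ := ih h true
        exact ⟨c', fun x hx => by rw [gadgetsPairs]; exact List.mem_append_right _ (h' x hx)⟩
  obtain ⟨c', h'⟩ := aux false
  exact ⟨c', fun x hx => List.mem_append_right _ (h' x hx)⟩

theorem nodup_map_snd_annotated (c : Bool) (Z R : List Bool) :
    ((annotated c Z R).map Prod.snd).Nodup := by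
  rw [annotated_eq_map, List.map_map]
  refine List.Nodup.map_on ?_ List.nodup_range
  intro i hi j hj h
  have := congrArg List.length h
  simp at this hi hj
  omega

theorem suffixPairs_inj₁ {D : List (List Bool)} (hD : D ≠ []) {t : List Bool} {x y : SuffixPair}
    (hx : x ∈ suffixPairs t D) (hy : y ∈ suffixPairs t D) (h : x.1.2 = y.1.2) : x = y := by
  refine List.inj_on_of_nodup_map (f := fun z : SuffixPair => z.1.2) ?_ hx hy h
  have := nodup_map_snd_annotated ((string₁ t D).getLastD false) (string₁ t D) []
  rw [← map_fst_suffixPairs hD, List.map_map] at this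
  exact this

theorem suffixPairs_inj₂ {D : List (List Bool)} (hD : D ≠ []) {t : List Bool} {x y : SuffixPair}
    (hx : x ∈ suffixPairs t D) (hy : y ∈ suffixPairs t D) (h : x.2.2 = y.2.2) : x = y := by
  refine List.inj_on_of_nodup_map (f := fun z : SuffixPair => z.2.2) ?_ hx hy h
  have := nodup_map_snd_annotated ((string₂ t D).getLastD false) (string₂ t D) []
  rw [← ((map_snd_suffixPairs hD t).map Prod.snd).nodup_iff, List.map_map] at this
  exact this

theorem suffix_of_mem_suffixPairs {D : List (List Bool)} (hD : D ≠ []) {t : List Bool}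
    {x : SuffixPair} (hx : x ∈ suffixPairs t D) :
    x.1.2 = string₁ t D ∨ x.1.1 :: x.1.2 <:+ string₁ t D := by
  have : x.1 ∈ (suffixPairs t D).map Prod.fst := List.mem_map_of_mem hx
  rw [map_fst_suffixPairs hD] at this
  rcases mem_annotated this with h | h
  · left; rw [h]; simp
  · right; simpa using h

theorem eq_of_cons_suffix_of_cons_suffix {a b : Bool} {l S : List Bool} (ha : a :: l <:+ S)
    (hb : b :: l <:+ S) : a = b := by
  have h := List.suffix_of_suffix_length_le ha hb (by simp)
  have := h.eq_of_length (by simp)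
  exact (List.cons.inj this).1

section Order

variable {t : List Bool} {D E : List (List Bool)} {m : ℕ} {x y : SuffixPair} {p : List Bool}

theorem suffixPairs_cases (hx : x ∈ suffixPairs t D) :
    (∃ Z E, E <:+ D ∧ x.1.2 = Z ++ E.flatMap gadget₁ ∧ x.2.2 = Z ++ E.flatMap gadget₂) ∨
    ∃ p E, p :: E <:+ D ∧
      ((∃ a, a ≤ 4 ∧ x.1.2 = ones a ++ piece₂ p (E.flatMap gadget₁) ∧
          x.2.2 = ones a ++ piece₂' p (E.flatMap gadget₂)) ∨
      (∃ z, z ≠ [] ∧ z <:+ core₇ p ∧ x.1.2 = z ++ (ones 4 ++ piece₂ p (E.flatMap gadget₁)) ∧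
          x.2.2 = z ++ (ones 4 ++ piece₃ p (E.flatMap gadget₂))) ∨
      (∃ z, z ≠ [] ∧ z <:+ core₆ p ∧ x.1.2 = z ++ (ones 4 ++ piece₃ p (E.flatMap gadget₁)) ∧
          x.2.2 = z ++ (ones 4 ++ piece₂' p (E.flatMap gadget₂)))) := by
  rw [suffixPairs, List.mem_append] at hx
  rcases hx with hx | hx
  · obtain ⟨z, -, -, h₁, h₂, -⟩ := exists_of_mem_paired hx
    exact Or.inl ⟨z, D, List.suffix_refl _, h₁, h₂⟩
  obtain ⟨c, p, E, hE, hx⟩ := exists_of_mem_gadgetsPairs hx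
  simp only [gadgetPairs, List.mem_append] at hx
  rcases hx with hx | hx | hx | hx | hx
  · obtain ⟨z, hz, hz', h₁, h₂, -⟩ := exists_of_mem_paired hx
    have : z = [true] := by
      simp only [List.suffix_cons_iff, List.suffix_nil] at hz'
      tauto
    subst this
    left
    refine ⟨[], p :: E, hE, ?_, ?_⟩
    · rw [h₁, List.flatMap_cons, gadget₁_append]; simp [core₇]
    · rw [h₂, List.flatMap_cons, gadget₂_append]; simp [core₆, ones_five]
  · obtain ⟨z, hz, hz', h₁, h₂, -⟩ := exists_of_mem_paired hx
    exact Or.inr ⟨p, E, hE, Or.inr (Or.inl ⟨z, hz, hz', h₁, h₂⟩)⟩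
  · obtain ⟨z, hz, hz', h₁, h₂, -⟩ := exists_of_mem_paired hx
    have : ∃ a ≤ 4, z = ones a ++ [false] := by
      simp only [ones, List.replicate_succ, List.replicate_zero, List.cons_append,
        List.nil_append, List.suffix_cons_iff, List.suffix_nil] at hz'
      rcases hz' with rfl | rfl | rfl | rfl | rfl | rfl
      · exact ⟨4, by norm_num, rfl⟩
      · exact ⟨3, by norm_num, rfl⟩
      · exact ⟨2, by norm_num, rfl⟩
      · exact ⟨1, by norm_num, rfl⟩
      · exact ⟨0, by norm_num, rfl⟩
      · exact absurd rfl hz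
    obtain ⟨a, ha, rfl⟩ := this
    refine Or.inr ⟨p, E, hE, Or.inl ⟨a, ha, ?_, ?_⟩⟩
    · rw [h₁, piece₂_eq]; simp
    · rw [h₂, piece₂'_eq]; simp
  · obtain ⟨z, hz, hz', h₁, h₂, -⟩ := exists_of_mem_paired hx
    exact Or.inr ⟨p, E, hE, Or.inr (Or.inr ⟨z, hz, hz', h₁, h₂⟩)⟩
  · obtain ⟨z, -, -, h₁, h₂, -⟩ := exists_of_mem_paired hx
    exact Or.inl ⟨z, E, (List.suffix_cons _ _).trans hE, h₁, h₂⟩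

theorem ne_nil_of_cons_suffix (hE : p :: E <:+ D) : D ≠ [] := by
  rintro rfl; simp at hE

theorem suffix_string₁_of_mem (hD : D ≠ []) (hx : x ∈ suffixPairs t D) :
    x.1.2 <:+ string₁ t D := by
  rcases suffix_of_mem_suffixPairs hD hx with h | h
  · rw [h]
  · exact (List.suffix_cons _ _).trans h

theorem gadget₁_suffix_string₁ (hE : p :: E <:+ D) :
    gadget₁ p ++ E.flatMap gadget₁ <:+ string₁ t D := by
  obtain ⟨F, rfl⟩ := hE
  rw [string₁, List.flatMap_append, ← List.append_assoc]
  exact List.suffix_append _ _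

theorem snd_eq_of_suffix_rest (hE : p :: E <:+ D) (hy : y ∈ suffixPairs t D) {z : List Bool}
    (hz : z ≠ []) (h : z <:+ ones 4 ++ piece₃ p []) (h₁ : y.1.2 = z ++ E.flatMap gadget₁) :
    y.2.2 = z ++ E.flatMap gadget₂ := by
  obtain ⟨c, hc⟩ := exists_gadgetPairs_subset t hE
  obtain ⟨y', hy', h₁', h₂'⟩ := exists_mem_paired (c₁ := true) (c₂ := false)
    (R₁ := E.flatMap gadget₁) (R₂ := E.flatMap gadget₂) hz h
  have hy'' : y' ∈ suffixPairs t D := hc _ (by simp only [gadgetPairs, List.mem_append]; tauto)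
  rw [suffixPairs_inj₁ (ne_nil_of_cons_suffix hE) hy hy'' (by rw [h₁, h₁']), h₂']

/-- The two components of a pair of pairs are ordered in the same way. -/
def Consistent (x y : SuffixPair) : Prop :=
  (x.1.2 < y.1.2 ∧ x.2.2 < y.2.2) ∨ (y.1.2 < x.1.2 ∧ y.2.2 < x.2.2)

theorem suffix₅ (p r : List Bool) :
    ones 4 ++ (zeros 3 ++ (ones 4 ++ piece₅ p r)) <:+ ones 4 ++ piece₃ p r := by
  refine ⟨ones 4 ++ (false :: false :: (spread p ++ (ones 3 ++ (zeros 3 ++ (ones 5 ++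
    (false :: false :: spread p)))))), ?_⟩
  simp [piece₃, piece₄]

theorem suffix₄ (p r : List Bool) :
    ones 3 ++ (zeros 3 ++ (ones 5 ++ piece₄ p r)) <:+ ones 4 ++ piece₃ p r := by
  refine ⟨ones 4 ++ (false :: false :: spread p), ?_⟩
  simp [piece₃]

theorem piece₄_nil_append (p r : List Bool) : piece₄ p [] ++ r = piece₄ p r := by
  simp [piece₄, piece₅]

theorem piece₅_nil_append (p r : List Bool) : piece₅ p [] ++ r = piece₅ p r := by
  simp [piece₅]

theorem suffix₃ (hE : p :: E <:+ D) :
    true :: (ones 4 ++ piece₃ p (E.flatMap gadget₁)) <:+ string₁ t D := by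
  refine List.IsSuffix.trans ?_ (gadget₁_suffix_string₁ hE)
  refine ⟨true :: false :: (spread p ++ (zeros 7 ++ (ones 4 ++ (false :: false ::
    (spread p ++ zeros 6))))), ?_⟩
  simp [gadget₁_append, piece₂, ones_five]

theorem suffix₂ (hE : p :: E <:+ D) :
    false :: (ones 4 ++ piece₂ p (E.flatMap gadget₁)) <:+ string₁ t D := by
  refine List.IsSuffix.trans ?_ (gadget₁_suffix_string₁ hE)
  refine ⟨true :: false :: (spread p ++ zeros 6), ?_⟩
  rw [gadget₁_append]
  simp [zeros, List.replicate_succ]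

end Order

/-! ### Prefixes that decide the order of matched suffixes -/

section Keys

variable {t : List Bool} {D E : List (List Bool)} {m : ℕ} {x y : SuffixPair} {p : List Bool}

theorem rest_suffix_string₁ (hE : p :: E <:+ D) :
    ones 4 ++ piece₃ p (E.flatMap gadget₁) <:+ string₁ t D :=
  (List.suffix_cons _ _).trans (suffix₃ hE)

/-- `K` is a common prefix of the two suffixes matched by `x`. Either it is all of them, or every
other pair whose first suffix starts with `K` is ordered consistently with `x`. -/
def IsKey (t : List Bool) (D : List (List Bool)) (x : SuffixPair) (K : List Bool) : Prop :=
  K <+: x.1.2 ∧ K <+: x.2.2 ∧ ((x.1.2 = K ∧ x.2.2 = K) ∨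
    ∀ y ∈ suffixPairs t D, K <+: y.1.2 → y.1.2 ≠ x.1.2 → Consistent x y)

theorem exists_isKey_of_common (hm : 1 ≤ m) (hD : ∀ q ∈ D, q.length = m) (hn : D.Nodup)
    (hD0 : D ≠ []) {Z : List Bool} (hE : E <:+ D) (h₁ : x.1.2 = Z ++ E.flatMap gadget₁)
    (h₂ : x.2.2 = Z ++ E.flatMap gadget₂) : ∃ K, IsKey t D x K := by
  cases E with
  | nil => exact ⟨Z, by simp [h₁], by simp [h₂], Or.inl (by simp [h₁, h₂])⟩
  | cons p E =>
    refine ⟨Z ++ (true :: false :: (spread p ++ zeros 6)), ?_, ?_, Or.inr ?_⟩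
    · rw [h₁, List.flatMap_cons, gadget₁_append, List.prefix_append_right_inj]
      refine ⟨[false] ++ (ones 4 ++ piece₂ p (E.flatMap gadget₁)), ?_⟩
      simp [zeros, List.replicate_succ]
    · rw [h₂, List.flatMap_cons, gadget₂_append, List.prefix_append_right_inj]
      refine ⟨ones 5 ++ piece₂' p (E.flatMap gadget₂), ?_⟩
      simp [zeros, List.replicate_succ]
    · intro y hy ⟨w, hw⟩ hne
      exfalso
      rw [List.append_assoc] at hw
      have hs : true :: false :: (spread p ++ zeros 6) ++ w <:+ string₁ t D :=
        (List.suffix_append _ _).trans (hw ▸ suffix_string₁_of_mem hD0 hy)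
      rcases eq_spread_or_eq_gadget₁ hm hD (hD p (hE.subset (by simp))) hs
        ⟨zeros 6 ++ w, by simp⟩ with ⟨q, -, ⟨q', rfl⟩, h⟩ | ⟨E', hE', h⟩
      · simp only [spread_append, List.cons_append, List.append_assoc, List.cons.injEq, true_and,
          List.append_cancel_left_eq] at h
        cases q' with
        | nil =>
          obtain ⟨q, D', rfl⟩ := List.exists_cons_of_ne_nil hD0
          obtain ⟨l, hl⟩ := gadget₁_eq_cons q
          simp [List.flatMap_cons, hl, zeros, List.replicate_succ] at h
        | cons b q' => simp [spread_cons, zeros, List.replicate_succ] at h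
      · rw [eq_of_cons_suffix hn hE' hE] at h
        rw [h, ← h₁] at hw
        exact hne hw.symm

theorem spread_append_cancel (p a b : List Bool) :
    (false :: false :: (spread p ++ a)) <+: (false :: false :: (spread p ++ b)) ↔ a <+: b := by
  simp

theorem exists_isKey_of_ones (hm : 1 ≤ m) (hD : ∀ q ∈ D, q.length = m) (hn : D.Nodup)
    (hD0 : D ≠ []) {a : ℕ} (ha : a ≤ 4) (hE : p :: E <:+ D)
    (h₁ : x.1.2 = ones a ++ piece₂ p (E.flatMap gadget₁))
    (h₂ : x.2.2 = ones a ++ piece₂' p (E.flatMap gadget₂)) : ∃ K, IsKey t D x K := by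
  refine ⟨ones a ++ (false :: false :: (spread p ++ zeros 6)), ?_, ?_, Or.inr ?_⟩
  · rw [h₁, List.prefix_append_right_inj, piece₂, spread_append_cancel]
    exact List.prefix_append _ _
  · rw [h₂, List.prefix_append_right_inj, piece₂', spread_append_cancel]
    exact ⟨[false] ++ (ones 4 ++ piece₃ p (E.flatMap gadget₂)), rfl⟩
  · intro y hy ⟨w, hw⟩ hne
    rw [List.append_assoc] at hw
    have hs : false :: false :: (spread p ++ zeros 6) ++ w <:+ string₁ t D :=
      (List.suffix_append _ _).trans (hw ▸ suffix_string₁_of_mem hD0 hy)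
    obtain ⟨E', hE', h⟩ := eq_piece_of_isPrefix hm hD (hD p (hE.subset (by simp))) hs
      ⟨zeros 6 ++ w, by simp⟩
    rw [eq_of_cons_suffix hn hE' hE] at h
    rcases h with h | h | h | h
    · rw [h, ← h₁] at hw
      exact absurd hw.symm hne
    · simp [piece₃, zeros, ones, List.replicate_succ] at h
    · simp [piece₄, zeros, ones, List.replicate_succ] at h
    · have hy₁ : y.1.2 = (ones a ++ piece₅ p []) ++ E.flatMap gadget₁ := by
        rw [← hw, h, List.append_assoc, piece₅_nil_append]
      have hy₂ := snd_eq_of_suffix_rest hE hy (by simp [piece₅]) (by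
        refine List.IsSuffix.trans ?_ (suffix₅ p [])
        obtain ⟨b, hb⟩ := Nat.exists_eq_add_of_le' ha
        refine ⟨ones 4 ++ (zeros 3 ++ ones b), ?_⟩
        have h₄ := ones_add_append b a (piece₅ p [])
        rw [← hb] at h₄
        rw [h₄]
        simp) hy₁
      right
      rw [hy₁, hy₂, h₁, h₂, List.append_assoc, List.append_assoc, append_lt_append_left_iff,
        append_lt_append_left_iff, piece₅_nil_append, piece₅_nil_append]
      simp [piece₂, piece₂', piece₅, append_lt_append_left_iff, List.cons_lt_cons_iff, zeros,
        ones, List.replicate_succ]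

theorem exists_isKey_of_core₇ (hm : 1 ≤ m) (hD : ∀ q ∈ D, q.length = m) (hn : D.Nodup)
    (hD0 : D ≠ []) {z : List Bool} (hz : z ≠ []) (hz' : z <:+ core₇ p) (hE : p :: E <:+ D)
    (h₁ : x.1.2 = z ++ (ones 4 ++ piece₂ p (E.flatMap gadget₁)))
    (h₂ : x.2.2 = z ++ (ones 4 ++ piece₃ p (E.flatMap gadget₂))) : ∃ K, IsKey t D x K := by
  refine ⟨z ++ (ones 4 ++ (false :: false :: spread p)), ?_, ?_, Or.inr ?_⟩
  · rw [h₁, List.prefix_append_right_inj, List.prefix_append_right_inj, piece₂]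
    simp
  · rw [h₂, List.prefix_append_right_inj, List.prefix_append_right_inj, piece₃]
    simp
  · intro y hy ⟨w, hw⟩ hne
    rw [List.append_assoc, List.append_assoc] at hw
    have hy' := suffix_string₁_of_mem hD0 hy
    have hs : false :: false :: spread p ++ w <:+ string₁ t D :=
      ((List.suffix_append _ _).trans (List.suffix_append _ _)).trans (hw ▸ hy')
    obtain ⟨E', hE', h⟩ := eq_piece_of_isPrefix hm hD (hD p (hE.subset (by simp))) hs
      ⟨w, by simp⟩
    rw [eq_of_cons_suffix hn hE' hE] at h
    -- the part before the four ones ends with a zero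
    obtain ⟨z₀, rfl⟩ : ∃ z₀, z = z₀ ++ [false] := by
      obtain ⟨z₀, b, rfl⟩ := List.eq_nil_or_concat' z |>.resolve_left hz
      have : [b] <:+ zeros 7 := by
        refine List.suffix_of_suffix_length_le ((List.suffix_append _ _).trans hz')
          (List.suffix_append (false :: spread p) _) (by simp [zeros])
      have := this.subset (List.mem_singleton_self b)
      rw [zeros, List.mem_replicate] at this
      exact ⟨z₀, by rw [this.2]⟩
    have no_ones : ∀ l, true :: (ones 4 ++ l) <:+ string₁ t D →
        ¬ false :: false :: spread p ++ w = l := by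
      rintro l hl rfl
      have : false :: (ones 4 ++ (false :: false :: spread p ++ w)) <:+ string₁ t D := by
        refine List.IsSuffix.trans ⟨z₀, ?_⟩ (hw ▸ hy')
        simp
      exact absurd (eq_of_cons_suffix_of_cons_suffix this hl) (by simp)
    rcases h with h | h | h | h
    · rw [h, ← h₁] at hw
      exact absurd hw.symm hne
    · exact absurd h (no_ones _ (suffix₃ hE))
    · refine absurd h (no_ones _ (List.IsSuffix.trans ?_ (((suffix₄ p _).trans
        (rest_suffix_string₁ hE)))))
      exact ⟨ones 3 ++ zeros 3, by simp [ones_five]⟩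
    · have hc : zeros 4 <:+ core₇ p := ⟨false :: (spread p ++ zeros 3), by
        simp [core₇, zeros, List.replicate_succ]⟩
      have hno : ¬ zeros 4 <:+ z₀ ++ [false] := by
        rintro ⟨z₁, hz₁⟩
        have h₃ : false :: (zeros 3 ++ (ones 4 ++ piece₅ p (E.flatMap gadget₁))) <:+
            string₁ t D := by
          refine List.IsSuffix.trans ⟨z₁, ?_⟩ (hw ▸ hy')
          rw [h, ← hz₁]; simp [zeros, List.replicate_succ]
        have h₄ : true :: (zeros 3 ++ (ones 4 ++ piece₅ p (E.flatMap gadget₁))) <:+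
            string₁ t D := by
          refine List.IsSuffix.trans ⟨ones 3, ?_⟩ ((suffix₅ p _).trans (rest_suffix_string₁ hE))
          simp [ones, List.replicate_succ]
        exact absurd (eq_of_cons_suffix_of_cons_suffix h₃ h₄) (by simp)
      have hz₁ : z₀ ++ [false] <:+ zeros 3 := by
        have := (List.suffix_or_suffix_of_suffix hz' hc).resolve_right hno
        rcases List.suffix_cons_iff.1 this with h | h
        · exact absurd (by rw [h]; exact List.suffix_refl _) hno
        · exact h
      obtain ⟨z₂, hz₂⟩ := hz₁
      have hy₁ : y.1.2 = ((z₀ ++ [false]) ++ (ones 4 ++ piece₅ p [])) ++ E.flatMap gadget₁ := by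
        rw [← hw, h, List.append_assoc (_ ++ _), List.append_assoc (ones 4), piece₅_nil_append]
      have hy₂ := snd_eq_of_suffix_rest hE hy (by simp) (by
        refine List.IsSuffix.trans ?_ (suffix₅ p [])
        exact ⟨ones 4 ++ z₂, by rw [← hz₂]; simp⟩) hy₁
      right
      rw [hy₁, hy₂, h₁, h₂, List.append_assoc (z₀ ++ [false]), List.append_assoc (z₀ ++ [false]),
        append_lt_append_left_iff, append_lt_append_left_iff, List.append_assoc (ones 4),
        List.append_assoc (ones 4), append_lt_append_left_iff, append_lt_append_left_iff,
        piece₅_nil_append, piece₅_nil_append]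
      simp [piece₂, piece₃, piece₅, append_lt_append_left_iff, List.cons_lt_cons_iff, zeros,
        ones, List.replicate_succ]

theorem exists_isKey_of_core₆ (hm : 1 ≤ m) (hD : ∀ q ∈ D, q.length = m) (hn : D.Nodup)
    (hD0 : D ≠ []) {z : List Bool} (hz : z ≠ []) (hz' : z <:+ core₆ p) (hE : p :: E <:+ D)
    (h₁ : x.1.2 = z ++ (ones 4 ++ piece₃ p (E.flatMap gadget₁)))
    (h₂ : x.2.2 = z ++ (ones 4 ++ piece₂' p (E.flatMap gadget₂))) : ∃ K, IsKey t D x K := by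
  refine ⟨z ++ (ones 4 ++ (false :: false :: spread p)), ?_, ?_, Or.inr ?_⟩
  · rw [h₁, List.prefix_append_right_inj, List.prefix_append_right_inj, piece₃]
    simp
  · rw [h₂, List.prefix_append_right_inj, List.prefix_append_right_inj, piece₂']
    simp
  · intro y hy ⟨w, hw⟩ hne
    rw [List.append_assoc, List.append_assoc] at hw
    have hy' := suffix_string₁_of_mem hD0 hy
    have hs : false :: false :: spread p ++ w <:+ string₁ t D :=
      ((List.suffix_append _ _).trans (List.suffix_append _ _)).trans (hw ▸ hy')
    obtain ⟨E', hE', h⟩ := eq_piece_of_isPrefix hm hD (hD p (hE.subset (by simp))) hs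
      ⟨w, by simp⟩
    rw [eq_of_cons_suffix hn hE' hE] at h
    -- the part before the four ones ends with another one
    obtain ⟨z₀, rfl⟩ : ∃ z₀, z = z₀ ++ [true] := by
      obtain ⟨z₀, b, rfl⟩ := List.eq_nil_or_concat' z |>.resolve_left hz
      have : [b] <:+ [true] := by
        refine List.suffix_of_suffix_length_le ((List.suffix_append _ _).trans hz')
          (⟨false :: (spread p ++ zeros 6), by simp [core₆]⟩) (by simp)
      have := this.eq_of_length (by simp)
      exact ⟨z₀, by rw [this]⟩
    have no_zero : ∀ l, false :: (ones 4 ++ l) <:+ string₁ t D →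
        ¬ false :: false :: spread p ++ w = l := by
      rintro l hl rfl
      have : true :: (ones 4 ++ (false :: false :: spread p ++ w)) <:+ string₁ t D := by
        refine List.IsSuffix.trans ⟨z₀, ?_⟩ (hw ▸ hy')
        simp
      exact absurd (eq_of_cons_suffix_of_cons_suffix this hl) (by simp)
    rcases h with h | h | h | h
    · exact absurd h (no_zero _ (suffix₂ hE))
    · rw [h, ← h₁] at hw
      exact absurd hw.symm hne
    · have hc : zeros 4 ++ [true] <:+ core₆ p := ⟨false :: (spread p ++ zeros 2), by
        simp [core₆, zeros, List.replicate_succ]⟩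
      have hno : ¬ zeros 4 ++ [true] <:+ z₀ ++ [true] := by
        rintro ⟨z₁, hz₁⟩
        have h₃ : false :: (zeros 3 ++ (ones 5 ++ piece₄ p (E.flatMap gadget₁))) <:+
            string₁ t D := by
          refine List.IsSuffix.trans ⟨z₁, ?_⟩ (hw ▸ hy')
          rw [h, ← hz₁]; simp [zeros, List.replicate_succ, ones_five]
        have h₄ : true :: (zeros 3 ++ (ones 5 ++ piece₄ p (E.flatMap gadget₁))) <:+
            string₁ t D := by
          refine List.IsSuffix.trans ⟨ones 2, ?_⟩ ((suffix₄ p _).trans (rest_suffix_string₁ hE))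
          simp [ones, List.replicate_succ]
        exact absurd (eq_of_cons_suffix_of_cons_suffix h₃ h₄) (by simp)
      have hz₁ : z₀ ++ [true] <:+ zeros 3 ++ [true] := by
        have := (List.suffix_or_suffix_of_suffix hz' hc).resolve_right hno
        rcases List.suffix_cons_iff.1 this with h | h
        · exact absurd (by rw [h]; exact List.suffix_refl _) hno
        · exact h
      obtain ⟨z₂, hz₂⟩ := hz₁
      have hy₁ : y.1.2 = ((z₀ ++ [true]) ++ (ones 4 ++ piece₄ p [])) ++ E.flatMap gadget₁ := by
        rw [← hw, h, List.append_assoc (_ ++ _), List.append_assoc (ones 4), piece₄_nil_append]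
      have hy₂ := snd_eq_of_suffix_rest hE hy (by simp) (by
        refine List.IsSuffix.trans ?_ (suffix₄ p [])
        refine ⟨ones 3 ++ z₂, ?_⟩
        have : zeros 3 ++ (ones 5 ++ piece₄ p []) = (zeros 3 ++ [true]) ++ (ones 4 ++ piece₄ p []) := by
          simp [ones_five]
        rw [this, ← hz₂]; simp) hy₁
      left
      rw [hy₁, hy₂, h₁, h₂, List.append_assoc (z₀ ++ [true]), List.append_assoc (z₀ ++ [true]),
        append_lt_append_left_iff, append_lt_append_left_iff, List.append_assoc (ones 4),
        List.append_assoc (ones 4), append_lt_append_left_iff, append_lt_append_left_iff,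
        piece₄_nil_append, piece₄_nil_append]
      simp [piece₂', piece₃, piece₄, append_lt_append_left_iff, List.cons_lt_cons_iff, zeros,
        ones, List.replicate_succ]
    · refine absurd h (no_zero _ (List.IsSuffix.trans ?_ (((suffix₅ p _).trans
        (rest_suffix_string₁ hE)))))
      exact ⟨ones 4 ++ zeros 2, by simp [zeros, List.replicate_succ]⟩

/-- Every matched pair has a key. If the two suffixes are different, the key ends in the gadget where
they first differ, after a spread pattern. Only suffixes that continue within the gadget of this
pattern can start with it, which leaves a few cases to compare. -/
theorem exists_isKey (hm : 1 ≤ m) (hD : ∀ q ∈ D, q.length = m) (hn : D.Nodup)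
    (hD0 : D ≠ []) (hx : x ∈ suffixPairs t D) : ∃ K, IsKey t D x K := by
  rcases suffixPairs_cases hx with ⟨Z, E, hE, h₁, h₂⟩ | ⟨p, E, hE, ⟨a, ha, h₁, h₂⟩ |
    ⟨z, hz, hz', h₁, h₂⟩ | ⟨z, hz, hz', h₁, h₂⟩⟩
  · exact exists_isKey_of_common hm hD hn hD0 hE h₁ h₂
  · exact exists_isKey_of_ones hm hD hn hD0 ha hE h₁ h₂
  · exact exists_isKey_of_core₇ hm hD hn hD0 hz hz' hE h₁ h₂
  · exact exists_isKey_of_core₆ hm hD hn hD0 hz hz' hE h₁ h₂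

/-- The matching of suffixes preserves the lexicographic order. -/
theorem snd_le_of_fst_le (hm : 1 ≤ m) (hD : ∀ q ∈ D, q.length = m) (hn : D.Nodup)
    (hD0 : D ≠ []) (hx : x ∈ suffixPairs t D) (hy : y ∈ suffixPairs t D)
    (h : x.1.2 ≤ y.1.2) : x.2.2 ≤ y.2.2 := by
  by_cases hxy : x = y
  · rw [hxy]
  have hne₁ : x.1.2 ≠ y.1.2 := fun h => hxy (suffixPairs_inj₁ hD0 hx hy h)
  have hne₂ : x.2.2 ≠ y.2.2 := fun h => hxy (suffixPairs_inj₂ hD0 hx hy h)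
  have hlt := lt_of_le_of_ne h hne₁
  obtain ⟨K, hK₁, hK₂, hK⟩ := exists_isKey hm hD hn hD0 hx
  obtain ⟨J, hJ₁, hJ₂, hJ⟩ := exists_isKey hm hD hn hD0 hy
  have of_consistent : Consistent x y → x.2.2 ≤ y.2.2 := by
    rintro (h' | h')
    · exact h'.2.le
    · exact absurd h'.1 hlt.not_gt
  by_cases hKJ : K <+: J
  · rcases hK with ⟨-, h₂⟩ | hK
    · exact (lt_of_isPrefix_of_ne (h₂ ▸ hKJ.trans hJ₂) hne₂).le
    · exact of_consistent (hK y hy (hKJ.trans hJ₁) hne₁.symm)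
  by_cases hJK : J <+: K
  · rcases hJ with ⟨h₁, -⟩ | hJ
    · exact absurd (lt_of_isPrefix_of_ne (h₁ ▸ hJK.trans hK₁) hne₁.symm) hlt.not_gt
    · exact of_consistent (hJ x hx (hJK.trans hK₁) hne₁).symm
  obtain ⟨a, ha⟩ := hK₁
  obtain ⟨a', ha'⟩ := hK₂
  obtain ⟨b, hb⟩ := hJ₁
  obtain ⟨b', hb'⟩ := hJ₂
  rw [← ha, ← hb, lt_iff_of_not_isPrefix hKJ hJK] at hlt
  rw [← ha', ← hb']
  exact ((lt_iff_of_not_isPrefix hKJ hJK _ _).2 hlt).le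

end Keys

/-! ### Adjacent elements of sorted lists and exchanges in run counts -/

section Sorted

variable {α β : Type*} [LinearOrder β] {k : α → β} {M : List α}

theorem exists_next (hM : M.Pairwise (fun x y => k x < k y)) {v w : α} (hv : v ∈ M) (hw : w ∈ M)
    (h : k v < k w) : ∃ A n B, M = A ++ v :: n :: B ∧ k v < k n ∧
      ∀ z ∈ M, k v < k z → k n ≤ k z := by
  obtain ⟨A, B, rfl⟩ := List.append_of_mem hv
  rw [List.pairwise_append] at hM
  obtain ⟨-, hB, hA⟩ := hM
  have mem : ∀ z ∈ A ++ v :: B, k v < k z → z ∈ B := by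
    intro z hz hlt
    rcases List.mem_append.1 hz with hz | hz
    · exact absurd (hA z hz v (by simp)) hlt.not_gt
    · rcases List.mem_cons.1 hz with rfl | hz
      · exact absurd hlt (lt_irrefl _)
      · exact hz
  have hwB := mem w hw h
  obtain ⟨n, B, rfl⟩ := List.exists_cons_of_ne_nil (List.ne_nil_of_mem hwB)
  refine ⟨A, n, B, rfl, (List.pairwise_cons.1 hB).1 n (by simp), fun z hz hlt => ?_⟩
  rcases List.mem_cons.1 (mem z hz hlt) with rfl | hz
  · exact le_rfl
  · exact ((List.pairwise_cons.1 (List.pairwise_cons.1 hB).2).1 z hz).le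

theorem exists_adjacent (hM : M.Pairwise (fun x y => k x < k y)) {v w : α} (hv : v ∈ M)
    (hw : w ∈ M) (h : k v < k w) (hb : ∀ z ∈ M, k v < k z → k w ≤ k z) :
    ∃ A B, M = A ++ v :: w :: B := by
  obtain ⟨A, n, B, hMe, hn, hn'⟩ := exists_next hM hv hw h
  have hnM : n ∈ M := by simp [hMe]
  have hkw : k n = k w := le_antisymm (hn' w hw h) (hb n hnM hn)
  have hinj : n = w := by
    rw [hMe, List.pairwise_append] at hM
    obtain ⟨-, hB, hA⟩ := hM
    rw [hMe] at hw
    rcases List.mem_append.1 hw with hw | hw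
    · exact absurd (hA w hw v (by simp)) h.not_gt
    · rcases List.mem_cons.1 hw with rfl | hw
      · exact absurd h (lt_irrefl _)
      · rcases List.mem_cons.1 hw with rfl | hw
        · rfl
        · exact absurd hkw ((List.pairwise_cons.1 (List.pairwise_cons.1 hB).2).1 w hw).ne
  exact ⟨A, B, hinj ▸ hMe⟩

theorem eq_of_append_cons_eq {A B A' B' : List α} {a : α} (hn : (A ++ a :: B).Nodup)
    (h : A ++ a :: B = A' ++ a :: B') : B = B' := by
  have h₁ : a ∉ A := fun ha => (List.disjoint_of_nodup_append hn) ha (by simp)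
  have h₂ : a ∉ B := (List.nodup_cons.1 (List.nodup_append.1 hn).2.1).1
  exact ((List.append_cons_inj_of_notMem h₁ h₂).1 h).2.2

/-- Exchanging the values of two neighbours changes the number of runs only through the
comparisons with their outer neighbours. -/
theorem runs_exchange (X Y : List Bool) (a b c d : Bool) :
    (runs (X ++ a :: c :: b :: d :: Y) : ℤ) - runs (X ++ a :: b :: c :: d :: Y) =
      ((if a = c then 0 else 1) + (if b = d then 0 else 1)) -
        ((if a = b then 0 else 1) + (if c = d then 0 else 1)) := by
  have h₁ := runs_append_cons X a (c :: b :: d :: Y)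
  have h₂ := runs_append_cons X a (b :: c :: d :: Y)
  simp only [runs_cons_cons] at h₁ h₂
  cases a <;> cases b <;> cases c <;> cases d <;> simp at * <;> omega

/-- The change in the number of runs when the symbols of two neighbours `b` and `c` are inverted.
These symbols differ, so that inverting them amounts to exchanging them. -/
theorem runs_map_flip [DecidableEq α] (hM : M.Nodup) {A B : List α} {a b c d : α}
    (h : M = A ++ a :: b :: c :: d :: B) {f g : α → Bool} (hf : f c = !f b)
    (hg : ∀ x ∈ M, g x = if x = b ∨ x = c then !f x else f x) :
    (runs (M.map g) : ℤ) - runs (M.map f) =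
      ((if f a = f c then 0 else 1) + (if f b = f d then 0 else 1)) -
        ((if f a = f b then 0 else 1) + (if f c = f d then 0 else 1)) := by
  have hn := hM
  rw [h, List.nodup_append] at hn
  obtain ⟨-, h₂, h₃⟩ := hn
  simp only [List.nodup_cons, List.mem_cons, not_or] at h₂
  have keep : ∀ x ∈ M, x ≠ b → x ≠ c → g x = f x := by
    intro x hx h₁ h₂
    rw [hg x hx, if_neg (by tauto)]
  have hA : A.map g = A.map f := by
    refine List.map_congr_left fun x hx => keep x (by simp [h, hx]) ?_ ?_
    · exact h₃ x hx b (by simp)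
    · exact h₃ x hx c (by simp)
  have hB : B.map g = B.map f := by
    refine List.map_congr_left fun x hx => keep x (by simp [h, hx]) ?_ ?_
    · rintro rfl; tauto
    · rintro rfl; tauto
  have ha : g a = f a := keep a (by simp [h]) (by tauto) (by tauto)
  have hd : g d = f d := keep d (by simp [h]) (by tauto) (by tauto)
  have hb : g b = f c := by rw [hg b (by simp [h]), if_pos (by simp), hf]
  have hc : g c = f b := by rw [hg c (by simp [h]), if_pos (by simp), hf, Bool.not_not]
  have hMg : M.map g = A.map f ++ f a :: f c :: f b :: f d :: B.map f := by
    rw [h]; simp [hA, hB, ha, hb, hc, hd]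
  have hMf : M.map f = A.map f ++ f a :: f b :: f c :: f d :: B.map f := by
    rw [h]; simp
  rw [hMg, hMf, runs_exchange]

end Sorted

/-! ### The suffixes at which the transforms differ -/

section Special

variable {t : List Bool} {D E : List (List Bool)} {m : ℕ} {x y : SuffixPair} {p q s : List Bool}

theorem exists_mem_suffixPairs (hD : D ≠ []) (hs : s ≠ []) (h : s <:+ string₁ t D) :
    ∃ x ∈ suffixPairs t D, x.1.2 = s := by
  obtain ⟨w, hw⟩ := h
  have hmem : (((string₁ t D).getLastD false :: string₁ t D).getD w.length false, s) ∈
      (suffixPairs t D).map Prod.fst := by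
    rw [map_fst_suffixPairs hD, annotated_eq_map, List.mem_map]
    refine ⟨w.length, ?_, ?_⟩
    · rw [List.mem_range, ← hw, List.length_append]
      have := List.length_pos_of_ne_nil hs
      omega
    · rw [List.append_nil]
      congr 1
      rw [← hw, List.drop_left]
  obtain ⟨x, hx, hx'⟩ := List.mem_map.1 hmem
  exact ⟨x, hx, by rw [hx']⟩

theorem fst_eq_of_cons_suffix (hD : D ≠ []) (hx : x ∈ suffixPairs t D) {b : Bool}
    (h : b :: x.1.2 <:+ string₁ t D) : x.1.1 = b := by
  rcases suffix_of_mem_suffixPairs hD hx with h' | h'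
  · have := h.length_le
    rw [h'] at this
    simp at this
  · exact eq_of_cons_suffix_of_cons_suffix h' h

/-- The four suffixes of `string₁ t D` that belong to the gadget of `p` and whose preceding symbol
differs from that of the matching suffix of `string₂ t D`. -/
def Special (D : List (List Bool)) (p s : List Bool) : Prop :=
  ∃ E, p :: E <:+ D ∧
    ((s = core₇ p ++ (ones 4 ++ piece₂ p (E.flatMap gadget₁)) ∨
      s = core₆ p ++ (ones 4 ++ piece₃ p (E.flatMap gadget₁))) ∨
    (s = ones 4 ++ piece₂ p (E.flatMap gadget₁) ∨ s = ones 4 ++ piece₃ p (E.flatMap gadget₁)))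

/-- A prefix that determines the pattern among all patterns of the same length. -/
def HasPattern (p s : List Bool) : Prop :=
  false :: spread p <+: s ∨ ones 4 ++ (false :: false :: spread p) <+: s

theorem HasPattern.eq (hl : p.length = q.length) (hp : HasPattern p s) (hq : HasPattern q s) :
    p = q := by
  have aux : ∀ {a b s : List Bool}, a.length = b.length → spread a <+: s → spread b <+: s →
      a = b := by
    intro a b s h h₁ h₂
    obtain ⟨w, rfl⟩ := h₂
    exact eq_of_spread_isPrefix h h₁
  rcases hp with hp | hp <;> rcases hq with hq | hq
  · cases s with
    | nil => simp at hp
    | cons c s =>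
      rw [List.cons_prefix_cons] at hp hq
      exact aux hl hp.2 hq.2
  · obtain ⟨w, rfl⟩ := hq
    simp [ones, List.replicate_succ] at hp
  · obtain ⟨w, rfl⟩ := hp
    simp [ones, List.replicate_succ] at hq
  · obtain ⟨w, rfl⟩ := hp
    simp only [List.append_assoc, List.prefix_append_right_inj, List.cons_append,
      List.cons_prefix_cons, true_and] at hq
    exact (eq_of_spread_isPrefix hl.symm hq).symm

theorem Special.hasPattern (h : Special D p s) : HasPattern p s := by
  obtain ⟨E, -, (rfl | rfl) | (rfl | rfl)⟩ := h
  · left; simp [core₇]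
  · left; simp [core₆]
  · right; simp [piece₂]
  · right; simp [piece₃]

theorem special_iff_of_suffix (hn : D.Nodup) (hE : p :: E <:+ D) : Special D p s ↔
    ((s = core₇ p ++ (ones 4 ++ piece₂ p (E.flatMap gadget₁)) ∨
      s = core₆ p ++ (ones 4 ++ piece₃ p (E.flatMap gadget₁))) ∨
    (s = ones 4 ++ piece₂ p (E.flatMap gadget₁) ∨
      s = ones 4 ++ piece₃ p (E.flatMap gadget₁))) := by
  constructor
  · rintro ⟨E', hE', h⟩
    rwa [eq_of_cons_suffix hn hE' hE] at h
  · exact fun h => ⟨E, hE, h⟩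

/-- Matched suffixes have the same preceding symbol, with the exception of four per pattern. -/
theorem fst_ne_iff_special (hD : D ≠ []) (hx : x ∈ suffixPairs t D) :
    x.1.1 ≠ x.2.1 ↔ ∃ p ∈ D, Special D p x.1.2 := by
  constructor
  · intro hne
    rw [suffixPairs, List.mem_append] at hx
    rcases hx with hx | hx
    · exact absurd (fst_eq_of_mem_paired hx) hne
    obtain ⟨c, p, E, hE, hx⟩ := exists_of_mem_gadgetsPairs hx
    refine ⟨p, hE.subset (by simp), E, hE, ?_⟩
    simp only [gadgetPairs, List.mem_append] at hx
    rcases hx with hx | hx | hx | hx | hx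
    · exact absurd (fst_eq_of_mem_paired hx) hne
    · obtain ⟨z, -, -, h₁, -, hz⟩ := exists_of_mem_paired hx
      rw [h₁, hz hne]; tauto
    · obtain ⟨z, -, -, h₁, -, hz⟩ := exists_of_mem_paired hx
      rw [h₁, hz hne]; right; left; simp [piece₂_eq]
    · obtain ⟨z, -, -, h₁, -, hz⟩ := exists_of_mem_paired hx
      rw [h₁, hz hne]; tauto
    · obtain ⟨z, -, -, h₁, -, hz⟩ := exists_of_mem_paired hx
      rw [h₁, hz hne]; right; right; rw [List.append_assoc, piece₃_nil_append]
  · rintro ⟨p, -, E, hE, h⟩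
    obtain ⟨c, hc⟩ := exists_gadgetPairs_subset t hE
    have key : ∀ {c₁ c₂ s₁ s₂}, ((c₁, s₁), (c₂, s₂)) ∈ suffixPairs t D → x.1.2 = s₁ → c₁ ≠ c₂ →
        x.1.1 ≠ x.2.1 := by
      intro c₁ c₂ s₁ s₂ hy h hne
      rw [suffixPairs_inj₁ hD hx hy h]
      exact hne
    rcases h with (h | h) | (h | h)
    · exact key (hc _ (List.mem_append_right _ (List.mem_append_left _
        (mem_paired_self (by simp [core₇]))))) h (by simp)
    · exact key (hc _ (List.mem_append_right _ (List.mem_append_right _ (List.mem_append_right _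
        (List.mem_append_left _ (mem_paired_self (by simp [core₆]))))))) h (by simp)
    · exact key (hc _ (List.mem_append_right _ (List.mem_append_right _ (List.mem_append_left _
        (mem_paired_self (by simp)))))) (h.trans (by simp [piece₂_eq])) (by simp)
    · exact key (hc _ (List.mem_append_right _ (List.mem_append_right _ (List.mem_append_right _
        (List.mem_append_right _ (mem_paired_self (by simp [piece₃])))))))
        (h.trans (by simp [piece₃_nil_append])) (by simp)

end Special

section Count

variable {t : List Bool} {D E : List (List Bool)} {m : ℕ} {x y : SuffixPair} {p q s : List Bool}

/-- The suffixes of `string₁ t D` that start with `0` and the spread of `p` start in the five pieces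
of the gadget of `p` or at an occurrence of `p` in the text. Their lexicographic order is: fifth,
first and second piece, text, third and fourth piece. The preceding symbol is `1` for the first
piece and for the text, and `0` otherwise. -/
theorem cases_of_isPrefix_core (hm : 1 ≤ m) (hD : ∀ q ∈ D, q.length = m) (hn : D.Nodup)
    (hE : p :: E <:+ D) (hy : y ∈ suffixPairs t D) (h : false :: spread p <+: y.1.2) :
    (y.1.1 = false ∧ (false :: y.1.2 = piece₂ p (E.flatMap gadget₁) ∨
      false :: y.1.2 = piece₃ p (E.flatMap gadget₁) ∨
      false :: y.1.2 = piece₄ p (E.flatMap gadget₁) ∨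
      false :: y.1.2 = piece₅ p (E.flatMap gadget₁))) ∨
    (y.1.1 = true ∧ (y.1.2 = core₇ p ++ (ones 4 ++ piece₂ p (E.flatMap gadget₁)) ∨
      ∃ q, q <:+ t ∧ p <+: q ∧ y.1.2 = false :: (spread q ++ D.flatMap gadget₁))) := by
  have hD0 := ne_nil_of_cons_suffix hE
  have hp := hD p (hE.subset (by simp))
  rcases suffix_of_mem_suffixPairs hD0 hy with h' | h'
  · rw [h', string₁_eq] at h
    simp at h
  cases hc : y.1.1 with
  | false =>
    rw [hc] at h'
    obtain ⟨E', hE', h''⟩ := eq_piece_of_isPrefix hm hD hp h'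
      (List.cons_prefix_cons.2 ⟨rfl, h⟩)
    rw [eq_of_cons_suffix hn hE' hE] at h''
    exact Or.inl ⟨rfl, h''⟩
  | true =>
    rw [hc] at h'
    rcases eq_spread_or_eq_gadget₁ hm hD hp h' (List.cons_prefix_cons.2 ⟨rfl, h⟩) with
      ⟨q, h₁, h₂, h₃⟩ | ⟨E', hE', h''⟩
    · exact Or.inr ⟨rfl, Or.inr ⟨q, h₁, h₂, (List.cons.inj h₃).2⟩⟩
    · rw [eq_of_cons_suffix hn hE' hE, List.flatMap_cons, gadget₁_append] at h''
      refine Or.inr ⟨rfl, Or.inl ?_⟩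
      rw [(List.cons.inj h'').2, core₇]
      simp

theorem cases_of_isPrefix_ones (hm : 1 ≤ m) (hD : ∀ q ∈ D, q.length = m) (hn : D.Nodup)
    (hE : p :: E <:+ D) (hy : y ∈ suffixPairs t D)
    (h : ones 4 ++ (false :: false :: spread p) <+: y.1.2) :
    y.1.2 = ones 4 ++ piece₂ p (E.flatMap gadget₁) ∨
      y.1.2 = ones 4 ++ piece₃ p (E.flatMap gadget₁) ∨
      y.1.2 = ones 4 ++ piece₄ p (E.flatMap gadget₁) ∨
      y.1.2 = ones 4 ++ piece₅ p (E.flatMap gadget₁) := by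
  have hD0 := ne_nil_of_cons_suffix hE
  have hp := hD p (hE.subset (by simp))
  obtain ⟨w, hw⟩ := h
  rw [List.append_assoc] at hw
  have h' : false :: false :: spread p ++ w <:+ string₁ t D :=
    (List.suffix_append _ _).trans (hw ▸ suffix_string₁_of_mem hD0 hy)
  obtain ⟨E', hE', h''⟩ := eq_piece_of_isPrefix hm hD hp h' (List.prefix_append _ _)
  rw [eq_of_cons_suffix hn hE' hE] at h''
  rw [← hw]
  rcases h'' with h | h | h | h <;> simp only [h, true_or, or_true]

theorem tail_piece₅ (p r : List Bool) :
    (piece₅ p r).tail = (false :: spread p) ++ (zeros 8 ++ (ones 3 ++ r)) := rfl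

theorem tail_piece₄ (p r : List Bool) : (piece₄ p r).tail =
    (false :: spread p) ++ (ones 4 ++ (zeros 3 ++ (ones 4 ++ piece₅ p r))) := rfl

theorem tail_piece₃ (p r : List Bool) : (piece₃ p r).tail =
    (false :: spread p) ++ (ones 3 ++ (zeros 3 ++ (ones 5 ++ piece₄ p r))) := rfl

theorem tail_piece₂ (p r : List Bool) : (piece₂ p r).tail =
    (false :: spread p) ++ (zeros 6 ++ (ones 5 ++ piece₃ p r)) := rfl

theorem core₇_append (p r : List Bool) :
    core₇ p ++ (ones 4 ++ piece₂ p r) =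
      (false :: spread p) ++ (zeros 7 ++ (ones 4 ++ piece₂ p r)) := by
  simp [core₇]

theorem tail_piece₅_lt_core₇ (p r : List Bool) :
    (piece₅ p r).tail < core₇ p ++ (ones 4 ++ piece₂ p r) := by
  rw [core₇_append, tail_piece₅, append_lt_append_left_iff]
  simp [zeros, ones, List.replicate_succ, List.cons_lt_cons_iff]

theorem core₇_lt_tail_piece₂ (p r : List Bool) :
    core₇ p ++ (ones 4 ++ piece₂ p r) < (piece₂ p r).tail := by
  rw [core₇_append, tail_piece₂, append_lt_append_left_iff]
  simp [zeros, ones, List.replicate_succ, List.cons_lt_cons_iff]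

theorem tail_piece₂_lt_tail_piece₃ (p r : List Bool) :
    (piece₂ p r).tail < (piece₃ p r).tail := by
  rw [tail_piece₂, tail_piece₃, append_lt_append_left_iff]
  simp [zeros, ones, List.replicate_succ, List.cons_lt_cons_iff]

theorem tail_piece₃_lt_tail_piece₄ (p r : List Bool) :
    (piece₃ p r).tail < (piece₄ p r).tail := by
  rw [tail_piece₃, tail_piece₄, append_lt_append_left_iff]
  simp [zeros, ones, List.replicate_succ, List.cons_lt_cons_iff]

theorem tail_piece₂_lt_text (hD : D ≠ []) (r : List Bool) (hq : p <+: q) :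
    (piece₂ p r).tail < false :: (spread q ++ D.flatMap gadget₁) := by
  obtain ⟨q, rfl⟩ := hq
  obtain ⟨d, D, rfl⟩ := List.exists_cons_of_ne_nil hD
  obtain ⟨l, hl⟩ := gadget₁_eq_cons d
  rw [tail_piece₂, spread_append, List.append_assoc, ← List.cons_append, append_lt_append_left_iff]
  cases q with
  | nil => simp [zeros, List.replicate_succ, List.flatMap_cons, hl, List.cons_lt_cons_iff]
  | cons a q => cases a <;> simp [zeros, List.replicate_succ, spread_cons, List.cons_lt_cons_iff]

theorem text_lt_tail_piece₃ (hD : D ≠ []) (r : List Bool) (hq : p <+: q) :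
    false :: (spread q ++ D.flatMap gadget₁) < (piece₃ p r).tail := by
  obtain ⟨q, rfl⟩ := hq
  obtain ⟨d, D, rfl⟩ := List.exists_cons_of_ne_nil hD
  obtain ⟨l, hl⟩ := gadget₁_eq_cons d
  rw [tail_piece₃, spread_append, List.append_assoc, ← List.cons_append, append_lt_append_left_iff]
  cases q with
  | nil => simp [ones, List.replicate_succ, List.flatMap_cons, hl, List.cons_lt_cons_iff]
  | cons a q => cases a <;> simp [ones, List.replicate_succ, spread_cons, List.cons_lt_cons_iff]

theorem piece₅_lt_piece₂ (p r : List Bool) : ones 4 ++ piece₅ p r < ones 4 ++ piece₂ p r := by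
  rw [append_lt_append_left_iff]
  simp [piece₅, piece₂, List.cons_lt_cons_iff, append_lt_append_left_iff, zeros, ones,
    List.replicate_succ]

theorem piece₂_lt_piece₃ (p r : List Bool) : ones 4 ++ piece₂ p r < ones 4 ++ piece₃ p r := by
  rw [append_lt_append_left_iff]
  simp [piece₃, piece₂, List.cons_lt_cons_iff, append_lt_append_left_iff, zeros, ones,
    List.replicate_succ]

theorem piece₃_lt_piece₄ (p r : List Bool) : ones 4 ++ piece₃ p r < ones 4 ++ piece₄ p r := by
  rw [append_lt_append_left_iff]
  simp [piece₃, piece₄, List.cons_lt_cons_iff, append_lt_append_left_iff, zeros, ones,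
    List.replicate_succ]

theorem cons_spread_suffix (h : q <:+ t) (r : List Bool) :
    true :: false :: (spread q ++ r) <:+ true :: false :: (spread t ++ r) := by
  induction t with
  | nil => rw [List.suffix_nil.1 h]
  | cons a t ih =>
    rcases List.suffix_cons_iff.1 h with rfl | h
    · exact List.suffix_refl _
    · exact (ih h).trans ⟨[true, false, a], by simp [spread_cons]⟩

/-- The sorted arrangement of the matched suffixes. -/
def sortedPairs (t : List Bool) (D : List (List Bool)) : List SuffixPair :=
  (suffixPairs t D).insertionSort (fun x y => x.1.2 ≤ y.1.2)

theorem sortedPairs_perm (t : List Bool) (D : List (List Bool)) :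
    (sortedPairs t D).Perm (suffixPairs t D) := List.perm_insertionSort _ _

theorem mem_sortedPairs : x ∈ sortedPairs t D ↔ x ∈ suffixPairs t D :=
  (sortedPairs_perm t D).mem_iff

theorem pairwise_le_sortedPairs (t : List Bool) (D : List (List Bool)) :
    (sortedPairs t D).Pairwise (fun x y => x.1.2 ≤ y.1.2) := by
  have : Std.Total (fun x y : SuffixPair => x.1.2 ≤ y.1.2) := ⟨fun x y => le_total _ _⟩
  have : IsTrans SuffixPair (fun x y : SuffixPair => x.1.2 ≤ y.1.2) :=
    ⟨fun _ _ _ h h' => le_trans h h'⟩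
  exact List.pairwise_insertionSort _ _

theorem pairwise_lt_sortedPairs (hD : D ≠ []) (t : List Bool) :
    (sortedPairs t D).Pairwise (fun x y => x.1.2 < y.1.2) := by
  have hn : ((sortedPairs t D).map (fun x => x.1.2)).Nodup := by
    rw [((sortedPairs_perm t D).map _).nodup_iff]
    have := nodup_map_snd_annotated ((string₁ t D).getLastD false) (string₁ t D) []
    rw [← map_fst_suffixPairs hD, List.map_map] at this
    exact this
  rw [List.Nodup, List.pairwise_map] at hn
  exact ((pairwise_le_sortedPairs t D).and hn).imp (fun h => lt_of_le_of_ne h.1 h.2)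

theorem bwt_string₁ (hD : D ≠ []) (t : List Bool) :
    bwt (string₁ t D) = (sortedPairs t D).map (fun x => x.1.1) := by
  rw [bwt_eq_map_fst (E := (sortedPairs t D).map Prod.fst), List.map_map]
  · rfl
  · rw [← map_fst_suffixPairs hD]
    exact (sortedPairs_perm t D).map _
  · rw [List.pairwise_map]
    exact pairwise_le_sortedPairs t D

theorem bwt_string₂ (hm : 1 ≤ m) (hD : ∀ q ∈ D, q.length = m) (hn : D.Nodup) (hD0 : D ≠ [])
    (t : List Bool) : bwt (string₂ t D) = (sortedPairs t D).map (fun x => x.2.1) := by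
  rw [bwt_eq_map_fst (E := (sortedPairs t D).map Prod.snd), List.map_map]
  · rfl
  · exact ((sortedPairs_perm t D).map _).trans (map_snd_suffixPairs hD0 t)
  · rw [List.pairwise_map]
    refine List.Pairwise.imp_of_mem ?_ (pairwise_le_sortedPairs t D)
    intro x y hx hy h
    exact snd_le_of_fst_le hm hD hn hD0 (mem_sortedPairs.1 hx) (mem_sortedPairs.1 hy) h

/-- The neighbourhood in the suffix array of the two suffixes that start in the first two pieces
with `0` and the spread of `p`. -/
theorem exists_core_neighbours (hm : 1 ≤ m) (hD : ∀ q ∈ D, q.length = m) (hn : D.Nodup)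
    (hE : p :: E <:+ D) : ∃ A a b c d B, sortedPairs t D = A ++ a :: b :: c :: d :: B ∧
      b.1.2 = core₇ p ++ (ones 4 ++ piece₂ p (E.flatMap gadget₁)) ∧
      c.1.2 = core₆ p ++ (ones 4 ++ piece₃ p (E.flatMap gadget₁)) ∧
      HasPattern p a.1.2 ∧ HasPattern p d.1.2 ∧ ¬ Special D p a.1.2 ∧ ¬ Special D p d.1.2 ∧
      a.1.1 = false ∧ b.1.1 = true ∧ c.1.1 = false ∧ (d.1.1 = true ↔ p <:+: t) := by
  have hD0 := ne_nil_of_cons_suffix hE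
  set r := E.flatMap gadget₁ with hr
  have hM := pairwise_lt_sortedPairs hD0 t
  have hg := gadget₁_suffix_string₁ (t := t) hE
  rw [gadget₁_append, ← hr] at hg
  have hs₁ : true :: (core₇ p ++ (ones 4 ++ piece₂ p r)) <:+ string₁ t D := by
    rw [core₇_append]; simpa using hg
  have hs₂ : false :: (piece₂ p r).tail <:+ string₁ t D :=
    (List.suffix_append (ones 4) _).trans ((List.suffix_cons _ _).trans (suffix₂ hE))
  have hs₃ : false :: (piece₃ p r).tail <:+ string₁ t D :=
    (List.suffix_append (ones 4) _).trans (rest_suffix_string₁ hE)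
  have hs₅ : false :: (piece₅ p r).tail <:+ string₁ t D :=
    ((List.suffix_append (ones 4) _).trans (List.suffix_append _ _)).trans
      ((List.suffix_append _ _).trans ((suffix₅ p r).trans (rest_suffix_string₁ hE)))
  have hc₂ : (piece₂ p r).tail = core₆ p ++ (ones 4 ++ piece₃ p r) := by rw [piece₂_eq]; rfl
  have get : ∀ {b s}, s ≠ [] → b :: s <:+ string₁ t D →
      ∃ x ∈ sortedPairs t D, x.1.2 = s ∧ x.1.1 = b := by
    intro b s hs h
    obtain ⟨x, hx, rfl⟩ := exists_mem_suffixPairs hD0 hs ((List.suffix_cons _ _).trans h)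
    exact ⟨x, mem_sortedPairs.2 hx, rfl, fst_eq_of_cons_suffix hD0 hx h⟩
  obtain ⟨a, ha, ha', hac⟩ := get (by simp [tail_piece₅]) hs₅
  obtain ⟨b, hb, hb', hbc⟩ := get (by simp [core₇]) hs₁
  obtain ⟨c, hc, hc', hcc⟩ := get (by simp [tail_piece₂]) hs₂
  obtain ⟨e, he, he', hec⟩ := get (by simp [tail_piece₃]) hs₃
  have hab : a.1.2 < b.1.2 := by rw [ha', hb']; exact tail_piece₅_lt_core₇ p r
  have hbc' : b.1.2 < c.1.2 := by rw [hb', hc']; exact core₇_lt_tail_piece₂ p r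
  have hce : c.1.2 < e.1.2 := by rw [hc', he']; exact tail_piece₂_lt_tail_piece₃ p r
  -- the possible positions of a suffix between the first and the last of these
  have between : ∀ z ∈ sortedPairs t D, a.1.2 < z.1.2 → z.1.2 ≤ e.1.2 →
      z.1.2 = b.1.2 ∨ z.1.2 = c.1.2 ∨ (z.1.2 = e.1.2 ∧ z.1.1 = false) ∨
        (p <:+: t ∧ z.1.1 = true ∧ c.1.2 < z.1.2 ∧ z.1.2 < e.1.2) := by
    intro z hz h₁ h₂
    have hpre : false :: spread p <+: z.1.2 := by
      rcases h₂.lt_or_eq with h₂ | h₂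
      · rw [ha', tail_piece₅] at h₁
        rw [he', tail_piece₃] at h₂
        exact isPrefix_of_lt_of_lt h₁ h₂
      · rw [h₂, he', tail_piece₃]
        exact List.prefix_append _ _
    have tail_eq : ∀ {l : List Bool}, false :: z.1.2 = l → z.1.2 = l.tail := by
      rintro l rfl; rfl
    rcases cases_of_isPrefix_core hm hD hn hE (mem_sortedPairs.1 hz) hpre with
      ⟨hzc, h | h | h | h⟩ | ⟨hzc, h | ⟨q, h₃, h₄, h₅⟩⟩
    · exact Or.inr (Or.inl (by rw [hc', tail_eq h]))
    · exact Or.inr (Or.inr (Or.inl ⟨by rw [he', tail_eq h], hzc⟩))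
    · rw [tail_eq h, he'] at h₂
      exact absurd (tail_piece₃_lt_tail_piece₄ p r) h₂.not_gt
    · rw [tail_eq h, ha'] at h₁
      exact absurd h₁ (lt_irrefl _)
    · exact Or.inl (by rw [hb', h])
    · refine Or.inr (Or.inr (Or.inr ⟨h₄.isInfix.trans h₃.isInfix, hzc, ?_, ?_⟩))
      · rw [hc', h₅]; exact tail_piece₂_lt_text hD0 r h₄
      · rw [he', h₅]; exact text_lt_tail_piece₃ hD0 r h₄
  obtain ⟨A, B₁, h₁⟩ := exists_adjacent (k := fun x : SuffixPair => x.1.2) hM ha hb hab (by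
    intro z hz hlt
    by_contra hlt'
    push Not at hlt'
    rcases between z hz hlt (hlt'.le.trans (hbc'.trans hce).le) with h | h | h | h
    · exact absurd hlt' (by rw [h]; exact lt_irrefl _)
    · exact absurd hlt' (by rw [h]; exact hbc'.not_gt)
    · exact absurd hlt' (by rw [h.1]; exact (hbc'.trans hce).not_gt)
    · exact absurd hlt' (hbc'.trans h.2.2.1).not_gt)
  obtain ⟨A₂, B₂, h₂⟩ := exists_adjacent (k := fun x : SuffixPair => x.1.2) hM hb hc hbc' (by
    intro z hz hlt
    by_contra hlt'
    push Not at hlt'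
    rcases between z hz (hab.trans hlt) (hlt'.le.trans hce.le) with h | h | h | h
    · exact absurd hlt (by rw [h]; exact lt_irrefl _)
    · exact absurd hlt' (by rw [h]; exact lt_irrefl _)
    · exact absurd hlt' (by rw [h.1]; exact hce.not_gt)
    · exact absurd hlt' h.2.2.1.not_gt)
  obtain ⟨A₃, d, B₃, h₃, hcd, hd⟩ := exists_next (k := fun x : SuffixPair => x.1.2) hM hc he hce
  have hnd : (sortedPairs t D).Nodup :=
    hM.imp (fun h h' => absurd h (by rw [h']; exact lt_irrefl _))
  have hB₁ : B₁ = c :: B₂ := by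
    refine eq_of_append_cons_eq (A := A ++ [a]) (a := b) (A' := A₂) ?_ ?_
    · simpa [h₁] using hnd
    · rw [← h₂, h₁]; simp
  have hB₂ : B₂ = d :: B₃ := by
    refine eq_of_append_cons_eq (A := A₂ ++ [b]) (a := c) (A' := A₃) ?_ ?_
    · simpa [h₂] using hnd
    · rw [← h₃, h₂]; simp
  have hdM : d ∈ sortedPairs t D := by simp [h₃]
  have hde := hd e he hce
  have hpre : ∀ {s}, HasPattern p (false :: spread p ++ s) := Or.inl (List.prefix_append _ _)
  have hnsp : ∀ {s}, s ≠ b.1.2 → s ≠ c.1.2 → (∃ w, s = false :: w) → ¬ Special D p s := by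
    rintro _ h₁ h₂ ⟨w, rfl⟩ h
    rw [special_iff_of_suffix hn hE] at h
    rcases h with (h | h) | (h | h)
    · exact h₁ (h.trans hb'.symm)
    · exact h₂ (h.trans (by rw [hc', hc₂]))
    · simp [ones, List.replicate_succ] at h
    · simp [ones, List.replicate_succ] at h
  have hdpre : false :: spread p <+: d.1.2 := by
    rcases hde.lt_or_eq with h | h
    · rw [hc', tail_piece₂] at hcd
      rw [he', tail_piece₃] at h
      exact isPrefix_of_lt_of_lt hcd h
    · rw [h, he', tail_piece₃]
      exact List.prefix_append _ _
  refine ⟨A, a, b, c, d, B₃, by rw [h₁, hB₁, hB₂], hb', by rw [hc', hc₂], ?_, Or.inl hdpre, ?_, ?_,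
    hac, hbc, hcc, ?_⟩
  · rw [ha', tail_piece₅]; exact hpre
  · exact hnsp hab.ne (hab.trans hbc').ne ⟨_, ha'⟩
  · refine hnsp (hbc'.trans hcd).ne' hcd.ne' ?_
    obtain ⟨w, hw⟩ := hdpre
    exact ⟨_, hw.symm⟩
  · rcases between d hdM ((hab.trans hbc').trans hcd) hde with h | h | h | h
    · exact absurd (h ▸ hcd) hbc'.not_gt
    · exact absurd (h ▸ hcd) (lt_irrefl _)
    · refine ⟨fun h' => by simp [h.2] at h', ?_⟩
      -- an occurrence in the text would lie strictly before the third piece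
      rintro ⟨u, v, huv⟩
      exfalso
      have hs : true :: false :: (spread (p ++ v) ++ D.flatMap gadget₁) <:+ string₁ t D := by
        rw [string₁_eq]
        exact cons_spread_suffix ⟨u, by rw [← huv]; simp⟩ _
      obtain ⟨z, hz, hz', -⟩ := get (by simp) hs
      have h₁ : c.1.2 < z.1.2 := by
        rw [hc', hz']; exact tail_piece₂_lt_text hD0 r (List.prefix_append _ _)
      have h₂ : z.1.2 < e.1.2 := by
        rw [he', hz']; exact text_lt_tail_piece₃ hD0 r (List.prefix_append _ _)
      exact absurd (hd z hz h₁) (by rw [h.1]; exact h₂.not_ge)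
    · exact ⟨fun _ => h.1, fun _ => h.2.1⟩

/-- The neighbourhood in the suffix array of the two suffixes that start with the last four symbols
of the first two pieces of the gadget of `p`. -/
theorem exists_ones_neighbours (hm : 1 ≤ m) (hD : ∀ q ∈ D, q.length = m) (hn : D.Nodup)
    (hE : p :: E <:+ D) : ∃ A a b c d B, sortedPairs t D = A ++ a :: b :: c :: d :: B ∧
      b.1.2 = ones 4 ++ piece₂ p (E.flatMap gadget₁) ∧
      c.1.2 = ones 4 ++ piece₃ p (E.flatMap gadget₁) ∧
      HasPattern p a.1.2 ∧ HasPattern p d.1.2 ∧ ¬ Special D p a.1.2 ∧ ¬ Special D p d.1.2 ∧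
      a.1.1 = false ∧ b.1.1 = false ∧ c.1.1 = true ∧ d.1.1 = true := by
  have hD0 := ne_nil_of_cons_suffix hE
  set r := E.flatMap gadget₁ with hr
  have hM := pairwise_lt_sortedPairs hD0 t
  have hs₂ : false :: (ones 4 ++ piece₂ p r) <:+ string₁ t D := suffix₂ hE
  have hs₃ : true :: (ones 4 ++ piece₃ p r) <:+ string₁ t D := suffix₃ hE
  have hs₄ : true :: (ones 4 ++ piece₄ p r) <:+ string₁ t D :=
    ((List.suffix_append _ _).trans (List.suffix_append _ _)).trans
      ((suffix₄ p r).trans (rest_suffix_string₁ hE))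
  have hs₅ : false :: (ones 4 ++ piece₅ p r) <:+ string₁ t D := by
    refine List.IsSuffix.trans ⟨ones 4 ++ zeros 2, ?_⟩
      ((suffix₅ p r).trans (rest_suffix_string₁ hE))
    simp [zeros, List.replicate_succ]
  have get : ∀ {b s}, s ≠ [] → b :: s <:+ string₁ t D →
      ∃ x ∈ sortedPairs t D, x.1.2 = s ∧ x.1.1 = b := by
    intro b s hs h
    obtain ⟨x, hx, rfl⟩ := exists_mem_suffixPairs hD0 hs ((List.suffix_cons _ _).trans h)
    exact ⟨x, mem_sortedPairs.2 hx, rfl, fst_eq_of_cons_suffix hD0 hx h⟩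
  obtain ⟨a, ha, ha', hac⟩ := get (by simp [ones]) hs₅
  obtain ⟨b, hb, hb', hbc⟩ := get (by simp [ones]) hs₂
  obtain ⟨c, hc, hc', hcc⟩ := get (by simp [ones]) hs₃
  obtain ⟨d, hd, hd', hdc⟩ := get (by simp [ones]) hs₄
  have hab : a.1.2 < b.1.2 := by rw [ha', hb']; exact piece₅_lt_piece₂ p r
  have hbc' : b.1.2 < c.1.2 := by rw [hb', hc']; exact piece₂_lt_piece₃ p r
  have hcd : c.1.2 < d.1.2 := by rw [hc', hd']; exact piece₃_lt_piece₄ p r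
  have pre : ∀ {l}, ones 4 ++ (false :: false :: (spread p ++ l)) =
      (ones 4 ++ (false :: false :: spread p)) ++ l := by simp
  have between : ∀ z ∈ sortedPairs t D, a.1.2 < z.1.2 → z.1.2 < d.1.2 →
      z.1.2 = b.1.2 ∨ z.1.2 = c.1.2 := by
    intro z hz h₁ h₂
    have hpre : ones 4 ++ (false :: false :: spread p) <+: z.1.2 := by
      rw [ha', piece₅, pre] at h₁
      rw [hd', piece₄, pre] at h₂
      exact isPrefix_of_lt_of_lt h₁ h₂
    rcases cases_of_isPrefix_ones hm hD hn hE (mem_sortedPairs.1 hz) hpre with h | h | h | h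
    · exact Or.inl (by rw [hb', h])
    · exact Or.inr (by rw [hc', h])
    · exact absurd h₂ (by rw [h, hd']; exact lt_irrefl _)
    · exact absurd h₁ (by rw [h, ha']; exact lt_irrefl _)
  obtain ⟨A, B₁, h₁⟩ := exists_adjacent (k := fun x : SuffixPair => x.1.2) hM ha hb hab (by
    intro z hz hlt
    by_contra hlt'
    push Not at hlt'
    rcases between z hz hlt (hlt'.trans (hbc'.trans hcd)) with h | h
    · exact absurd hlt' (by rw [h]; exact lt_irrefl _)
    · exact absurd hlt' (by rw [h]; exact hbc'.not_gt))
  obtain ⟨A₂, B₂, h₂⟩ := exists_adjacent (k := fun x : SuffixPair => x.1.2) hM hb hc hbc' (by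
    intro z hz hlt
    by_contra hlt'
    push Not at hlt'
    rcases between z hz (hab.trans hlt) (hlt'.trans hcd) with h | h
    · exact absurd hlt (by rw [h]; exact lt_irrefl _)
    · exact absurd hlt' (by rw [h]; exact lt_irrefl _))
  obtain ⟨A₃, B₃, h₃⟩ := exists_adjacent (k := fun x : SuffixPair => x.1.2) hM hc hd hcd (by
    intro z hz hlt
    by_contra hlt'
    push Not at hlt'
    rcases between z hz ((hab.trans hbc').trans hlt) hlt' with h | h
    · exact absurd hlt (by rw [h]; exact hbc'.not_gt)
    · exact absurd hlt (by rw [h]; exact lt_irrefl _))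
  have hnd : (sortedPairs t D).Nodup :=
    hM.imp (fun h h' => absurd h (by rw [h']; exact lt_irrefl _))
  have hB₁ : B₁ = c :: B₂ := by
    refine eq_of_append_cons_eq (A := A ++ [a]) (a := b) (A' := A₂) ?_ ?_
    · simpa [h₁] using hnd
    · rw [← h₂, h₁]; simp
  have hB₂ : B₂ = d :: B₃ := by
    refine eq_of_append_cons_eq (A := A₂ ++ [b]) (a := c) (A' := A₃) ?_ ?_
    · simpa [h₂] using hnd
    · rw [← h₃, h₂]; simp
  have hnsp : ∀ {s}, s ≠ b.1.2 → s ≠ c.1.2 → (∃ w, s = true :: w) → ¬ Special D p s := by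
    rintro _ h₁ h₂ ⟨w, rfl⟩ h
    rw [special_iff_of_suffix hn hE] at h
    rcases h with (h | h) | (h | h)
    · simp [core₇] at h
    · simp [core₆] at h
    · exact h₁ (h.trans hb'.symm)
    · exact h₂ (h.trans hc'.symm)
  refine ⟨A, a, b, c, d, B₃, by rw [h₁, hB₁, hB₂], hb', hc', ?_, ?_, ?_, ?_, hac, hbc, hcc, hdc⟩
  · right; rw [ha', piece₅, pre]; exact List.prefix_append _ _
  · right; rw [hd', piece₄, pre]; exact List.prefix_append _ _
  · exact hnsp hab.ne (hab.trans hbc').ne ⟨_, by rw [ha']; rfl⟩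
  · exact hnsp (hbc'.trans hcd).ne' hcd.ne' ⟨_, by rw [hd']; rfl⟩

open Classical in
/-- The symbol preceding the first suffix of a pair, inverted if this suffix belongs to the gadget
of a pattern in `F` and is one of those where the two transforms differ. -/
noncomputable def flipped (D F : List (List Bool)) (x : SuffixPair) : Bool :=
  if ∃ p ∈ F, Special D p x.1.2 then !x.1.1 else x.1.1

/-- The symbols next to the special suffixes of `p` are not changed by the inversions for other
patterns, since these suffixes start with a prefix that determines `p`. -/
theorem flipped_of_hasPattern {F : List (List Bool)} (hD : ∀ q ∈ D, q.length = m)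
    (hF : F ⊆ D) (hp : p ∈ D) (hpF : p ∉ F) (h : HasPattern p x.1.2) :
    flipped D F x = x.1.1 := by
  rw [flipped, if_neg]
  rintro ⟨q, hq, hs⟩
  have := h.eq (by rw [hD p hp, hD q (hF hq)]) hs.hasPattern
  exact hpF (this ▸ hq)

open Classical in
theorem flipped_cons {F : List (List Bool)} (hD : ∀ q ∈ D, q.length = m)
    (hF : F ⊆ D) (hp : p ∈ D) (hpF : p ∉ F) (x : SuffixPair) :
    flipped D (p :: F) x = if Special D p x.1.2 then !flipped D F x else flipped D F x := by
  by_cases h : Special D p x.1.2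
  · rw [if_pos h, flipped_of_hasPattern hD hF hp hpF h.hasPattern, flipped, if_pos]
    exact ⟨p, by simp, h⟩
  · rw [if_neg h, flipped, flipped]
    simp [h]

/-- Inverting the four symbols of the pattern `p` creates two runs if `p` does not occur in `t`, and
none otherwise. With the neighbours, the symbols `0011` at the suffixes that start with `1` become
`0101`. At the suffixes that start with `0`, the symbols `010d` become `001d`, where `d = 1` if and
only if `p` occurs in `t`: two runs disappear if it does. -/
theorem runs_flipped_cons (hm : 1 ≤ m) (hD : ∀ q ∈ D, q.length = m) (hn : D.Nodup)
    {F : List (List Bool)} (hF : F ⊆ D) (hp : p ∈ D) (hpF : p ∉ F) [Decidable (p <:+: t)] :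
    (runs ((sortedPairs t D).map (flipped D (p :: F))) : ℤ) -
      runs ((sortedPairs t D).map (flipped D F)) = if p <:+: t then 0 else 2 := by
  classical
  obtain ⟨F', E, hE⟩ := List.append_of_mem hp
  have hE : p :: E <:+ D := ⟨F', hE.symm⟩
  have hD0 := ne_nil_of_cons_suffix hE
  have hM := pairwise_lt_sortedPairs hD0 t
  have hnd : (sortedPairs t D).Nodup :=
    hM.imp (fun h h' => absurd h (by rw [h']; exact lt_irrefl _))
  have hinj : ∀ x ∈ sortedPairs t D, ∀ y ∈ sortedPairs t D, x.1.2 = y.1.2 → x = y :=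
    fun x hx y hy h => suffixPairs_inj₁ hD0 (mem_sortedPairs.1 hx) (mem_sortedPairs.1 hy) h
  obtain ⟨A, a, b, c, d, B, h, hb, hc, ha₁, hd₁, ha₂, hd₂, ha₃, hb₃, hc₃, hd₃⟩ :=
    exists_core_neighbours (t := t) hm hD hn hE
  obtain ⟨A', a', b', c', d', B', h', hb', hc', ha₁', hd₁', ha₂', hd₂', ha₃', hb₃', hc₃', hd₃'⟩ :=
    exists_ones_neighbours (t := t) hm hD hn hE
  have hspec : ∀ {x}, x ∈ sortedPairs t D →
      (Special D p x.1.2 ↔ (x = b ∨ x = c) ∨ (x = b' ∨ x = c')) := by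
    intro x hx
    rw [special_iff_of_suffix hn hE, ← hb, ← hc, ← hb', ← hc']
    have e : ∀ y ∈ sortedPairs t D, x.1.2 = y.1.2 ↔ x = y :=
      fun y hy => ⟨hinj x hx y hy, fun h => by rw [h]⟩
    rw [e b (by simp [h]), e c (by simp [h]), e b' (by simp [h']), e c' (by simp [h'])]
  have hne : ∀ {x y : SuffixPair}, (∃ w, x.1.2 = false :: w) → (∃ w, y.1.2 = true :: w) →
      x ≠ y := by
    rintro x y ⟨w, hw⟩ ⟨v, hv⟩ rfl
    rw [hw] at hv
    simp at hv
  have hb0 : ∃ w, b.1.2 = false :: w := ⟨_, hb⟩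
  have hc0 : ∃ w, c.1.2 = false :: w := ⟨_, hc⟩
  have hb1 : ∃ w, b'.1.2 = true :: w := ⟨_, hb'⟩
  have hc1 : ∃ w, c'.1.2 = true :: w := ⟨_, hc'⟩
  have hsb : HasPattern p b.1.2 := ((hspec (by simp [h])).2 (by tauto)).hasPattern
  have hsc : HasPattern p c.1.2 := ((hspec (by simp [h])).2 (by tauto)).hasPattern
  have hsb' : HasPattern p b'.1.2 := ((hspec (by simp [h'])).2 (by tauto)).hasPattern
  have hsc' : HasPattern p c'.1.2 := ((hspec (by simp [h'])).2 (by tauto)).hasPattern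
  have fl : ∀ {x : SuffixPair}, HasPattern p x.1.2 → flipped D F x = x.1.1 :=
    fun hx => flipped_of_hasPattern hD hF hp hpF hx
  set g : SuffixPair → Bool := fun x =>
    if x = b ∨ x = c then !flipped D F x else flipped D F x with hg
  have g_eq : ∀ {x : SuffixPair}, HasPattern p x.1.2 → x ≠ b → x ≠ c → g x = x.1.1 := by
    intro x h₁ h₂ h₃
    rw [hg]
    simp only
    rw [if_neg (by tauto), fl h₁]
  have e₁ := runs_map_flip hnd h (f := flipped D F) (g := g) (by rw [fl hsb, fl hsc, hb₃, hc₃]; rfl)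
    (fun x _ => by rw [hg])
  have hab' : a' ≠ b ∧ a' ≠ c := by
    constructor <;> rintro rfl
    · exact ha₂' ((hspec (by simp [h])).2 (by tauto))
    · exact ha₂' ((hspec (by simp [h])).2 (by tauto))
  have hdb' : d' ≠ b ∧ d' ≠ c := by
    constructor <;> rintro rfl
    · exact hd₂' ((hspec (by simp [h])).2 (by tauto))
    · exact hd₂' ((hspec (by simp [h])).2 (by tauto))
  have gb' := g_eq hsb' (hne hb0 hb1).symm (hne hc0 hb1).symm
  have gc' := g_eq hsc' (hne hb0 hc1).symm (hne hc0 hc1).symm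
  have ga' := g_eq ha₁' hab'.1 hab'.2
  have gd' := g_eq hd₁' hdb'.1 hdb'.2
  have e₂ := runs_map_flip hnd h' (f := g) (g := flipped D (p :: F))
    (by rw [gb', gc', hb₃', hc₃']; rfl) (by
      intro x hx
      rw [flipped_cons hD hF hp hpF, hg]
      simp only [hspec hx]
      by_cases h₁ : x = b' ∨ x = c'
      · have h₂ : ¬ (x = b ∨ x = c) := by
          rintro (rfl | rfl)
          · rcases h₁ with h₁ | h₁
            · exact hne hb0 hb1 h₁
            · exact hne hb0 hc1 h₁
          · rcases h₁ with h₁ | h₁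
            · exact hne hc0 hb1 h₁
            · exact hne hc0 hc1 h₁
        simp [h₁, h₂]
      · simp [h₁])
  rw [fl ha₁, fl hd₁, fl hsb, fl hsc, ha₃, hb₃, hc₃] at e₁
  rw [ga', gb', gc', gd', ha₃', hb₃', hc₃', hd₃'] at e₂
  by_cases ho : p <:+: t
  · rw [hd₃.2 ho] at e₁
    simp [ho] at e₁ e₂ ⊢
    omega
  · have : d.1.1 = false := by
      cases hd' : d.1.1
      · rfl
      · exact absurd (hd₃.1 hd') ho
    rw [this] at e₁
    simp [ho] at e₁ e₂ ⊢
    omega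

/-- The transform of `string₁ t D` is turned into that of `string₂ t D` by inverting the four
symbols of one pattern after the other. -/
theorem rlbwtSize_string₂_sub (hD : IsDictionary t D m) :
    (rlbwtSize (string₂ t D) : ℤ) - rlbwtSize (string₁ t D) =
      2 * (D.countP (fun p => ¬ p <:+: t) : ℤ) := by
  by_cases hD0 : D = []
  · subst hD0; simp [string₁, string₂]
  have hm := hD.pos
  have hl := hD.length_eq
  have hn := hD.nodup
  have hcount : ∀ F : List (List Bool), F ⊆ D → F.Nodup →
      (runs ((sortedPairs t D).map (flipped D F)) : ℤ) -
        runs ((sortedPairs t D).map (fun x => x.1.1)) =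
      2 * (F.countP (fun p => ¬ p <:+: t) : ℤ) := by
    intro F
    induction F with
    | nil => simp [show flipped D [] = fun x => x.1.1 from funext fun x => by simp [flipped]]
    | cons p F ih =>
      intro hF hFn
      rw [List.nodup_cons] at hFn
      have hF' : F ⊆ D := fun q hq => hF (by simp [hq])
      have h₁ := ih hF' hFn.2
      have h₂ := runs_flipped_cons (t := t) hm hl hn hF' (hF (by simp)) hFn.1
      rw [List.countP_cons]
      by_cases ho : p <:+: t
      · simp [ho] at h₂ ⊢
        simp at h₁
        omega
      · simp [ho] at h₂ ⊢
        simp at h₁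
        omega
  have hflip : (sortedPairs t D).map (flipped D D) = (sortedPairs t D).map (fun x => x.2.1) := by
    refine List.map_congr_left fun x hx => ?_
    have h := fst_ne_iff_special hD0 (mem_sortedPairs.1 hx)
    rw [flipped]
    by_cases hs : ∃ p ∈ D, Special D p x.1.2
    · rw [if_pos hs]
      have := h.2 hs
      revert this
      cases x.1.1 <;> cases x.2.1 <;> simp
    · rw [if_neg hs]
      by_contra hne
      exact hs (h.1 hne)
  rw [rlbwtSize, rlbwtSize, bwt_string₁ hD0, bwt_string₂ hm hl hn hD0, ← hflip]
  exact hcount D (fun _ h => h) hn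

end Count

/-! ### Word RAM executions -/

section Machine

variable {w : ℕ}

theorem Exec.deterministic {s s' : ℕ} {p : Program} {σ τ τ' : State w} {t t' : ℕ}
    (h : Exec s p σ t τ) (h' : Exec s' p σ t' τ') : t = t' ∧ τ = τ' := by
  induction h generalizing t' τ' with
  | skip | const | op | load | store => cases h'; exact ⟨rfl, rfl⟩
  | seq _ _ ih₁ ih₂ =>
    cases h' with
    | seq h₁ h₂ =>
      obtain ⟨rfl, rfl⟩ := ih₁ h₁
      obtain ⟨rfl, rfl⟩ := ih₂ h₂
      exact ⟨rfl, rfl⟩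
  | ite_true h _ ih =>
    cases h' with
    | ite_true _ h₁ => obtain ⟨rfl, rfl⟩ := ih h₁; exact ⟨rfl, rfl⟩
    | ite_false h₁ => exact absurd h₁ h
  | ite_false h _ ih =>
    cases h' with
    | ite_true h₁ => exact absurd h h₁
    | ite_false _ h₁ => obtain ⟨rfl, rfl⟩ := ih h₁; exact ⟨rfl, rfl⟩
  | loop_done h =>
    cases h' with
    | loop_done => exact ⟨rfl, rfl⟩
    | loop_step h₁ => exact absurd h h₁
  | loop_step h _ _ ih₁ ih₂ =>
    cases h' with
    | loop_done h₁ => exact absurd h₁ h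
    | loop_step _ h₁ h₂ =>
      obtain ⟨rfl, rfl⟩ := ih₁ h₁
      obtain ⟨rfl, rfl⟩ := ih₂ h₂
      exact ⟨rfl, rfl⟩

theorem Exec.mono {s s' : ℕ} (hs : s ≤ s') {p : Program} {σ τ : State w} {t : ℕ}
    (h : Exec s p σ t τ) : Exec s' p σ t τ := by
  induction h with
  | skip => exact .skip _
  | const => exact .const ..
  | op => exact .op ..
  | load _ _ _ _ h => exact .load _ _ _ _ (h.trans_le hs)
  | store _ _ _ _ h => exact .store _ _ _ _ (h.trans_le hs)
  | seq _ _ ih₁ ih₂ => exact .seq ih₁ ih₂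
  | ite_true h _ ih => exact .ite_true h ih
  | ite_false h _ ih => exact .ite_false h ih
  | loop_done h => exact .loop_done h
  | loop_step h _ _ ih₁ ih₂ => exact .loop_step h ih₁ ih₂

/-- Renaming of the registers by `f` and of the arrays by `g`. -/
def Program.rename (f g : ℕ → ℕ) : Program → Program
  | .skip => .skip
  | .const d v => .const (f d) v
  | .op o d a b => .op o (f d) (f a) (f b)
  | .load d arr a => .load (f d) (g arr) (f a)
  | .store arr a b => .store (g arr) (f a) (f b)
  | .seq p q => .seq (p.rename f g) (q.rename f g)
  | .ite a p q => .ite (f a) (p.rename f g) (q.rename f g)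
  | .loop a p => .loop (f a) (p.rename f g)

/-- The registers and arrays named by `f` and `g` in `τ` form a copy of the machine state `σ`. -/
structure State.Embeds (f g : ℕ → ℕ) (τ σ : State w) : Prop where
  reg : ∀ r, τ.reg (f r) = σ.reg r
  mem : ∀ a, τ.mem (g a) = σ.mem a

/-- The states `τ` and `τ'` agree outside the registers and arrays named by `f` and `g`. -/
structure State.AgreeOff (f g : ℕ → ℕ) (τ τ' : State w) : Prop where
  reg : ∀ r, r ∉ Set.range f → τ'.reg r = τ.reg r
  mem : ∀ a, a ∉ Set.range g → τ'.mem a = τ.mem a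

theorem State.AgreeOff.refl (f g : ℕ → ℕ) (τ : State w) : State.AgreeOff f g τ τ :=
  ⟨fun _ _ => rfl, fun _ _ => rfl⟩

theorem State.AgreeOff.trans {f g : ℕ → ℕ} {τ τ' τ'' : State w} (h : State.AgreeOff f g τ τ')
    (h' : State.AgreeOff f g τ' τ'') : State.AgreeOff f g τ τ'' :=
  ⟨fun r hr => (h'.reg r hr).trans (h.reg r hr), fun a ha => (h'.mem a ha).trans (h.mem a ha)⟩

theorem State.Embeds.setReg {f g : ℕ → ℕ} (hf : f.Injective) {τ σ : State w}
    (h : State.Embeds f g τ σ) (d : ℕ) (v : BitVec w) :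
    State.Embeds f g (τ.setReg (f d) v) (σ.setReg d v) := by
  refine ⟨fun r => ?_, h.mem⟩
  simp only [State.setReg, Function.update_apply, hf.eq_iff, h.reg]

theorem State.agreeOff_setReg (f g : ℕ → ℕ) (τ : State w) (d : ℕ) (v : BitVec w) :
    State.AgreeOff f g τ (τ.setReg (f d) v) := by
  refine ⟨fun r hr => ?_, fun _ _ => rfl⟩
  simp only [State.setReg, Function.update_apply]
  rw [if_neg]
  rintro rfl
  exact hr ⟨d, rfl⟩

/-- A renamed program simulates the original one on the copy and changes nothing else. -/
theorem Exec.rename {f g : ℕ → ℕ} (hf : f.Injective) (hg : g.Injective) {s : ℕ} {p : Program}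
    {σ σ' : State w} {t : ℕ} (h : Exec s p σ t σ') {τ : State w} (hτ : State.Embeds f g τ σ) :
    ∃ τ', Exec s (p.rename f g) τ t τ' ∧ State.Embeds f g τ' σ' ∧ State.AgreeOff f g τ τ' := by
  induction h generalizing τ with
  | skip => exact ⟨τ, .skip _, hτ, .refl ..⟩
  | const σ d v => exact ⟨_, .const .., hτ.setReg hf d _, State.agreeOff_setReg ..⟩
  | op σ o d a b =>
    refine ⟨_, .op .., ?_, State.agreeOff_setReg ..⟩
    rw [hτ.reg, hτ.reg]
    exact hτ.setReg hf d _
  | load σ d arr a h =>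
    refine ⟨_, .load _ _ _ _ (by rwa [hτ.reg]), ?_, State.agreeOff_setReg ..⟩
    rw [hτ.reg, hτ.mem]
    exact hτ.setReg hf d _
  | store σ arr a b h =>
    refine ⟨_, .store _ _ _ _ (by rwa [hτ.reg]), ⟨hτ.reg, fun c => ?_⟩, ⟨fun _ _ => rfl, ?_⟩⟩
    · simp only [State.setMem, Function.update_apply, hg.eq_iff, hτ.reg, hτ.mem]
    · intro c hc
      simp only [State.setMem, Function.update_apply]
      rw [if_neg]
      rintro rfl
      exact hc ⟨arr, rfl⟩
  | seq _ _ ih₁ ih₂ =>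
    obtain ⟨τ₁, e₁, h₁, a₁⟩ := ih₁ hτ
    obtain ⟨τ₂, e₂, h₂, a₂⟩ := ih₂ h₁
    exact ⟨τ₂, .seq e₁ e₂, h₂, a₁.trans a₂⟩
  | ite_true h _ ih =>
    obtain ⟨τ₁, e₁, h₁, a₁⟩ := ih hτ
    exact ⟨τ₁, .ite_true (by rwa [hτ.reg]) e₁, h₁, a₁⟩
  | ite_false h _ ih =>
    obtain ⟨τ₁, e₁, h₁, a₁⟩ := ih hτ
    exact ⟨τ₁, .ite_false (by rwa [hτ.reg]) e₁, h₁, a₁⟩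
  | loop_done h => exact ⟨τ, .loop_done (by rwa [hτ.reg]), hτ, .refl ..⟩
  | loop_step h _ _ ih₁ ih₂ =>
    obtain ⟨τ₁, e₁, h₁, a₁⟩ := ih₁ hτ
    obtain ⟨τ₂, e₂, h₂, a₂⟩ := ih₂ h₁
    exact ⟨τ₂, .loop_step (by rwa [hτ.reg]) e₁ e₂, h₂, a₁.trans a₂⟩

/-! ### Every algorithm reads its input -/

/-- The states agree except possibly in the memory cell `c`. -/
def State.AgreeExcept (c : ℕ × BitVec w) (τ σ : State w) : Prop :=
  τ.reg = σ.reg ∧ ∀ a i, (a, i) ≠ c → τ.mem a i = σ.mem a i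

/-- An execution of `t` steps reads at most `t` memory cells, and its course does not depend on the
content of any other cell. -/
theorem Exec.exists_footprint {s : ℕ} {p : Program} {σ σ' : State w} {t : ℕ}
    (h : Exec s p σ t σ') : ∃ R : Finset (ℕ × BitVec w), R.card ≤ t ∧
      (∀ c ∈ R, c.2.toNat < s) ∧ ∀ c ∉ R, ∀ τ, State.AgreeExcept c τ σ →
        ∃ τ', Exec s p τ t τ' ∧ State.AgreeExcept c τ' σ' := by
  classical
  have setReg : ∀ {c τ σ} (d : ℕ) (v : BitVec w), State.AgreeExcept c τ σ →
      State.AgreeExcept c (τ.setReg d v) (σ.setReg d v) := by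
    rintro c τ σ d v ⟨h₁, h₂⟩
    exact ⟨by simp [State.setReg, h₁], h₂⟩
  induction h with
  | skip => exact ⟨∅, by simp, by simp, fun c _ τ hτ => ⟨τ, .skip _, hτ⟩⟩
  | const σ d v => exact ⟨∅, by simp, by simp, fun c _ τ hτ => ⟨_, .const .., setReg d _ hτ⟩⟩
  | op σ o d a b =>
    refine ⟨∅, by simp, by simp, fun c _ τ hτ => ⟨_, .op .., ?_⟩⟩
    rw [hτ.1]
    exact setReg d _ hτ
  | load σ d arr a h =>
    refine ⟨{(arr, σ.reg a)}, by simp, by simpa, fun c hc τ hτ =>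
      ⟨_, .load _ _ _ _ (by rwa [hτ.1]), ?_⟩⟩
    rw [hτ.1, hτ.2 _ _ (fun h => hc (by simp [h]))]
    exact setReg d _ hτ
  | store σ arr a b h =>
    refine ⟨∅, by simp, by simp, fun c _ τ hτ =>
      ⟨_, .store _ _ _ _ (by rwa [hτ.1]), ⟨hτ.1, fun x i hx => ?_⟩⟩⟩
    simp only [State.setMem, Function.update_apply, hτ.1]
    split_ifs with h₁
    · subst h₁
      by_cases h₂ : i = σ.reg a
      · simp [h₂]
      · simp [h₂, hτ.2 _ _ hx]
    · exact hτ.2 _ _ hx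
  | seq _ _ ih₁ ih₂ =>
    obtain ⟨R₁, c₁, s₁, h₁⟩ := ih₁
    obtain ⟨R₂, c₂, s₂, h₂⟩ := ih₂
    refine ⟨R₁ ∪ R₂, (Finset.card_union_le _ _).trans (by omega), ?_, fun c hc τ hτ => ?_⟩
    · intro c hc
      rcases Finset.mem_union.1 hc with hc | hc
      exacts [s₁ c hc, s₂ c hc]
    · rw [Finset.mem_union, not_or] at hc
      obtain ⟨τ₁, e₁, hτ₁⟩ := h₁ c hc.1 τ hτ
      obtain ⟨τ₂, e₂, hτ₂⟩ := h₂ c hc.2 τ₁ hτ₁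
      exact ⟨τ₂, .seq e₁ e₂, hτ₂⟩
  | ite_true h _ ih =>
    obtain ⟨R, c, s, h'⟩ := ih
    refine ⟨R, by omega, s, fun c hc τ hτ => ?_⟩
    obtain ⟨τ₁, e₁, hτ₁⟩ := h' c hc τ hτ
    exact ⟨τ₁, .ite_true (by rwa [hτ.1]) e₁, hτ₁⟩
  | ite_false h _ ih =>
    obtain ⟨R, c, s, h'⟩ := ih
    refine ⟨R, by omega, s, fun c hc τ hτ => ?_⟩
    obtain ⟨τ₁, e₁, hτ₁⟩ := h' c hc τ hτ
    exact ⟨τ₁, .ite_false (by rwa [hτ.1]) e₁, hτ₁⟩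
  | loop_done h => exact ⟨∅, by simp, by simp, fun c _ τ hτ => ⟨τ, .loop_done (by rwa [hτ.1]), hτ⟩⟩
  | loop_step h _ _ ih₁ ih₂ =>
    obtain ⟨R₁, c₁, s₁, h₁⟩ := ih₁
    obtain ⟨R₂, c₂, s₂, h₂⟩ := ih₂
    refine ⟨R₁ ∪ R₂, (Finset.card_union_le _ _).trans (by omega), ?_, fun c hc τ hτ => ?_⟩
    · intro c hc
      rcases Finset.mem_union.1 hc with hc | hc
      exacts [s₁ c hc, s₂ c hc]
    · rw [Finset.mem_union, not_or] at hc
      obtain ⟨τ₁, e₁, hτ₁⟩ := h₁ c hc.1 τ hτ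
      obtain ⟨τ₂, e₂, hτ₂⟩ := h₂ c hc.2 τ₁ hτ₁
      exact ⟨τ₂, .loop_step (by rwa [hτ.1]) e₁ e₂, hτ₂⟩

end Machine

theorem blockSize_pos (n : ℕ) : 0 < blockSize n := Nat.succ_pos _

theorem lt_two_pow_blockSize (n : ℕ) : n < 2 ^ blockSize n :=
  Nat.lt_pow_succ_log_self (by norm_num) n

theorem lt_packedLength_iff {b n i : ℕ} (hb : 0 < b) : i < packedLength b n ↔ i * b < n := by
  rw [packedLength, Nat.lt_iff_add_one_le, Nat.le_div_iff_mul_le hb, Nat.add_mul]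
  omega

theorem packedLength_le_self {b n : ℕ} (hb : 0 < b) : packedLength b n ≤ n := by
  by_contra h
  push Not at h
  have := (lt_packedLength_iff hb).1 h
  have := Nat.le_mul_of_pos_right n hb
  omega

theorem packedWord_eq_zero {b i : ℕ} {x : List Bool}
    (h : ∀ j < b, x.getD (i * b + j) false = false) : packedWord b x i = 0 := by
  refine Finset.sum_eq_zero fun j hj => ?_
  rw [h j (Finset.mem_range.1 hj)]
  simp

theorem packedWord_ne_zero {b i j : ℕ} {x : List Bool} (hj : j < b)
    (h : x.getD (i * b + j) false = true) : packedWord b x i ≠ 0 := by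
  refine (Finset.sum_pos' (fun _ _ => Nat.zero_le _) ⟨j, Finset.mem_range.2 hj, ?_⟩).ne'
  rw [h]
  simp

theorem getD_zeros (n i : ℕ) : (zeros n).getD i false = false := by
  rw [zeros, List.getD_eq_getElem?_getD, List.getElem?_replicate]
  split_ifs <;> rfl

/-- An algorithm whose output on `0 ⋯ 0` differs from its output on every string with both symbols
has to read every word of its input: on `0 ⋯ 0`, a symbol in an unread word could be changed without
effect on the output. Hence its time and space are at least of the order of the input size. -/
theorem packedLength_le_of_solves {Output : (w : ℕ) → List Bool → State w → Prop} {A : Program}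
    {T S : ℕ → ℝ} (h : SolvesStringProblem Output A T S)
    (hO : ∀ (w : ℕ) (x : List Bool) (σ τ : State w), blockSize x.length ≤ w → true ∈ x →
      false ∈ x → Output w (zeros x.length) σ → Output w x τ →
      ¬ (τ.reg = σ.reg ∧ ∀ a i, a ≠ 0 → τ.mem a i = σ.mem a i)) :
    ∃ K : ℕ, ∀ u, 2 ≤ u → (packedLength (blockSize u) u : ℝ) ≤ K * T u ∧
      (packedLength (blockSize u) u : ℝ) ≤ K * S u := by
  obtain ⟨c, h⟩ := h
  obtain ⟨K, h⟩ := h 1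
  refine ⟨K, fun u hu => ?_⟩
  set b := blockSize u with hb
  have hb0 : 0 < b := blockSize_pos u
  obtain ⟨w, hw₁, hw₂⟩ : ∃ w, c * b ≤ w ∧ b ≤ w := ⟨(c + 1) * b, by nlinarith, by nlinarith⟩
  have huw : u < 2 ^ w := (lt_two_pow_blockSize u).trans_le (Nat.pow_le_pow_right (by norm_num) hw₂)
  have run : ∀ x : List Bool, x.length = u → ∃ (s t : ℕ) (σ : State w),
      Exec s A (stringInput w x) t σ ∧ (t : ℝ) ≤ K * T u ∧ (s : ℝ) ≤ K * S u ∧ Output w x σ := by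
    intro x hx
    refine h u hu x ?_ (by omega) w (by rw [hx]; exact hw₁)
    rintro rfl
    simp at hx
    omega
  have hz : (zeros u).length = u := by simp [zeros]
  obtain ⟨s, t, σ, he, ht, hs, ho⟩ := run (zeros u) hz
  obtain ⟨R, hR, hRs, hRc⟩ := he.exists_footprint
  have toNat_of : ∀ {j}, j < packedLength b u → (BitVec.ofNat w j).toNat = j := by
    intro j hj
    have := packedLength_le_self (n := u) hb0
    rw [BitVec.toNat_ofNat, Nat.mod_eq_of_lt (by omega)]
  have hmem : ∀ j < packedLength b u, (0, BitVec.ofNat w j) ∈ R := by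
    intro j hj
    by_contra hnot
    have hjb := (lt_packedLength_iff hb0).1 hj
    -- the input that differs from `0 ⋯ 0` in the first symbol of the word `j` only
    set x := (zeros u).set (j * b) true with hx
    have hxl : x.length = u := by simp [hx, hz]
    have hx1 : x[j * b]'(by omega) = true := by simp [hx]
    have htrue : true ∈ x := hx1 ▸ List.getElem_mem _
    have hfalse : false ∈ x := by
      have : ∀ k, k ≠ j * b → (hk : k < x.length) → false ∈ x := by
        intro k hk hk'
        have : x[k] = false := by
          simp only [hx]
          rw [List.getElem_set_of_ne hk.symm]
          simp [zeros]
        exact this ▸ List.getElem_mem _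
      by_cases h0 : j * b = 0
      · exact this 1 (by omega) (by omega)
      · exact this 0 (by omega) (by omega)
    obtain ⟨s', t', τ, he', -, -, ho'⟩ := run x hxl
    have hagree : State.AgreeExcept (0, BitVec.ofNat w j) (stringInput w x)
        (stringInput w (zeros u)) := by
      refine ⟨by simp [stringInput, hxl, hz], fun a i hai => ?_⟩
      simp only [stringInput, hxl, hz, ← hb]
      split_ifs with ha
      · subst ha
        have hij : i.toNat ≠ j := by
          rintro rfl
          exact hai (by simp)
        rw [packedWord_eq_zero, packedWord_eq_zero]
        · exact fun k _ => getD_zeros _ _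
        · intro k hk
          have hne : j * b ≠ i.toNat * b + k := by
            intro hjk
            apply hij
            have h₁ : (i.toNat * b + k) / b = i.toNat := by
              rw [mul_comm, Nat.mul_add_div hb0, Nat.div_eq_of_lt hk, add_zero]
            rw [← h₁, ← hjk, Nat.mul_div_cancel _ hb0]
          rw [hx, List.getD_eq_getElem?_getD, List.getElem?_set_ne hne,
            ← List.getD_eq_getElem?_getD, getD_zeros]
      · rfl
    obtain ⟨τ', he'', hτ'⟩ := hRc _ hnot _ hagree
    obtain ⟨-, rfl⟩ := he''.deterministic he'
    refine hO w x σ τ' (by rw [hxl]; exact hw₂) htrue hfalse (by rwa [hxl]) ho' ⟨hτ'.1, ?_⟩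
    intro a i ha
    exact hτ'.2 a i (fun h => ha (congrArg Prod.fst h))
  have hcard : packedLength b u ≤ t := by
    refine le_trans ?_ hR
    rw [← Finset.card_range (packedLength b u)]
    refine Finset.card_le_card_of_injOn (fun j => (0, BitVec.ofNat w j)) ?_ ?_
    · intro j hj
      exact hmem j (Finset.mem_range.1 (by simpa using hj))
    · intro i hi j hj hij
      have hi' := toNat_of (Finset.mem_range.1 (by simpa using hi))
      have hj' := toNat_of (Finset.mem_range.1 (by simpa using hj))
      rw [← hi', ← hj', (Prod.mk.inj hij).2]
  have hspace : packedLength b u ≤ s := by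
    have hp : 0 < packedLength b u := (lt_packedLength_iff hb0).2 (by omega)
    have := hRs _ (hmem (packedLength b u - 1) (by omega))
    simp only at this
    rw [toNat_of (by omega)] at this
    omega
  exact ⟨le_trans (by exact_mod_cast hcard) ht, le_trans (by exact_mod_cast hspace) hs⟩

theorem bwt_perm (x : List Bool) : (bwt x).Perm x := by
  have h : (bwt x).Perm ((List.range x.length).map
      (fun i => x.getD ((i + (x.length - 1)) % x.length) false)) :=
    (List.perm_insertionSort _ _).map _
  refine h.trans ?_
  rw [List.map_congr_left (g := fun i => (x.getLastD false :: x).getD i false)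
    (fun i hi => getD_cyclic_pred x i (List.mem_range.1 hi))]
  have : (List.range x.length).map (fun i => (x.getLastD false :: x).getD i false) =
      (x.getLastD false :: x).dropLast := by
    apply List.ext_getElem
    · simp
    · intro i h₁ h₂
      simp only [List.length_map, List.length_range] at h₁
      simp only [List.getElem_map, List.getElem_range, List.getElem_dropLast]
      rw [List.getD_eq_getElem]
  rw [this]
  cases x using List.reverseRecOn with
  | nil => simp
  | append_singleton x a =>
    rw [← List.cons_append, List.dropLast_concat]
    simp only [List.getLastD_concat]
    exact (List.perm_append_singleton a x).symm

theorem length_bwt (x : List Bool) : (bwt x).length = x.length := (bwt_perm x).length_eq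

theorem bwt_zeros (n : ℕ) : bwt (zeros n) = zeros n :=
  List.perm_replicate.1 (bwt_perm (zeros n))

theorem runs_zeros (n : ℕ) : runs (zeros (n + 1)) = 1 := by
  induction n with
  | zero => rfl
  | succ n ih => simpa [zeros, List.replicate_succ, runs_cons_cons] using ih

theorem runs_le_length (x : List Bool) : runs x ≤ x.length := by
  induction x with
  | nil => simp [runs]
  | cons a x ih =>
    cases x with
    | nil => simp [runs]
    | cons b x =>
      rw [runs_cons_cons, List.length_cons]
      split_ifs <;> omega

theorem eq_replicate_of_runs_le_one {a : Bool} {x : List Bool} (h : runs (a :: x) ≤ 1) :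
    ∀ b ∈ x, b = a := by
  induction x generalizing a with
  | nil => simp
  | cons c x ih =>
    rw [runs_cons_cons] at h
    have hpos : 1 ≤ runs (c :: x) := by
      clear h ih
      induction x generalizing c with
      | nil => simp [runs]
      | cons d x ih => have := ih d; rw [runs_cons_cons]; omega
    have hac : a = c := by
      by_contra hne
      rw [if_neg hne] at h
      omega
    subst hac
    intro b hb
    rcases List.mem_cons.1 hb with rfl | hb
    · rfl
    · exact ih (by simpa using h) b hb

theorem two_le_runs {x : List Bool} (h₁ : true ∈ x) (h₂ : false ∈ x) : 2 ≤ runs x := by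
  by_contra h
  cases x with
  | nil => simp at h₁
  | cons a x =>
    have := eq_replicate_of_runs_le_one (a := a) (x := x) (by omega)
    have h₃ : ∀ b ∈ a :: x, b = a := by simpa using this
    have := h₃ _ h₁
    have := h₃ _ h₂
    simp_all

/-- The number of runs is `1` on `0 ⋯ 0` and at least `2` if both symbols occur. -/
theorem packedLength_le_of_solvesRLBWTSize {A : Program} {T S : ℕ → ℝ}
    (h : SolvesRLBWTSize A T S) : ∃ K : ℕ, ∀ u, 2 ≤ u →
      (packedLength (blockSize u) u : ℝ) ≤ K * T u ∧
      (packedLength (blockSize u) u : ℝ) ≤ K * S u := by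
  refine packedLength_le_of_solves h ?_
  rintro w x σ τ - h₁ h₂ hσ hτ ⟨h₃, -⟩
  rw [h₃, hσ] at hτ
  have h₄ : 2 ≤ rlbwtSize x := two_le_runs ((bwt_perm x).mem_iff.2 h₁) ((bwt_perm x).mem_iff.2 h₂)
  obtain ⟨n, hn⟩ := Nat.exists_eq_succ_of_ne_zero (List.length_pos_of_mem h₁).ne'
  rw [rlbwtSize, bwt_zeros, hn, runs_zeros] at hτ
  omega

/-- The transform of `0 ⋯ 0` is `0 ⋯ 0`, whereas every other transform has a nonzero word. -/
theorem packedLength_le_of_solvesBWTConstruction {A : Program} {T S : ℕ → ℝ}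
    (h : SolvesBWTConstruction A T S) : ∃ K : ℕ, ∀ u, 2 ≤ u →
      (packedLength (blockSize u) u : ℝ) ≤ K * T u ∧
      (packedLength (blockSize u) u : ℝ) ≤ K * S u := by
  refine packedLength_le_of_solves h ?_
  rintro w x σ τ - h₁ - hσ hτ ⟨-, h₃⟩
  obtain ⟨k, hk, hk'⟩ := List.getElem_of_mem ((bwt_perm x).mem_iff.2 h₁)
  have hb := blockSize_pos x.length
  have hlen : (zeros x.length).length = x.length := by simp [zeros]
  rw [hlen] at hσ
  rw [length_bwt] at hk
  have hdiv : k / blockSize x.length * blockSize x.length + k % blockSize x.length = k := by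
    rw [mul_comm]; exact Nat.div_add_mod _ _
  have hlt : k / blockSize x.length < packedLength (blockSize x.length) x.length := by
    rw [lt_packedLength_iff hb]; omega
  have e₁ := hσ _ hlt
  have e₂ := hτ _ hlt
  rw [h₃ _ _ (by norm_num), e₁, bwt_zeros, packedWord_eq_zero (fun j _ => getD_zeros _ _)] at e₂
  refine packedWord_ne_zero (Nat.mod_lt k hb) ?_ e₂.symm
  rw [hdiv, List.getD_eq_getElem _ _ (by rw [length_bwt]; exact hk), hk']

/-! ### Programs over natural numbers -/

/-- A machine state with natural numbers for words. -/
structure NState where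
  reg : ℕ → ℕ
  mem : ℕ → ℕ → ℕ

namespace NState

/-- The state after writing `v` to the register `d`. -/
def setReg (ν : NState) (d v : ℕ) : NState := ⟨Function.update ν.reg d v, ν.mem⟩

/-- The state after writing `v` to the cell `i` of the array `a`. -/
def setMem (ν : NState) (a i v : ℕ) : NState :=
  ⟨ν.reg, Function.update ν.mem a (Function.update (ν.mem a) i v)⟩

@[simp] theorem setReg_reg (ν : NState) (d v r : ℕ) :
    (ν.setReg d v).reg r = if r = d then v else ν.reg r := by
  simp [setReg, Function.update_apply]

@[simp] theorem setReg_mem (ν : NState) (d v : ℕ) : (ν.setReg d v).mem = ν.mem := rfl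

@[simp] theorem setMem_reg (ν : NState) (a i v : ℕ) : (ν.setMem a i v).reg = ν.reg := rfl

theorem setMem_mem (ν : NState) (a i v b j : ℕ) :
    (ν.setMem a i v).mem b j = if b = a ∧ j = i then v else ν.mem b j := by
  by_cases h₁ : b = a
  · subst h₁
    by_cases h₂ : j = i <;> simp [setMem, h₂]
  · simp [setMem, h₁]

end NState

/-- The registers `40, 43, 46, …` hold the intermediate results of expressions. The registers below
`40` are the variables of programs, and the two other classes modulo `3` above are left for the
registers of two programs that are called as subroutines. -/
def temp (k : ℕ) : ℕ := 40 + 3 * k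

/-- The register `r` is one of `40, 43, 46, …`. -/
def IsTemp (r : ℕ) : Prop := 40 ≤ r ∧ r % 3 = 1

instance : DecidablePred IsTemp := fun _ => inferInstanceAs (Decidable (_ ∧ _))

theorem isTemp_temp (k : ℕ) : IsTemp (temp k) := by simp only [IsTemp, temp]; omega

/-- The words of `σ` outside the temporary registers have the values given by `ν`. -/
structure Represents {w : ℕ} (σ : State w) (ν : NState) : Prop where
  reg : ∀ r, ¬ IsTemp r → (σ.reg r).toNat = ν.reg r
  mem : ∀ a (i : BitVec w), (σ.mem a i).toNat = ν.mem a i.toNat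

/-- The value of an operation in the absence of overflow. -/
def BinOp.natEval : BinOp → ℕ → ℕ → ℕ
  | .add, x, y => x + y
  | .sub, x, y => x - y
  | .mul, x, y => x * y
  | .div, x, y => x / y
  | .mod, x, y => x % y
  | .and, x, y => x &&& y
  | .or, x, y => x ||| y
  | .xor, x, y => x ^^^ y
  | .shl, x, y => x * 2 ^ y
  | .shr, x, y => x / 2 ^ y
  | .lt, x, y => if x < y then 1 else 0
  | .eq, x, y => if x = y then 1 else 0

/-- The operation does not overflow. -/
def BinOp.Fits (w : ℕ) : BinOp → ℕ → ℕ → Prop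
  | .add, x, y => x + y < 2 ^ w
  | .sub, x, y => y ≤ x
  | .mul, x, y => x * y < 2 ^ w
  | .shl, x, y => x * 2 ^ y < 2 ^ w
  | _, _, _ => True

theorem BinOp.toNat_eval {w : ℕ} (hw : 0 < w) (o : BinOp) (x y : BitVec w)
    (h : o.Fits w x.toNat y.toNat) : (o.eval x y).toNat = o.natEval x.toNat y.toNat := by
  have h1 : (1 : ℕ) < 2 ^ w := Nat.one_lt_two_pow hw.ne'
  cases o <;> simp only [BinOp.eval, BinOp.natEval, BinOp.Fits] at *
  · rw [BitVec.toNat_add, Nat.mod_eq_of_lt h]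
  · rw [BitVec.toNat_sub_of_le (by rwa [BitVec.le_def])]
  · rw [BitVec.toNat_mul, Nat.mod_eq_of_lt h]
  · rw [BitVec.toNat_udiv]
  · rw [BitVec.toNat_umod]
  · rw [BitVec.toNat_and]
  · rw [BitVec.toNat_or]
  · rw [BitVec.toNat_xor]
  · rw [BitVec.shiftLeft_eq', BitVec.toNat_shiftLeft, Nat.shiftLeft_eq, Nat.mod_eq_of_lt h]
  · rw [BitVec.ushiftRight_eq', BitVec.toNat_ushiftRight, Nat.shiftRight_eq_div_pow]
  · split_ifs <;> simp [Nat.mod_eq_of_lt h1]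
  · simp only [← BitVec.toNat_inj]
    split_ifs <;> simp [Nat.mod_eq_of_lt h1]

/-- Expressions over registers and array cells. -/
inductive Ex
  | reg (r : ℕ)
  | const (v : ℕ)
  | bin (o : BinOp) (a b : Ex)
  | load (arr : ℕ) (a : Ex)

namespace Ex

instance (n : ℕ) : OfNat Ex n := ⟨.const n⟩
instance : Add Ex := ⟨.bin .add⟩
instance : Sub Ex := ⟨.bin .sub⟩
instance : Mul Ex := ⟨.bin .mul⟩
instance : Div Ex := ⟨.bin .div⟩
instance : Mod Ex := ⟨.bin .mod⟩

/-- The value of an expression. -/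
def eval (ν : NState) : Ex → ℕ
  | .reg r => ν.reg r
  | .const v => v
  | .bin o a b => o.natEval (a.eval ν) (b.eval ν)
  | .load arr a => ν.mem arr (a.eval ν)

/-- The expression can be evaluated on `w`-bit words without overflow and without access to array
cells beyond `s`. -/
def Valid (w s : ℕ) (ν : NState) : Ex → Prop
  | .reg r => ¬ IsTemp r
  | .const v => v < 2 ^ w
  | .bin o a b => a.Valid w s ν ∧ b.Valid w s ν ∧ o.Fits w (a.eval ν) (b.eval ν)
  | .load _ a => a.Valid w s ν ∧ a.eval ν < s

/-- The number of machine steps in the evaluation of an expression. -/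
def cost : Ex → ℕ
  | .reg _ => 1
  | .const _ => 1
  | .bin _ a b => a.cost + (b.cost + 1)
  | .load _ a => a.cost + 1

/-- A program that evaluates an expression into the temporary register `k`. -/
def code : ℕ → Ex → Program
  | k, .reg r => .op .and (temp k) r r
  | k, .const v => .const (temp k) v
  | k, .bin o a b => .seq (a.code k) (.seq (b.code (k + 1)) (.op o (temp k) (temp k) (temp (k + 1))))
  | k, .load arr a => .seq (a.code k) (.load (temp k) arr (temp k))

variable (ν : NState) (w s : ℕ) (a b : Ex) (n : ℕ)

@[simp] theorem eval_reg (r : ℕ) : (reg r).eval ν = ν.reg r := rfl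
@[simp] theorem eval_const (v : ℕ) : (const v).eval ν = v := rfl
@[simp] theorem eval_ofNat : (ofNat(n) : Ex).eval ν = n := rfl
@[simp] theorem eval_add : (a + b).eval ν = a.eval ν + b.eval ν := rfl
@[simp] theorem eval_sub : (a - b).eval ν = a.eval ν - b.eval ν := rfl
@[simp] theorem eval_mul : (a * b).eval ν = a.eval ν * b.eval ν := rfl
@[simp] theorem eval_div : (a / b).eval ν = a.eval ν / b.eval ν := rfl
@[simp] theorem eval_mod : (a % b).eval ν = a.eval ν % b.eval ν := rfl
@[simp] theorem eval_bin (o : BinOp) : (bin o a b).eval ν = o.natEval (a.eval ν) (b.eval ν) := rfl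
@[simp] theorem eval_load (arr : ℕ) : (load arr a).eval ν = ν.mem arr (a.eval ν) := rfl

@[simp] theorem cost_reg (r : ℕ) : (reg r).cost = 1 := rfl
@[simp] theorem cost_ofNat : (ofNat(n) : Ex).cost = 1 := rfl
@[simp] theorem cost_const (v : ℕ) : (const v).cost = 1 := rfl
@[simp] theorem cost_add : (a + b).cost = a.cost + (b.cost + 1) := rfl
@[simp] theorem cost_sub : (a - b).cost = a.cost + (b.cost + 1) := rfl
@[simp] theorem cost_mul : (a * b).cost = a.cost + (b.cost + 1) := rfl
@[simp] theorem cost_div : (a / b).cost = a.cost + (b.cost + 1) := rfl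
@[simp] theorem cost_mod : (a % b).cost = a.cost + (b.cost + 1) := rfl
@[simp] theorem cost_bin (o : BinOp) : (bin o a b).cost = a.cost + (b.cost + 1) := rfl
@[simp] theorem cost_load (arr : ℕ) : (load arr a).cost = a.cost + 1 := rfl

@[simp] theorem valid_reg (r : ℕ) : (reg r).Valid w s ν ↔ ¬ IsTemp r := Iff.rfl
@[simp] theorem valid_const (v : ℕ) : (const v).Valid w s ν ↔ v < 2 ^ w := Iff.rfl
@[simp] theorem valid_ofNat : (ofNat(n) : Ex).Valid w s ν ↔ n < 2 ^ w := Iff.rfl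
@[simp] theorem valid_add : (a + b).Valid w s ν ↔
    a.Valid w s ν ∧ b.Valid w s ν ∧ a.eval ν + b.eval ν < 2 ^ w := Iff.rfl
@[simp] theorem valid_sub : (a - b).Valid w s ν ↔
    a.Valid w s ν ∧ b.Valid w s ν ∧ b.eval ν ≤ a.eval ν := Iff.rfl
@[simp] theorem valid_mul : (a * b).Valid w s ν ↔
    a.Valid w s ν ∧ b.Valid w s ν ∧ a.eval ν * b.eval ν < 2 ^ w := Iff.rfl
@[simp] theorem valid_div : (a / b).Valid w s ν ↔ a.Valid w s ν ∧ b.Valid w s ν :=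
  ⟨fun h => ⟨h.1, h.2.1⟩, fun h => ⟨h.1, h.2, trivial⟩⟩
@[simp] theorem valid_mod : (a % b).Valid w s ν ↔ a.Valid w s ν ∧ b.Valid w s ν :=
  ⟨fun h => ⟨h.1, h.2.1⟩, fun h => ⟨h.1, h.2, trivial⟩⟩
@[simp] theorem valid_bin (o : BinOp) : (bin o a b).Valid w s ν ↔
    a.Valid w s ν ∧ b.Valid w s ν ∧ o.Fits w (a.eval ν) (b.eval ν) := Iff.rfl
@[simp] theorem valid_load (arr : ℕ) : (load arr a).Valid w s ν ↔
    a.Valid w s ν ∧ a.eval ν < s := Iff.rfl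

end Ex

theorem temp_injective {j k : ℕ} (h : temp j = temp k) : j = k := by simp only [temp] at h; omega

theorem Represents.setReg_temp {w : ℕ} {σ : State w} {ν : NState} (h : Represents σ ν) (k : ℕ)
    (v : BitVec w) : Represents (σ.setReg (temp k) v) ν := by
  refine ⟨fun r hr => ?_, h.mem⟩
  have : r ≠ temp k := by rintro rfl; exact hr (isTemp_temp k)
  simp [State.setReg, this, h.reg r hr]

theorem setReg_temp_of_lt {w : ℕ} (τ : State w) (v : BitVec w) {j k : ℕ} (hj : j < k) :
    (τ.setReg (temp k) v).reg (temp j) = τ.reg (temp j) := by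
  have : temp j ≠ temp k := fun h => hj.ne (temp_injective h)
  simp [State.setReg, this]

theorem setReg_self {w : ℕ} (τ : State w) (d : ℕ) (v : BitVec w) : (τ.setReg d v).reg d = v := by
  simp [State.setReg]

/-- Correctness of the code of an expression. It leaves the temporary registers below `k` unchanged,
which allows for the evaluation of the second operand of an operation. -/
theorem Ex.exec_code {w s : ℕ} (hw : 0 < w) {ν : NState} (e : Ex) (he : e.Valid w s ν) (k : ℕ)
    (σ : State w) (hσ : Represents σ ν) :
    ∃ σ', Exec s (e.code k) σ e.cost σ' ∧ Represents σ' ν ∧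
      (σ'.reg (temp k)).toNat = e.eval ν ∧ ∀ j < k, σ'.reg (temp j) = σ.reg (temp j) := by
  induction e generalizing k σ with
  | reg r =>
    refine ⟨_, .op .., hσ.setReg_temp _ _, ?_, fun j hj => setReg_temp_of_lt _ _ hj⟩
    rw [setReg_self]
    simp [BinOp.eval, hσ.reg r he]
  | const v =>
    refine ⟨_, .const .., hσ.setReg_temp _ _, ?_, fun j hj => setReg_temp_of_lt _ _ hj⟩
    rw [setReg_self, BitVec.toNat_ofNat, Nat.mod_eq_of_lt he]
    rfl
  | bin o a b iha ihb =>
    obtain ⟨ha, hb, ho⟩ := he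
    obtain ⟨σ₁, e₁, r₁, v₁, f₁⟩ := iha ha k σ hσ
    obtain ⟨σ₂, e₂, r₂, v₂, f₂⟩ := ihb hb (k + 1) σ₁ r₁
    refine ⟨_, .seq e₁ (.seq e₂ (.op ..)), r₂.setReg_temp _ _, ?_, ?_⟩
    · have h₁ : (σ₂.reg (temp k)).toNat = a.eval ν := by rw [f₂ k (by omega), v₁]
      rw [setReg_self, BinOp.toNat_eval hw _ _ _ (by rw [h₁, v₂]; exact ho), h₁, v₂]
      rfl
    · intro j hj
      rw [setReg_temp_of_lt _ _ hj, f₂ j (by omega), f₁ j hj]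
  | load arr a iha =>
    obtain ⟨ha, hs⟩ := he
    obtain ⟨σ₁, e₁, r₁, v₁, f₁⟩ := iha ha k σ hσ
    refine ⟨_, .seq e₁ (.load _ _ _ _ (by rw [v₁]; exact hs)), r₁.setReg_temp _ _, ?_, ?_⟩
    · rw [setReg_self, r₁.mem, v₁]
      rfl
    · intro j hj
      rw [setReg_temp_of_lt _ _ hj, f₁ j hj]

/-- `reg d := e` -/
def assign (d : ℕ) (e : Ex) : Program := .seq (e.code 0) (.op .and d (temp 0) (temp 0))

/-- `arr[e₁] := e₂` -/
def write (arr : ℕ) (e₁ e₂ : Ex) : Program :=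
  .seq (e₁.code 0) (.seq (e₂.code 1) (.store arr (temp 0) (temp 1)))

/-- The sequential composition of a list of programs. -/
def block : List Program → Program
  | [] => .skip
  | p :: l => .seq p (block l)

/-- Total correctness with bounds: from every machine state represented by `ν`, the program `p`
halts within `t` steps and `s` words per array in a state represented by some `ν'` with `Q ν'`. -/
def Runs (w s : ℕ) (p : Program) (t : ℕ) (ν : NState) (Q : NState → Prop) : Prop :=
  ∀ σ : State w, Represents σ ν →
    ∃ t' ≤ t, ∃ σ' ν', Exec s p σ t' σ' ∧ Represents σ' ν' ∧ Q ν'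

namespace Runs

variable {w s : ℕ} {p q : Program} {l : List Program} {t t' : ℕ} {ν : NState} {Q Q' : NState → Prop}

theorem mono (h : Runs w s p t ν Q) (ht : t ≤ t') (hQ : ∀ ν', Q ν' → Q' ν') :
    Runs w s p t' ν Q' := by
  intro σ hσ
  obtain ⟨t₁, ht₁, σ₁, ν₁, e₁, r₁, q₁⟩ := h σ hσ
  exact ⟨t₁, ht₁.trans ht, σ₁, ν₁, e₁, r₁, hQ _ q₁⟩

theorem seq (h : Runs w s p t ν (fun ν' => Runs w s q t' ν' Q)) :
    Runs w s (.seq p q) (t + t') ν Q := by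
  intro σ hσ
  obtain ⟨t₁, ht₁, σ₁, ν₁, e₁, r₁, q₁⟩ := h σ hσ
  obtain ⟨t₂, ht₂, σ₂, ν₂, e₂, r₂, q₂⟩ := q₁ σ₁ r₁
  exact ⟨t₁ + t₂, by omega, σ₂, ν₂, .seq e₁ e₂, r₂, q₂⟩

theorem block_nil (h : Q ν) : Runs w s (block []) 1 ν Q :=
  fun σ hσ => ⟨1, le_rfl, σ, ν, .skip σ, hσ, h⟩

theorem block_cons (h : Runs w s p t ν (fun ν' => Runs w s (block l) t' ν' Q)) :
    Runs w s (block (p :: l)) (t + t') ν Q := h.seq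

theorem assign (hw : 0 < w) {d : ℕ} {e : Ex} (he : e.Valid w s ν)
    (hQ : Q (ν.setReg d (e.eval ν))) : Runs w s (assign d e) (e.cost + 1) ν Q := by
  intro σ hσ
  obtain ⟨σ₁, e₁, r₁, v₁, -⟩ := e.exec_code hw he 0 σ hσ
  refine ⟨_, le_rfl, _, ν.setReg d (e.eval ν), .seq e₁ (.op ..), ⟨fun r hr => ?_, r₁.mem⟩, hQ⟩
  simp only [State.setReg, Function.update_apply, NState.setReg_reg]
  split_ifs
  · simp [BinOp.eval, v₁]
  · exact r₁.reg r hr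

theorem block_assign (hw : 0 < w) {d : ℕ} {e : Ex} (he : e.Valid w s ν)
    (hQ : Runs w s (block l) t (ν.setReg d (e.eval ν)) Q) :
    Runs w s (block (BWTReduction.assign d e :: l)) (e.cost + 1 + t) ν Q :=
  block_cons (Runs.assign hw he hQ)

theorem block_assign_of_eq (hw : 0 < w) {d v : ℕ} {e : Ex} (he : e.Valid w s ν) (hv : e.eval ν = v)
    (hQ : Runs w s (block l) t (ν.setReg d v) Q) :
    Runs w s (block (BWTReduction.assign d e :: l)) (e.cost + 1 + t) ν Q :=
  block_assign hw he (hv ▸ hQ)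

theorem block_write (hw : 0 < w) {arr : ℕ} {e₁ e₂ : Ex} (he₁ : e₁.Valid w s ν)
    (he₂ : e₂.Valid w s ν) (hs : e₁.eval ν < s)
    (hQ : Runs w s (block l) t (ν.setMem arr (e₁.eval ν) (e₂.eval ν)) Q) :
    Runs w s (block (write arr e₁ e₂ :: l)) (e₁.cost + (e₂.cost + 1) + t) ν Q := by
  refine block_cons ?_
  intro σ hσ
  obtain ⟨σ₁, x₁, r₁, v₁, -⟩ := e₁.exec_code hw he₁ 0 σ hσ
  obtain ⟨σ₂, x₂, r₂, v₂, f₂⟩ := e₂.exec_code hw he₂ 1 σ₁ r₁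
  have v₁' : (σ₂.reg (temp 0)).toNat = e₁.eval ν := by rw [f₂ 0 (by omega), v₁]
  refine ⟨_, le_rfl, _, ν.setMem arr (e₁.eval ν) (e₂.eval ν),
    .seq x₁ (.seq x₂ (.store _ _ _ _ (by rw [v₁']; exact hs))),
    ⟨r₂.reg, fun a i => ?_⟩, hQ⟩
  rw [NState.setMem_mem, ← v₁', ← v₂]
  by_cases h₁ : a = arr
  · subst h₁
    by_cases h₂ : i = σ₂.reg (temp 0)
    · simp [State.setMem, h₂]
    · simp [State.setMem, BitVec.toNat_inj, h₂, r₂.mem]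
  · simp [State.setMem, h₁, r₂.mem]

/-- The rule for loops; the invariant is indexed by the number of remaining iterations. -/
theorem loop {a : ℕ} (ha : ¬ IsTemp a) (I : ℕ → NState → Prop)
    (hstep : ∀ j ν, I (j + 1) ν → ν.reg a ≠ 0 ∧ Runs w s p t ν (I j))
    (hzero : ∀ ν, I 0 ν → ν.reg a = 0) (j : ℕ) (hI : I j ν) :
    Runs w s (.loop a p) (j * (t + 1) + 1) ν (I 0) := by
  induction j generalizing ν with
  | zero =>
    intro σ hσ
    refine ⟨1, by omega, σ, ν, .loop_done ?_, hσ, hI⟩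
    rw [← BitVec.toNat_inj, hσ.reg a ha, hzero ν hI]
    simp
  | succ j ih =>
    intro σ hσ
    obtain ⟨hne, hrun⟩ := hstep j ν hI
    obtain ⟨t₁, ht₁, σ₁, ν₁, e₁, r₁, q₁⟩ := hrun σ hσ
    obtain ⟨t₂, ht₂, σ₂, ν₂, e₂, r₂, q₂⟩ := ih q₁ σ₁ r₁
    refine ⟨t₁ + t₂ + 1, ?_, σ₂, ν₂, .loop_step ?_ e₁ e₂, r₂, q₂⟩
    · rw [Nat.add_mul]; omega
    · rw [Ne, ← BitVec.toNat_inj, hσ.reg a ha]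
      simpa using hne

end Runs

/-! ### Binary strings as numbers -/

/-- The number whose binary digits, least significant first, are the symbols of the string. -/
def val : List Bool → ℕ
  | [] => 0
  | a :: l => a.toNat + 2 * val l

theorem val_append (x y : List Bool) : val (x ++ y) = val x + 2 ^ x.length * val y := by
  induction x with
  | nil => simp [val]
  | cons a x ih => simp only [List.cons_append, val, ih, List.length_cons, pow_succ]; ring

theorem val_lt (x : List Bool) : val x < 2 ^ x.length := by
  induction x with
  | nil => simp [val]
  | cons a x ih =>
    have := Bool.toNat_lt a
    simp only [val, List.length_cons, pow_succ]
    omega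

theorem val_take_add (x : List Bool) (k : ℕ) :
    val (x.take k) + 2 ^ k * val (x.drop k) = val x := by
  rcases le_total k x.length with h | h
  · conv_rhs => rw [← List.take_append_drop k x, val_append, List.length_take, min_eq_left h]
  · simp [List.take_of_length_le h, List.drop_of_length_le h, val]

theorem val_take_lt (x : List Bool) (k : ℕ) : val (x.take k) < 2 ^ k :=
  (val_lt _).trans_le (Nat.pow_le_pow_right (by norm_num) (by simp))

theorem val_take (x : List Bool) (k : ℕ) : val (x.take k) = val x % 2 ^ k := by
  rw [← val_take_add x k, Nat.add_mul_mod_self_left, Nat.mod_eq_of_lt (val_take_lt x k)]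

theorem val_drop (x : List Bool) (k : ℕ) : val (x.drop k) = val x / 2 ^ k := by
  rw [← val_take_add x k, Nat.add_mul_div_left _ _ (by positivity),
    Nat.div_eq_of_lt (val_take_lt x k), zero_add]

theorem testBit_val (x : List Bool) (j : ℕ) : (val x).testBit j = x.getD j false := by
  induction x generalizing j with
  | nil => simp [val]
  | cons a x ih =>
    have h : val (a :: x) = Nat.bit a (val x) := by
      rw [Nat.bit_val, val]; ring
    cases j with
    | zero => rw [h, Nat.testBit_bit_zero]; rfl
    | succ j => rw [h, Nat.testBit_bit_succ, ih]; rfl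

theorem packedWord_eq (b : ℕ) (x : List Bool) (i : ℕ) :
    packedWord b x i = val x / 2 ^ (i * b) % 2 ^ b := by
  have h : ∀ c, ∑ j ∈ Finset.range c, (if x.getD (i * b + j) false then 2 ^ j else 0) =
      val x / 2 ^ (i * b) % 2 ^ c := by
    intro c
    induction c with
    | zero => simp [Nat.mod_one]
    | succ c ih =>
      rw [Finset.sum_range_succ, ih, Nat.mod_pow_succ, ← Nat.toNat_testBit, Nat.testBit_div_two_pow,
        testBit_val, add_comm c]
      cases x.getD (i * b + c) false <;> simp
  exact h b

theorem packedWord_eq_val (b : ℕ) (x : List Bool) (i : ℕ) :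
    packedWord b x i = val ((x.drop (i * b)).take b) := by
  rw [packedWord_eq, val_take, val_drop]

theorem packedWord_lt (b : ℕ) (x : List Bool) (i : ℕ) : packedWord b x i < 2 ^ b := by
  rw [packedWord_eq]; exact Nat.mod_lt _ (by positivity)

/-- The number obtained from `v` by moving its binary digit `j` to the position `e * j`, for all
`j`; for `e = 0` the digits are added up. -/
def stretch (e v : ℕ) : ℕ :=
  if h : v = 0 then 0 else v % 2 + 2 ^ e * stretch e (v / 2)
termination_by v
decreasing_by omega

theorem stretch_zero (e : ℕ) : stretch e 0 = 0 := by rw [stretch]; simp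

theorem stretch_eq (e v : ℕ) : stretch e v = v % 2 + 2 ^ e * stretch e (v / 2) := by
  by_cases h : v = 0
  · simp [h, stretch_zero]
  · rw [stretch, dif_neg h]

theorem stretch_add (e : ℕ) {h x : ℕ} (y : ℕ) (hx : x < 2 ^ h) :
    stretch e (x + 2 ^ h * y) = stretch e x + 2 ^ (e * h) * stretch e y := by
  induction h generalizing x with
  | zero => obtain rfl : x = 0 := by simpa using hx
            simp [stretch_zero]
  | succ h ih =>
    rw [pow_succ] at hx
    have h₁ : (x + 2 ^ (h + 1) * y) % 2 = x % 2 := by rw [pow_succ]; rw [mul_assoc, mul_left_comm]; omega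
    have h₂ : (x + 2 ^ (h + 1) * y) / 2 = x / 2 + 2 ^ h * y := by
      rw [pow_succ, mul_assoc, mul_left_comm]; omega
    rw [stretch_eq e (x + _), h₁, h₂, ih (by omega), stretch_eq e x, mul_add, mul_add, mul_one,
      pow_add]
    ring

theorem stretch_mod_add_div (e v h : ℕ) :
    stretch e (v % 2 ^ h) + 2 ^ (e * h) * stretch e (v / 2 ^ h) = stretch e v := by
  rw [← stretch_add e _ (Nat.mod_lt _ (by positivity)), Nat.mod_add_div]

theorem stretch_lt (e : ℕ) {v l : ℕ} (hv : v < 2 ^ l) : stretch e v < 2 ^ ((e + 1) * l) := by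
  induction l generalizing v with
  | zero => obtain rfl : v = 0 := by simpa using hv
            simp [stretch_zero]
  | succ l ih =>
    rw [stretch_eq, mul_add, mul_one, pow_add, pow_succ 2 e]
    have := ih (v := v / 2) (by rw [pow_succ] at hv; omega)
    have h₁ : 2 ^ e * (stretch e (v / 2) + 1) ≤ 2 ^ e * 2 ^ ((e + 1) * l) :=
      Nat.mul_le_mul_left _ this
    have h₂ : 1 ≤ 2 ^ e := Nat.one_le_two_pow
    have h₃ : 2 ^ ((e + 1) * l) * (2 ^ e * 2) = 2 * (2 ^ e * 2 ^ ((e + 1) * l)) := by ring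
    rw [h₃]
    have h₄ : v % 2 < 2 := Nat.mod_lt _ (by norm_num)
    rw [mul_add] at h₁
    omega

/-- The number of a spread string is that of the stretched symbols plus that of the inserted `10`s,
a geometric sum of powers of `8`. -/
theorem val_spread (x : List Bool) :
    val (spread x) = stretch 3 (val x) + 2 * ((2 ^ (3 * x.length) - 1) / 7) := by
  have key : 7 * val (spread x) + 2 = 7 * stretch 3 (val x) + 2 * 2 ^ (3 * x.length) := by
    induction x with
    | nil => simp [spread, val, stretch_zero]
    | cons a x ih =>
      have h₁ : val (spread (a :: x)) = a.toNat + 2 * (1 + 2 * (0 + 2 * val (spread x))) := rfl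
      have h₂ : val (a :: x) = a.toNat + 2 ^ 1 * val x := by simp [val]
      have h₃ : stretch 3 a.toNat = a.toNat := by
        cases a <;> rw [stretch_eq] <;> simp [stretch_zero]
      rw [h₁, h₂, stretch_add 3 _ (by simpa using Bool.toNat_lt a), h₃, List.length_cons,
        mul_add 3, pow_add]
      omega
  have h8 : ∀ l, 2 ^ (3 * l) % 7 = 1 := by
    intro l
    rw [pow_mul, Nat.pow_mod]; simp
  have := h8 x.length
  omega

/-! ### Counting runs word by word -/

/-- The number of positions of `x` whose symbol differs from the preceding one, where `a` precedes
the first position. -/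
def changes : Bool → List Bool → ℕ
  | _, [] => 0
  | a, c :: l => (a ^^ c).toNat + changes c l

theorem runs_cons_eq_changes (a : Bool) (l : List Bool) : runs (a :: l) = changes (!a) (a :: l) := by
  induction l generalizing a with
  | nil => simp [runs, changes]
  | cons c l ih =>
    rw [runs_cons_cons, ih c]
    cases a <;> cases c <;> simp [changes]

theorem changes_append (a : Bool) (x y : List Bool) :
    changes a (x ++ y) = changes a x + changes ((a :: x).getLast (by simp)) y := by
  induction x generalizing a with
  | nil => simp [changes]
  | cons c x ih => simp [changes, ih, add_assoc]

/-- The symbol changes are the ones in the exclusive disjunction of the string and its shift by one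
position. -/
theorem changes_eq_stretch (a : Bool) (x : List Bool) :
    changes a x = stretch 0 ((val x ^^^ (2 * val x + a.toNat)) % 2 ^ x.length) := by
  induction x generalizing a with
  | nil => simp [changes, Nat.mod_one, stretch_zero]
  | cons c x ih =>
    have h₁ : val (c :: x) = Nat.bit c (val x) := by rw [Nat.bit_val, val]; ring
    have h₂ : 2 * val (c :: x) + a.toNat = Nat.bit a (2 * val x + c.toNat) := by
      rw [Nat.bit_val, val]; ring
    rw [changes, ih c, h₂, h₁, Nat.xor_bit, Nat.bit_val, List.length_cons, pow_succ']
    generalize val x ^^^ (2 * val x + c.toNat) = u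
    have h₃ : (2 * u + (c ^^ a).toNat) % (2 * 2 ^ x.length) =
        2 * (u % 2 ^ x.length) + (c ^^ a).toNat := by
      have hb := Bool.toNat_lt (c ^^ a)
      rw [Nat.mod_mul]
      have e₁ : (2 * u + (c ^^ a).toNat) / 2 = u := by omega
      have e₂ : (2 * u + (c ^^ a).toNat) % 2 = (c ^^ a).toNat := by omega
      rw [e₁, e₂]; ring
    have hb := Bool.toNat_lt (c ^^ a)
    rw [h₃, stretch_eq 0 (2 * (u % 2 ^ x.length) + _), Bool.xor_comm a c]
    have e₁ : (2 * (u % 2 ^ x.length) + (c ^^ a).toNat) / 2 = u % 2 ^ x.length := by omega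
    have e₂ : (2 * (u % 2 ^ x.length) + (c ^^ a).toNat) % 2 = (c ^^ a).toNat := by omega
    rw [e₁, e₂]
    simp

theorem val_div_eq_getLast (x : List Bool) (hx : x ≠ []) :
    val x / 2 ^ (x.length - 1) = (x.getLast hx).toNat := by
  rw [← val_drop, List.drop_length_sub_one hx]
  simp [val]

/-! ### Block size and lookup table -/

/-- `ν'` differs from `ν` at most in the registers `l, …, u` and in the array `arr`. -/
structure Frame (l u arr : ℕ) (ν ν' : NState) : Prop where
  reg : ∀ r, r < l ∨ u < r → ν'.reg r = ν.reg r
  mem : ∀ a, a ≠ arr → ν'.mem a = ν.mem a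

namespace Frame

variable {l u arr : ℕ} {ν ν' ν'' : NState}

theorem refl (l u arr : ℕ) (ν : NState) : Frame l u arr ν ν := ⟨fun _ _ => rfl, fun _ _ => rfl⟩

theorem trans (h : Frame l u arr ν ν') (h' : Frame l u arr ν' ν'') : Frame l u arr ν ν'' :=
  ⟨fun r hr => (h'.reg r hr).trans (h.reg r hr), fun a ha => (h'.mem a ha).trans (h.mem a ha)⟩

theorem mono (h : Frame l u arr ν ν') {l' u' : ℕ} (hl : l' ≤ l) (hu : u ≤ u') :
    Frame l' u' arr ν ν' := ⟨fun r hr => h.reg r (by omega), h.mem⟩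

theorem setReg (h : Frame l u arr ν ν') {d : ℕ} (hd : l ≤ d ∧ d ≤ u) (v : ℕ) :
    Frame l u arr ν (ν'.setReg d v) := by
  refine ⟨fun r hr => ?_, h.mem⟩
  rw [NState.setReg_reg, if_neg (by omega), h.reg r hr]

theorem setMem (h : Frame l u arr ν ν') (i v : ℕ) : Frame l u arr ν (ν'.setMem arr i v) := by
  refine ⟨h.reg, fun a ha => ?_⟩
  rw [← h.mem a ha]
  funext j
  rw [NState.setMem_mem, if_neg (by tauto)]

end Frame

/-- Sets register `d` to the length of the binary representation of register `src`. -/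
def bitLength (d src : ℕ) : Program := block [
  assign d 0,
  assign 30 (.reg src),
  .loop 30 (block [assign 30 (.reg 30 / 2), assign d (.reg d + 1)])]

theorem two_pow_le_of_blockSize {x j : ℕ} (hx : 0 < x) (h : j < blockSize x) : 2 ^ j ≤ x :=
  Nat.pow_le_of_le_log hx.ne' (by rw [blockSize] at h; omega)

theorem runs_bitLength {w s d src : ℕ} {ν : NState} (hw : 2 ≤ w) (hd : d < 30) (hsrc : src < 30)
    (hne : src ≠ d) (hx : 0 < ν.reg src) (hL : blockSize (ν.reg src) < 2 ^ w) :
    Runs w s (bitLength d src) (10 * blockSize (ν.reg src) + 6) ν (fun ν' =>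
      ν'.reg d = blockSize (ν.reg src) ∧ (∀ r, r ≠ d → r ≠ 30 → ν'.reg r = ν.reg r) ∧
      ν'.mem = ν.mem) := by
  have h4 : 2 ^ 2 ≤ 2 ^ w := Nat.pow_le_pow_right (by norm_num) hw
  have hts : ¬ IsTemp src := by simp only [IsTemp]; omega
  have htd : ¬ IsTemp d := by simp only [IsTemp]; omega
  have ht : ¬ IsTemp 30 := by decide
  set x := ν.reg src with hxd
  set L := blockSize x with hLd
  refine Runs.mono (Runs.block_assign (by omega) (by simp) <|
    Runs.block_assign (by omega) (by simp [hts]) <| Runs.block_cons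
      (t' := 1) (Runs.mono (Runs.loop (t := 9) ht (fun j ν' => ν'.reg 30 = x / 2 ^ ν'.reg d ∧
        ν'.reg d + j = L ∧ (∀ r, r ≠ d → r ≠ 30 → ν'.reg r = ν.reg r) ∧ ν'.mem = ν.mem)
        ?_ ?_ L ?_) le_rfl ?_)) ?_ (fun _ h => h)
  · rintro j ν' ⟨h₁, h₂, h₃, h₄⟩
    refine ⟨?_, ?_⟩
    · rw [h₁]
      have := two_pow_le_of_blockSize hx (j := ν'.reg d) (by omega)
      exact (Nat.div_pos this (by positivity)).ne'
    · refine Runs.mono (Runs.block_assign (by omega) (by simp [ht]; omega) <|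
        Runs.block_assign (by omega) ?_ <| Runs.block_nil ?_) (by simp) (fun _ h => h)
      · simp only [Ex.valid_add, Ex.valid_reg, htd, Ex.valid_ofNat, Ex.eval_reg, Ex.eval_ofNat,
          NState.setReg_reg, if_neg (show d ≠ 30 by omega), not_false_eq_true, true_and]
        omega
      · simp only [NState.setReg_reg, Ex.eval_add, Ex.eval_reg, Ex.eval_ofNat, NState.setReg_mem,
          Ex.eval_div, if_neg (show 30 ≠ d by omega), if_true, if_neg (show d ≠ 30 by omega)]
        refine ⟨?_, by omega, ?_, h₄⟩
        · rw [h₁, Nat.div_div_eq_div_mul, pow_succ]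
        · intro r hr hr'
          rw [if_neg hr, if_neg hr', h₃ r hr hr']
  · rintro ν' ⟨h₁, h₂, -⟩
    rw [h₁]
    apply Nat.div_eq_of_lt
    rw [add_zero] at h₂
    rw [h₂]
    exact lt_two_pow_blockSize x
  · simp only [NState.setReg_reg, Ex.eval_reg, Ex.eval_ofNat, NState.setReg_mem,
      if_neg (show d ≠ 30 by omega), if_true, if_neg hne]
    refine ⟨by simp [hxd], by omega, ?_, trivial⟩
    intro r hr hr'
    rw [if_neg hr', if_neg hr]
  · rintro ν' ⟨-, h₂, h₃, h₄⟩
    exact Runs.block_nil ⟨h₂, h₃, h₄⟩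
  · simp; omega

/-- Fills the first `reg 5` entries of array 2 with the values of `stretch e`. -/
def fillTable (e : ℕ) : Program := block [
  assign 30 0,
  assign 31 (.reg 5),
  .loop 31 (block [
    write 2 (.reg 30) (.load 2 (.reg 30 / 2) * .const (2 ^ e) + .reg 30 % 2),
    assign 30 (.reg 30 + 1),
    assign 31 (.reg 31 - 1)])]

theorem runs_fillTable {w s e h : ℕ} {ν : NState} (hw : 2 ≤ w) (hwe : (e + 1) * (h + 1) ≤ w)
    (h₅ : ν.reg 5 = 2 ^ h) (hs : 2 ^ h ≤ s) (h0 : ν.mem 2 0 = 0) :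
    Runs w s (fillTable e) (24 * 2 ^ h + 6) ν (fun ν' =>
      (∀ i < 2 ^ h, ν'.mem 2 i = stretch e i) ∧ Frame 30 31 2 ν ν') := by
  have h4 : 2 ^ 2 ≤ 2 ^ w := Nat.pow_le_pow_right (by norm_num) hw
  have hHw : 2 ^ h < 2 ^ w := Nat.pow_lt_pow_right (by norm_num) (by nlinarith)
  have t30 : ¬ IsTemp 30 := by decide
  have t31 : ¬ IsTemp 31 := by decide
  have t5 : ¬ IsTemp 5 := by decide
  have hew : 2 ^ e < 2 ^ w := Nat.pow_lt_pow_right (by norm_num) (by nlinarith)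
  refine Runs.mono (Runs.block_assign (by omega) (by simp) <|
    Runs.block_assign (by omega) (by simp [t5]) <| Runs.block_cons
      (t' := 1) (Runs.mono (Runs.loop (t := 24 - 1) t31 (fun j ν' => ν'.reg 31 = j ∧
        ν'.reg 30 + j = 2 ^ h ∧ (∀ i < ν'.reg 30, ν'.mem 2 i = stretch e i) ∧ ν'.mem 2 0 = 0 ∧
        Frame 30 31 2 ν ν')
        ?_ (fun ν' h => h.1) (2 ^ h) ?_) le_rfl ?_)) ?_ (fun _ h => h)
  · rintro j ν' ⟨h₁, h₂, h₃, h₄, hF⟩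
    refine ⟨by omega, ?_⟩
    have hval : ν'.mem 2 (ν'.reg 30 / 2) = stretch e (ν'.reg 30 / 2) := by
      rcases Nat.eq_zero_or_pos (ν'.reg 30) with h0 | h0
      · simp [h0, h₄, stretch_zero]
      · exact h₃ _ (by omega)
    have hnew : ν'.mem 2 (ν'.reg 30 / 2) * 2 ^ e + ν'.reg 30 % 2 = stretch e (ν'.reg 30) := by
      rw [hval, stretch_eq e (ν'.reg 30)]; ring
    have hlt : stretch e (ν'.reg 30) < 2 ^ w :=
      (stretch_lt e (l := h) (by omega)).trans_le
        (Nat.pow_le_pow_right (by norm_num) (by nlinarith))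
    refine Runs.mono (Runs.block_write (by omega) (by simp [t30]) ?_ (by simp; omega) <|
      Runs.block_assign (by omega) ?_ <| Runs.block_assign (by omega) ?_ <|
      Runs.block_nil ?_) (by simp) (fun _ h => h)
    · simp only [Ex.valid_add, Ex.valid_mul, Ex.valid_load, Ex.valid_div, Ex.valid_reg, t30,
        Ex.valid_ofNat, Ex.valid_const, Ex.valid_mod, Ex.eval_mul, Ex.eval_load,
        Ex.eval_div, Ex.eval_reg, Ex.eval_ofNat, Ex.eval_const, Ex.eval_mod, hnew]
      refine ⟨⟨⟨⟨not_false, by omega⟩, by omega⟩, hew, by omega⟩, ⟨not_false, by omega⟩, hlt⟩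
    · simp [t30]; omega
    · simp [t31]; omega
    · simp only [Ex.eval_add, Ex.eval_mul, Ex.eval_load, Ex.eval_sub,
        Ex.eval_div, Ex.eval_reg, Ex.eval_ofNat, Ex.eval_const, Ex.eval_mod, hnew]
      refine ⟨by simp [h₁], by simp; omega, ?_, ?_, ?_⟩
      · intro i hi
        simp only [NState.setReg_reg, NState.setMem_reg, NState.setReg_mem] at hi ⊢
        rw [NState.setMem_mem]
        split_ifs with hc
        · rw [hc.2]
        · simp at hi; exact h₃ i (by simp at hc; omega)
      · simp only [NState.setReg_mem, NState.setMem_mem, h₄]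
        split_ifs with hc
        · rw [← hc.2, stretch_zero]
        · rfl
      · exact ((hF.setMem _ _).setReg (by omega) _).setReg (by omega) _
  · refine ⟨by simp [h₅], by simp, by simp, by simpa using h0, ?_⟩
    exact ((Frame.refl ..).setReg (by omega) _).setReg (by omega) _
  · rintro ν' ⟨-, h₂, h₃, -, hF⟩
    exact Runs.block_nil ⟨fun i hi => h₃ i (by omega), hF⟩
  · simp; omega

/-! ### The output stream -/

theorem packedWord_append {b i : ℕ} {x : List Bool} (y : List Bool) (h : (i + 1) * b ≤ x.length) :
    packedWord b (x ++ y) i = packedWord b x i := by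
  rw [packedWord_eq_val, packedWord_eq_val, List.drop_append_of_le_length (by nlinarith),
    List.take_append_of_le_length (by rw [List.length_drop, Nat.add_mul] at *; omega)]

theorem packedWord_of_length_le {b i : ℕ} {x : List Bool} (h : x.length ≤ i * b) :
    packedWord b x i = 0 := by
  rw [packedWord_eq_val, List.drop_of_length_le h]
  simp [val]

/-- The string `z` has been written to the output stream with `b` symbols per word: the array `o`
holds the first `reg 12` words of its packed representation, and register 10 holds the remaining
`reg 11` symbols. -/
structure Stream (o b : ℕ) (z : List Bool) (ν : NState) : Prop where
  acc : ν.reg 10 = val z / 2 ^ (ν.reg 12 * b)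
  cnt : ν.reg 12 * b + ν.reg 11 = z.length
  out : ∀ i < ν.reg 12, ν.mem o i = packedWord b z i
  rest : ∀ i, ν.reg 12 ≤ i → ν.mem o i = 0

/-- Appends the `reg 15` lowest bits, with value `reg 14`, to the output stream; register 6 holds
the number `b` of symbols per word and register 7 holds `2 ^ b`. -/
def emit (o : ℕ) : Program := block [
  assign 10 (.reg 10 + .bin .shl (.reg 14) (.reg 11)),
  assign 11 (.reg 11 + .reg 15),
  assign 13 (.reg 11 / .reg 6),
  .loop 13 (block [
    write o (.reg 12) (.reg 10 % .reg 7),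
    assign 10 (.reg 10 / .reg 7),
    assign 12 (.reg 12 + 1),
    assign 11 (.reg 11 - .reg 6),
    assign 13 (.reg 13 - 1)])]

theorem Stream.acc_lt {o b : ℕ} {z : List Bool} {ν : NState} (h : Stream o b z ν) :
    ν.reg 10 < 2 ^ ν.reg 11 := by
  rw [h.acc, Nat.div_lt_iff_lt_mul (by positivity), ← pow_add, add_comm, h.cnt]
  exact val_lt z

/-- One round of the loop in `emit`, which moves one word to the output array. -/
theorem runs_flush {w s o b j : ℕ} {z : List Bool} {ν : NState} (hw : 2 ≤ w) (hb : 0 < b)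
    (h₆ : ν.reg 6 = b) (h₇ : ν.reg 7 = 2 ^ b) (hz : Stream o b z ν) (hzw : z.length < 2 ^ w)
    (hs : z.length / b < s) (h₁₃ : ν.reg 13 = j + 1) (hj : ν.reg 11 / b = j + 1) :
    Runs w s (block [
      write o (.reg 12) (.reg 10 % .reg 7),
      assign 10 (.reg 10 / .reg 7),
      assign 12 (.reg 12 + 1),
      assign 11 (.reg 11 - .reg 6),
      assign 13 (.reg 13 - 1)]) 22 ν (fun ν' => Stream o b z ν' ∧ ν'.reg 13 = j ∧
        ν'.reg 11 / b = j ∧ Frame 10 15 o ν ν') := by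
  have h4 : 2 ^ 2 ≤ 2 ^ w := Nat.pow_le_pow_right (by norm_num) hw
  have hcb : b ≤ ν.reg 11 := by
    by_contra h
    rw [Nat.div_eq_of_lt (by omega)] at hj
    omega
  have hcnt := hz.cnt
  have hidx : (ν.reg 12 + 1) * b ≤ z.length := by rw [Nat.add_mul]; omega
  have hidx' : ν.reg 12 + 1 ≤ z.length := (Nat.le_mul_of_pos_right _ hb).trans hidx
  refine Runs.mono (Runs.block_write (by omega) (by simp [IsTemp]) (by simp [IsTemp]) ?_ <|
    Runs.block_assign (by omega) (by simp [IsTemp]) <|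
    Runs.block_assign (by omega) ?_ <|
    Runs.block_assign (by omega) ?_ <| Runs.block_assign (by omega) ?_ <|
    Runs.block_nil ?_) (by simp) (fun _ h => h)
  · refine lt_of_lt_of_le ?_ (Nat.succ_le_of_lt hs)
    rw [Nat.lt_succ_iff, Nat.le_div_iff_mul_le hb]
    simp only [Ex.eval_reg]
    omega
  · simp [IsTemp]; omega
  · simp [IsTemp]; omega
  · simp [IsTemp]; omega
  · have hpow : 2 ^ ((ν.reg 12 + 1) * b) = 2 ^ (ν.reg 12 * b) * 2 ^ b := by
      rw [Nat.add_mul, one_mul, pow_add]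
    have e₁ : ((ν.reg 11) - b) / b = j := by
      have := Nat.div_eq_sub_div hb hcb
      omega
    refine ⟨⟨?_, ?_, ?_, ?_⟩, by simp [h₁₃], by simpa [h₆] using e₁, ?_⟩
    · simp [h₇, hz.acc, hpow, Nat.div_div_eq_div_mul]
    · simp [h₆, Nat.add_mul]
      omega
    · intro i hi
      simp at hi ⊢
      rw [NState.setMem_mem]
      split_ifs with hc
      · rw [hc.2, packedWord_eq, hz.acc, h₇]
      · exact hz.out i (by omega)
    · intro i hi
      simp at hi ⊢
      rw [NState.setMem_mem, if_neg (by omega)]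
      exact hz.rest i (by omega)
    · simp only [Ex.eval_reg]
      exact (((((Frame.refl ..).setMem _ _).setReg (by omega) _).setReg (by omega) _).setReg
        (by omega) _).setReg (by omega) _

/-- The output of a string of at most `12 * b` symbols takes constant time, as at most `12` words are
completed. -/
theorem runs_emit {w s o b : ℕ} {z y : List Bool} {ν : NState} (hw : 2 ≤ w) (hb : 0 < b)
    (h₆ : ν.reg 6 = b) (h₇ : ν.reg 7 = 2 ^ b) (hz : Stream o b z ν) (hc : ν.reg 11 < b)
    (h₁₄ : ν.reg 14 = val y) (h₁₅ : ν.reg 15 = y.length) (hy : y.length ≤ 12 * b)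
    (hyw : b + y.length ≤ w) (hzw : (z ++ y).length < 2 ^ w) (hs : (z ++ y).length / b < s) :
    Runs w s (emit o) 310 ν (fun ν' => Stream o b (z ++ y) ν' ∧ ν'.reg 11 < b ∧
      Frame 10 15 o ν ν') := by
  have hcnt := hz.cnt
  have hlen : (z ++ y).length = z.length + y.length := List.length_append
  set ν₁ := ((ν.setReg 10 (ν.reg 10 + ν.reg 14 * 2 ^ ν.reg 11)).setReg 11
    (ν.reg 11 + ν.reg 15)).setReg 13 ((ν.reg 11 + ν.reg 15) / ν.reg 6) with hν₁
  have hF : Frame 10 15 o ν ν₁ :=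
    (((Frame.refl ..).setReg (by omega) _).setReg (by omega) _).setReg (by omega) _
  have hz₁ : Stream o b (z ++ y) ν₁ := by
    refine ⟨?_, ?_, ?_, ?_⟩
    · have hpow : 2 ^ z.length = 2 ^ (ν.reg 12 * b) * 2 ^ ν.reg 11 := by rw [← pow_add, hcnt]
      simp only [hν₁, NState.setReg_reg]
      norm_num
      rw [val_append, hpow, mul_assoc, Nat.add_mul_div_left _ _ (by positivity), ← hz.acc, h₁₄,
        mul_comm]
    · simp [hν₁]
      omega
    · intro i hi
      simp [hν₁] at hi ⊢
      rw [hz.out i hi, packedWord_append]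
      have := Nat.mul_le_mul_right b (show i + 1 ≤ ν.reg 12 by omega)
      omega
    · intro i hi
      simp [hν₁] at hi ⊢
      exact hz.rest i hi
  have hacc := hz₁.acc_lt
  have hj : (ν.reg 11 + ν.reg 15) / b ≤ 12 := by
    rw [← Nat.lt_succ_iff, Nat.div_lt_iff_lt_mul hb]
    omega
  have hpw : 2 ^ (ν.reg 11 + ν.reg 15) ≤ 2 ^ w := Nat.pow_le_pow_right (by norm_num) (by omega)
  have e10 : ν₁.reg 10 = ν.reg 10 + ν.reg 14 * 2 ^ ν.reg 11 := by simp [hν₁]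
  have e11 : ν₁.reg 11 = ν.reg 11 + ν.reg 15 := by simp [hν₁]
  have e13 : ν₁.reg 13 = (ν.reg 11 + ν.reg 15) / b := by simp [hν₁, h₆]
  rw [e11, e10] at hacc
  refine Runs.mono (Runs.block_assign (by omega) ?_ <|
    Runs.block_assign (by omega) ?_ <|
    Runs.block_assign (by omega) ?_ <|
    Runs.block_cons (t' := 1) (Runs.mono (Runs.loop (t := 22) (by decide) (fun j ν' =>
      Stream o b (z ++ y) ν' ∧ ν'.reg 13 = j ∧ ν'.reg 11 / b = j ∧ Frame 10 15 o ν ν')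
      ?_ (fun _ h => h.2.1) (ν₁.reg 13) ?_) le_rfl ?_)) ?_ (fun _ h => h)
  · simp [IsTemp, BinOp.natEval, BinOp.Fits]; omega
  · simp [IsTemp]; omega
  · simp [IsTemp]
  · rintro j ν' ⟨h₁, h₂, h₃, h₄⟩
    refine ⟨by omega, Runs.mono (runs_flush hw hb (by rw [h₄.reg 6 (by omega), h₆])
      (by rw [h₄.reg 7 (by omega), h₇]) h₁ hzw hs h₂ h₃) le_rfl ?_⟩
    rintro ν'' ⟨g₁, g₂, g₃, g₄⟩
    exact ⟨g₁, g₂, g₃, h₄.trans g₄⟩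
  · have e : ν₁.reg 11 / b = ν₁.reg 13 := by rw [e11, e13]
    exact ⟨hz₁, rfl, e, hF⟩
  · rintro ν' ⟨h₁, -, h₃, h₄⟩
    refine Runs.block_nil ⟨h₁, ?_, h₄⟩
    by_contra h
    exact (Nat.div_pos (by omega) hb).ne' h₃
  · rw [e13]
    simp
    omega

/-- Writes the incomplete last word of the output stream to the output array. -/
def finish (o : ℕ) : Program := block [write o (.reg 12) (.reg 10)]

theorem runs_finish {w s o b : ℕ} {z : List Bool} {ν : NState} (hw : 2 ≤ w) (hb : 0 < b)
    (hz : Stream o b z ν) (hc : ν.reg 11 < b) (hs : z.length / b < s) :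
    Runs w s (finish o) 10 ν (fun ν' => (∀ i, ν'.mem o i = packedWord b z i) ∧
      Frame 10 15 o ν ν') := by
  have hcnt := hz.cnt
  refine Runs.mono (Runs.block_write (by omega) (by simp [IsTemp]) (by simp [IsTemp]) ?_ <|
    Runs.block_nil ?_) (by simp) (fun _ h => h)
  · refine lt_of_le_of_lt ?_ hs
    rw [Nat.le_div_iff_mul_le hb]
    simp only [Ex.eval_reg]
    omega
  · refine ⟨fun i => ?_, (Frame.refl ..).setMem _ _⟩
    simp only [Ex.eval_reg, NState.setMem_mem, true_and]
    split_ifs with h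
    · rw [h, packedWord_eq, ← hz.acc, Nat.mod_eq_of_lt]
      exact hz.acc_lt.trans_le (Nat.pow_le_pow_right (by norm_num) hc.le)
    · rcases lt_or_gt_of_ne h with h | h
      · exact hz.out i h
      · rw [hz.rest i h.le, packedWord_of_length_le]
        have := Nat.mul_le_mul_right b (show ν.reg 12 + 1 ≤ i from h)
        rw [Nat.add_mul] at this
        omega

/-! ### Writing the strings of the reduction -/

/-- Numerical side conditions: words of `w` bits and arrays of `s` words suffice to write `N` symbols
with `b'` symbols per word, when the input has `b` symbols per word and the lookup table has `2 ^ h`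
entries. -/
structure Layout (w s b h b' N : ℕ) : Prop where
  pos : 0 < b
  le_two_mul : b ≤ 2 * h
  half_le : h ≤ b
  le : b ≤ b'
  word : 4 * b' + 20 ≤ w
  len : N < 2 ^ w
  space : N / b' < s
  table : 2 ^ h ≤ s

/-- The registers 3 to 7 and the array 2 hold the parameters and the lookup table. -/
structure Config (b h b' : ℕ) (ν : NState) : Prop where
  reg₃ : ν.reg 3 = b
  reg₄ : ν.reg 4 = h
  reg₅ : ν.reg 5 = 2 ^ h
  reg₆ : ν.reg 6 = b'
  reg₇ : ν.reg 7 = 2 ^ b'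
  table : ∀ i < 2 ^ h, ν.mem 2 i = stretch 3 i

theorem Config.of_frame {b h b' u o : ℕ} {ν ν' : NState} (hc : Config b h b' ν) (ho : o ≠ 2)
    (hF : Frame 10 u o ν ν') : Config b h b' ν' :=
  ⟨by rw [hF.reg 3 (by omega), hc.reg₃], by rw [hF.reg 4 (by omega), hc.reg₄],
    by rw [hF.reg 5 (by omega), hc.reg₅], by rw [hF.reg 6 (by omega), hc.reg₆],
    by rw [hF.reg 7 (by omega), hc.reg₇], by rw [hF.mem 2 ho.symm]; exact hc.table⟩

theorem Stream.congr {o b : ℕ} {z : List Bool} {ν ν' : NState} (h : Stream o b z ν)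
    (h₁₀ : ν'.reg 10 = ν.reg 10) (h₁₁ : ν'.reg 11 = ν.reg 11) (h₁₂ : ν'.reg 12 = ν.reg 12)
    (hm : ν'.mem o = ν.mem o) : Stream o b z ν' :=
  ⟨by rw [h₁₀, h₁₂, h.acc], by rw [h₁₁, h₁₂, h.cnt], by rw [h₁₂, hm]; exact h.out,
    by rw [h₁₂, hm]; exact h.rest⟩

/-- Appends the fixed string `y` to the output stream. -/
def emitConst (o : ℕ) (y : List Bool) : Program := block [
  assign 14 (.const (val y)),
  assign 15 (.const y.length),
  emit o]

theorem runs_emitConst {w s b h b' N o : ℕ} {z y : List Bool} {ν : NState}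
    (hL : Layout w s b h b' N) (hC : Config b h b' ν) (hz : Stream o b' z ν) (hc : ν.reg 11 < b')
    (hy : y.length ≤ 12) (hN : (z ++ y).length ≤ N) :
    Runs w s (emitConst o y) 320 ν (fun ν' => Stream o b' (z ++ y) ν' ∧ ν'.reg 11 < b' ∧
      Frame 10 15 o ν ν') := by
  have hb := hL.pos
  have hbb := hL.le
  have hw := hL.word
  have hpw : 2 ^ y.length < 2 ^ w := Nat.pow_lt_pow_right (by norm_num) (by omega)
  have hyl : y.length < 2 ^ y.length := Nat.lt_two_pow_self
  have hyv := val_lt y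
  refine Runs.mono (Runs.block_assign (by omega) (by simp; omega) <|
    Runs.block_assign (by omega) (by simp; omega) <|
    Runs.block_cons (t := 310) (t' := 1) ?_) (by simp) (fun _ h => h)
  refine Runs.mono (runs_emit (y := y) (z := z) (b := b') (by omega) (by omega) (by simp [hC.reg₆])
    (by simp [hC.reg₇]) (hz.congr (by simp) (by simp) (by simp) rfl) (by simpa using hc) (by simp)
    (by simp) (by omega) (by omega) (by have := hL.len; omega)
    ((Nat.div_le_div_right hN).trans_lt hL.space)) le_rfl ?_
  rintro ν' ⟨h₁, h₂, h₃⟩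
  exact Runs.block_nil ⟨h₁, h₂,
    (((Frame.refl ..).setReg (by omega) _).setReg (by omega) _).trans h₃⟩

/-- Appends the `spread` of the string of length `reg l` that is stored in `reg c` words of the
array `a` beginning at the word `reg 21`. In the loop, register 16 is the index of the current word,
register 17 the number of symbols that remain and register 20 the number of symbols of the current
word, which is the minimum of `reg 17` and the block size `reg 3`. -/
def emitSpread (o a l c : ℕ) : Program := block [
  assign 16 (.reg 21),
  assign 17 (.reg l),
  assign 18 (.reg c),
  .loop 18 (block [
    assign 19 (.load a (.reg 16)),
    assign 20 (.reg 17 * .bin .lt (.reg 17) (.reg 3) + .reg 3 * (1 - .bin .lt (.reg 17) (.reg 3))),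
    assign 14 (.load 2 (.reg 19 % .reg 5) + .bin .shl (.load 2 (.reg 19 / .reg 5)) (3 * .reg 4)
      + 2 * ((.bin .shl 1 (3 * .reg 20) - 1) / 7)),
    assign 15 (3 * .reg 20),
    emit o,
    assign 16 (.reg 16 + 1),
    assign 17 (.reg 17 - .reg 20),
    assign 18 (.reg 18 - 1)])]

/-- The value of the spread of a word, computed by two table lookups. -/
theorem val_spread_eq_lookup {b h b' : ℕ} {ν : NState} (hC : Config b h b' ν) {y : List Bool}
    (hy : y.length ≤ 2 * h) :
    ν.mem 2 (val y % 2 ^ h) + ν.mem 2 (val y / 2 ^ h) * 2 ^ (3 * h) +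
      2 * ((2 ^ (3 * y.length) - 1) / 7) = val (spread y) := by
  have hv : val y < 2 ^ h * 2 ^ h := by
    rw [← pow_add, ← two_mul]
    exact (val_lt y).trans_le (Nat.pow_le_pow_right (by norm_num) hy)
  rw [hC.table _ (Nat.mod_lt _ (by positivity)),
    hC.table _ ((Nat.div_lt_iff_lt_mul (by positivity)).2 hv), val_spread,
    ← stretch_mod_add_div 3 (val y) h, mul_comm (stretch 3 (val y / 2 ^ h))]

theorem runs_emitSpread {w s b h b' N o a l c p : ℕ} {z x : List Bool} {ν : NState}
    (hL : Layout w s b h b' N) (hC : Config b h b' ν) (hz : Stream o b' z ν) (hc : ν.reg 11 < b')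
    (ha : a ≠ o) (ho : o ≠ 2) (hl : l < 10) (hcr : c < 10)
    (h₂₁ : ν.reg 21 = p) (hlen : ν.reg l = x.length) (hcnt : ν.reg c = packedLength b x.length)
    (hmem : ∀ i < packedLength b x.length, ν.mem a (p + i) = packedWord b x i)
    (hps : p + packedLength b x.length ≤ s) (hpw : p + packedLength b x.length < 2 ^ w)
    (hN : (z ++ spread x).length ≤ N) :
    Runs w s (emitSpread o a l c) (400 * packedLength b x.length + 10) ν (fun ν' =>
      Stream o b' (z ++ spread x) ν' ∧ ν'.reg 11 < b' ∧ Frame 10 20 o ν ν') := by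
  have hb := hL.pos
  have hbb := hL.le
  have hw := hL.word
  have hh := hL.half_le
  have hbh := hL.le_two_mul
  have tl : ¬ IsTemp l := by simp only [IsTemp]; omega
  have tc : ¬ IsTemp c := by simp only [IsTemp]; omega
  have hw5 : 2 ^ 5 ≤ 2 ^ w := Nat.pow_le_pow_right (by norm_num) (by omega)
  have hbw : 4 * b < 2 ^ w := lt_of_le_of_lt (by omega) (Nat.lt_two_pow_self (n := w))
  set P := packedLength b x.length with hP
  have hlenN : 3 * x.length ≤ N := by
    rw [List.length_append, length_spread] at hN; omega
  have hNw := hL.len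
  refine Runs.mono (Runs.block_assign (by omega) (by simp [IsTemp]) <|
    Runs.block_assign (by omega) (by simp [tl]) <|
    Runs.block_assign (by omega) (by simp [tc]) <|
    Runs.block_cons (t' := 1) (Runs.mono (Runs.loop (t := 390) (by decide) (fun j ν' =>
      ν'.reg 18 = j ∧ j ≤ P ∧ ν'.reg 16 = p + (P - j) ∧ ν'.reg 17 = x.length - (P - j) * b ∧
      Stream o b' (z ++ spread (x.take ((P - j) * b))) ν' ∧ ν'.reg 11 < b' ∧ Frame 10 20 o ν ν')
      ?_ (fun _ h => h.1) P ?_) le_rfl ?_)) ?_ (fun _ h => h)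
  · rintro j ν' ⟨h₁₈, hj, h₁₆, h₁₇, hst, hlt, hF⟩
    refine ⟨by omega, ?_⟩
    -- the current word `i` holds the symbols `y`
    set i := P - (j + 1) with hi
    have hiP : i < P := by omega
    have hij : P - j = i + 1 := by omega
    have hix : i * b < x.length := (lt_packedLength_iff hb).1 hiP
    have hC' := hC.of_frame ho hF
    have hst' : Stream o b' (z ++ spread (x.take (i * b))) ν' := hst
    set y := (x.drop (i * b)).take b with hy
    have hyl : y.length = min b (x.length - i * b) := by simp [hy]
    have hy1 : y.length ≤ b := by omega
    have htake : x.take ((i + 1) * b) = x.take (i * b) ++ y := by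
      rw [Nat.add_mul, one_mul, List.take_add]
    have hlook := val_spread_eq_lookup hC' (y := y) (by omega)
    have hsl := length_spread y
    have hsv := val_lt (spread y)
    rw [hsl] at hsv
    have hpw3 : 2 ^ (3 * y.length) < 2 ^ w := Nat.pow_lt_pow_right (by norm_num) (by omega)
    have hv : val y < 2 ^ h * 2 ^ h := by
      rw [← pow_add, ← two_mul]
      exact (val_lt y).trans_le (Nat.pow_le_pow_right (by norm_num) (by omega))
    have hword : ν'.mem a (p + i) = val y := by
      rw [hF.mem a ha, hmem i hiP, packedWord_eq_val]
    have hNy : (z ++ spread (x.take (i * b)) ++ spread y).length ≤ N := by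
      refine le_trans ?_ hN
      simp only [List.length_append, length_spread, List.length_take]
      omega
    have hell : (x.length - i * b) * (if x.length - i * b < b then 1 else 0) +
        b * (1 - if x.length - i * b < b then 1 else 0) = y.length := by
      split_ifs <;> simp <;> omega
    have hd : val y % 2 ^ h < 2 ^ h := Nat.mod_lt _ (by positivity)
    have hq : val y / 2 ^ h < 2 ^ h := (Nat.div_lt_iff_lt_mul (by positivity)).2 hv
    have hsp := hL.table
    have h1 : 1 ≤ 2 ^ (3 * y.length) := Nat.one_le_two_pow
    have hbi : ∀ q : Prop, [Decidable q] → (if q then 1 else 0) ≤ 1 ∧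
        b * (1 - if q then 1 else 0) ≤ b ∧ (x.length - i * b) * (if q then 1 else 0) ≤ x.length := by
      intro q _
      split_ifs <;> simp
    refine Runs.mono (Runs.block_assign_of_eq (v := val y) (by omega) (by simp [IsTemp, h₁₆]; omega)
        (by simp [h₁₆, hword]) <|
      Runs.block_assign_of_eq (v := y.length) (by omega) ?_ (by
        simpa [BinOp.natEval, h₁₇, hC'.reg₃] using hell) <|
      Runs.block_assign_of_eq (v := val (spread y)) (by omega) ?_ (by
        simpa [BinOp.natEval, hC'.reg₄, hC'.reg₅] using hlook) <|
      Runs.block_assign_of_eq (v := 3 * y.length) (by omega) (by simp [IsTemp]; omega) (by simp) <|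
      Runs.block_cons (t := 310) (t' := 13) ?_) ?_ (fun _ h => h)
    · have := hbi (x.length - i * b < b)
      simp only [Ex.valid_add, Ex.valid_mul, Ex.valid_reg, Ex.valid_bin, Ex.valid_sub,
        Ex.valid_ofNat, BinOp.Fits, BinOp.natEval, Ex.eval_mul, Ex.eval_reg,
        Ex.eval_bin, Ex.eval_sub, Ex.eval_ofNat, NState.setReg_reg, h₁₇, hC'.reg₃]
      simp [IsTemp]
      simp at this hell
      omega
    · simp [hC'.reg₄, hC'.reg₅, IsTemp, BinOp.Fits, BinOp.natEval, hlook]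
      omega
    · refine Runs.mono (runs_emit (y := spread y) (z := z ++ spread (x.take (i * b))) (b := b')
        (by omega) (by omega) (by simp [hC'.reg₆])
        (by simp [hC'.reg₇]) (hst'.congr (by simp) (by simp) (by simp) rfl) (by simpa using hlt)
        (by simp) (by simp [hsl]) (by omega) (by omega) (by omega)
        ((Nat.div_le_div_right hNy).trans_lt hL.space)) le_rfl ?_
      rintro ν₂ ⟨g₁, g₂, g₃⟩
      have f₁₆ := g₃.reg 16 (by omega)
      have f₁₇ := g₃.reg 17 (by omega)
      have f₁₈ := g₃.reg 18 (by omega)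
      have f₂₀ := g₃.reg 20 (by omega)
      simp [h₁₆, h₁₇, h₁₈] at f₁₆ f₁₇ f₁₈ f₂₀
      refine Runs.mono (Runs.block_assign_of_eq (v := p + (i + 1)) (by omega)
          (by simp [IsTemp, f₁₆]; omega) (by simp [f₁₆]; omega) <|
        Runs.block_assign_of_eq (v := x.length - (i + 1) * b) (by omega)
          (by simp [IsTemp, f₁₇, f₂₀]; omega) (by simp [f₁₇, f₂₀, Nat.add_mul]; omega) <|
        Runs.block_assign_of_eq (v := j) (by omega)
          (by simp [IsTemp, f₁₈]; omega) (by simp [f₁₈]) <|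
        Runs.block_nil ?_) (by simp) (fun _ h => h)
      rw [hij]
      refine ⟨by simp, by omega, by simp, by simp, ?_, by simpa using g₂, ?_⟩
      · rw [htake, spread_append, ← List.append_assoc]
        exact g₁.congr (by simp) (by simp) (by simp) rfl
      · have e := ((((hF.setReg (d := 19) (by omega) (val y)).setReg (d := 20) (by omega)
          y.length).setReg (d := 14) (by omega) (val (spread y))).setReg (d := 15) (by omega)
          (3 * y.length)).trans (g₃.mono le_rfl (by omega))
        exact ((e.setReg (by omega) _).setReg (by omega) _).setReg (by omega) _
    · simp
  · have e₁ : ∀ r, r < 10 → r ≠ 16 ∧ r ≠ 17 := fun r hr => by omega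
    refine ⟨by simp [hcnt, (e₁ c hcr).1, (e₁ c hcr).2], le_rfl, by simp [h₂₁], ?_, ?_,
      by simpa using hc, ?_⟩
    · simp [hlen, (e₁ l hl).1]
    · simp [spread]
      exact hz.congr (by simp) (by simp) (by simp) rfl
    · exact (((Frame.refl ..).setReg (by omega) _).setReg (by omega) _).setReg (by omega) _
  · rintro ν' ⟨-, -, -, -, h₁, h₂, h₃⟩
    refine Runs.block_nil ⟨?_, h₂, h₃⟩
    rwa [Nat.sub_zero, List.take_of_length_le] at h₁
    by_contra h
    exact lt_irrefl P ((lt_packedLength_iff hb).2 (by omega))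
  · simp
    omega

/-- The blocks of a gadget: the spread pattern is preceded by one fixed string and followed by
another one. -/
def gadget (G : List (List Bool × List Bool)) (p : List Bool) : List Bool :=
  G.flatMap fun c => c.1 ++ spread p ++ c.2

/-- Appends the gadget with the blocks `G` of the pattern stored from word `reg 21` on. -/
def emitGadget (o : ℕ) : List (List Bool × List Bool) → Program
  | [] => .skip
  | c :: G => .seq (block [emitConst o c.1, emitSpread o 1 1 9, emitConst o c.2]) (emitGadget o G)

theorem runs_emitGadget {w s b h b' N o q : ℕ} {z p : List Bool} {ν : NState}
    (hL : Layout w s b h b' N) (hC : Config b h b' ν) (hz : Stream o b' z ν) (hc : ν.reg 11 < b')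
    (ho₁ : 1 ≠ o) (ho : o ≠ 2) (h₂₁ : ν.reg 21 = q) (hlen : ν.reg 1 = p.length)
    (hcnt : ν.reg 9 = packedLength b p.length)
    (hmem : ∀ i < packedLength b p.length, ν.mem 1 (q + i) = packedWord b p i)
    (hps : q + packedLength b p.length ≤ s) (hpw : q + packedLength b p.length < 2 ^ w)
    (G : List (List Bool × List Bool)) (hG : ∀ c ∈ G, c.1.length ≤ 12 ∧ c.2.length ≤ 12)
    (hN : (z ++ gadget G p).length ≤ N) :
    Runs w s (emitGadget o G) (G.length * (400 * packedLength b p.length + 660) + 1) ν (fun ν' =>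
      Stream o b' (z ++ gadget G p) ν' ∧ ν'.reg 11 < b' ∧ Frame 10 20 o ν ν') := by
  induction G generalizing z ν with
  | nil =>
    intro σ hσ
    exact ⟨1, by simp, σ, ν, .skip σ, hσ, by simpa [gadget] using hz, hc, Frame.refl ..⟩
  | cons c G ih =>
    have hNc : (z ++ c.1 ++ spread p ++ c.2 ++ gadget G p).length ≤ N := by
      simpa [gadget] using hN
    simp only [List.length_append] at hNc
    obtain ⟨hG₁, hG₂⟩ := List.forall_mem_cons.1 hG
    refine Runs.mono (Runs.seq (t := 400 * packedLength b p.length + 660)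
      (t' := G.length * (400 * packedLength b p.length + 660) + 1) ?_) ?_ (fun _ h => h)
    · refine Runs.mono (Runs.block_cons (t' := 400 * packedLength b p.length + 340)
        (Runs.mono (runs_emitConst hL hC hz hc hG₁.1
          (by simp only [List.length_append]; omega)) le_rfl ?_)) ?_ (fun _ h => h)
      · rintro ν₁ ⟨hz₁, hc₁, hF₁⟩
        refine Runs.mono (Runs.block_cons (t' := 321) (Runs.mono (runs_emitSpread (x := p) hL
          (hC.of_frame ho hF₁) hz₁ hc₁ ho₁ ho (by norm_num) (by norm_num)
          (by rw [hF₁.reg 21 (by omega), h₂₁]) (by rw [hF₁.reg 1 (by omega), hlen])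
          (by rw [hF₁.reg 9 (by omega), hcnt]) (by rw [hF₁.mem 1 ho₁]; exact hmem) hps hpw
          (by simp only [List.length_append]; omega)) le_rfl ?_)) (by omega) (fun _ h => h)
        rintro ν₂ ⟨hz₂, hc₂, hF₂⟩
        have hF₁₂ := (hF₁.mono le_rfl (by norm_num : 15 ≤ 20)).trans hF₂
        refine Runs.block_cons (t := 320) (t' := 1) (Runs.mono (runs_emitConst hL
          (hC.of_frame ho hF₁₂) hz₂ hc₂ hG₁.2
          (by simp only [List.length_append]; omega)) le_rfl ?_)
        rintro ν₃ ⟨hz₃, hc₃, hF₃⟩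
        have hF := hF₁₂.trans (hF₃.mono le_rfl (by norm_num : 15 ≤ 20))
        refine Runs.block_nil ?_
        refine Runs.mono (ih (hC.of_frame ho hF) hz₃ hc₃ (by rw [hF.reg 21 (by omega), h₂₁])
          (by rw [hF.reg 1 (by omega), hlen]) (by rw [hF.reg 9 (by omega), hcnt])
          (by rw [hF.mem 1 ho₁]; exact hmem) hG₂ (by simp only [List.length_append]; omega))
          le_rfl ?_
        rintro ν₄ ⟨hz₄, hc₄, hF₄⟩
        exact ⟨by simpa [gadget] using hz₄, hc₄, hF.trans hF₄⟩
      · omega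
    · simp only [List.length_cons, Nat.add_mul]
      omega

/-- Appends the gadgets of all patterns; register 21 is the first word of the current pattern. -/
def emitGadgets (o : ℕ) (G : List (List Bool × List Bool)) : Program := block [
  assign 21 0,
  assign 22 (.reg 2),
  .loop 22 (block [
    emitGadget o G,
    assign 21 (.reg 21 + .reg 9),
    assign 22 (.reg 22 - 1)])]

theorem runs_emitGadgets {w s b h b' N o m : ℕ} {z : List Bool} {D : List (List Bool)} {ν : NState}
    (hL : Layout w s b h b' N) (hC : Config b h b' ν) (hz : Stream o b' z ν) (hc : ν.reg 11 < b')
    (ho₁ : 1 ≠ o) (ho : o ≠ 2) (hD : ∀ p ∈ D, p.length = m) (h₁ : ν.reg 1 = m)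
    (h₂ : ν.reg 2 = D.length) (h₉ : ν.reg 9 = packedLength b m)
    (hmem : ∀ i < D.length * packedLength b m, ν.mem 1 i =
      packedWord b (D.getD (i / packedLength b m) []) (i % packedLength b m))
    (hps : D.length * packedLength b m ≤ s) (hpw : D.length * packedLength b m < 2 ^ w)
    (G : List (List Bool × List Bool)) (hG : ∀ c ∈ G, c.1.length ≤ 12 ∧ c.2.length ≤ 12)
    (hN : (z ++ D.flatMap (gadget G)).length ≤ N) :
    Runs w s (emitGadgets o G)
      (D.length * (G.length * (400 * packedLength b m + 660) + 11) + 6) ν (fun ν' =>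
        Stream o b' (z ++ D.flatMap (gadget G)) ν' ∧ ν'.reg 11 < b' ∧ Frame 10 22 o ν ν') := by
  have hw := hL.word
  have hw5 : 2 ^ 5 ≤ 2 ^ w := Nat.pow_le_pow_right (by norm_num) (by omega)
  set P := packedLength b m with hP
  set k := D.length with hk
  refine Runs.mono (Runs.block_assign_of_eq (v := 0) (by omega) (by simp) (by simp) <|
    Runs.block_assign_of_eq (v := k) (by omega) (by simp [IsTemp]) (by simp [h₂]) <|
    Runs.block_cons (t' := 1) (Runs.mono (Runs.loop (t := G.length * (400 * P + 660) + 10) (by decide)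
      (fun j ν' => ν'.reg 22 = j ∧ j ≤ k ∧ ν'.reg 21 = (k - j) * P ∧
        Stream o b' (z ++ (D.take (k - j)).flatMap (gadget G)) ν' ∧ ν'.reg 11 < b' ∧
        Frame 10 22 o ν ν')
      ?_ (fun _ h => h.1) k ?_) le_rfl ?_)) ?_ (fun _ h => h)
  · rintro j ν' ⟨h₂₂, hj, h₂₁, hst, hlt, hF⟩
    refine ⟨by omega, ?_⟩
    set i := k - (j + 1) with hi
    have hik : i < k := by omega
    have hij : k - j = i + 1 := by omega
    obtain ⟨p, hp⟩ : ∃ p, D[i] = p := ⟨_, rfl⟩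
    have hpm : p.length = m := hD p (hp ▸ List.getElem_mem _)
    have htake : D.take (i + 1) = D.take i ++ [p] := by rw [List.take_succ_eq_append_getElem hik, hp]
    have hiP : (i + 1) * P ≤ k * P := Nat.mul_le_mul_right P hik
    rw [Nat.add_mul, one_mul] at hiP
    have hNp : (z ++ (D.take i).flatMap (gadget G) ++ gadget G p).length ≤ N := by
      refine le_trans ?_ hN
      conv_rhs => rw [← List.take_append_drop (i + 1) D, htake]
      simp
    refine Runs.mono (Runs.block_cons (t' := 9) (Runs.mono (runs_emitGadget (p := p) (q := i * P) hL
      (hC.of_frame ho hF) hst hlt ho₁ ho h₂₁ (by rw [hF.reg 1 (by omega), h₁, hpm])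
      (by rw [hF.reg 9 (by omega), h₉, hpm]) ?_ (by rw [hpm]; omega) (by rw [hpm]; omega) G hG hNp)
      le_rfl ?_)) (by rw [hpm, ← hP]) (fun _ h => h)
    · intro t ht
      rw [hpm, ← hP] at ht
      rw [hF.mem 1 ho₁, hmem _ (by omega)]
      have e₁ : (i * P + t) / P = i := by
        rw [mul_comm, Nat.mul_add_div (by omega), Nat.div_eq_of_lt ht, add_zero]
      have e₂ : (i * P + t) % P = t := by
        rw [mul_comm, Nat.mul_add_mod, Nat.mod_eq_of_lt ht]
      rw [e₁, e₂, List.getD_eq_getElem _ _ hik, hp]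
    · rintro ν₂ ⟨g₁, g₂, g₃⟩
      have f₂₁ := (g₃.reg 21 (by omega)).trans h₂₁
      have f₂₂ := (g₃.reg 22 (by omega)).trans h₂₂
      have f₉ := (g₃.reg 9 (by omega)).trans ((hF.reg 9 (by omega)).trans h₉)
      refine Runs.mono (Runs.block_assign_of_eq (v := (i + 1) * P) (by omega)
          (by simp [IsTemp, f₂₁, f₉]; omega) (by simp [f₂₁, f₉, Nat.add_mul]) <|
        Runs.block_assign_of_eq (v := j) (by omega)
          (by simp [IsTemp, f₂₂]; omega) (by simp [f₂₂]) <|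
        Runs.block_nil ?_) (by simp) (fun _ h => h)
      rw [hij]
      refine ⟨by simp, by omega, by simp, ?_, by simpa using g₂, ?_⟩
      · rw [htake, List.flatMap_append, ← List.append_assoc]
        simp only [List.flatMap_singleton]
        exact g₁.congr (by simp) (by simp) (by simp) rfl
      · exact ((hF.trans (g₃.mono le_rfl (by omega))).setReg (by omega) _).setReg (by omega) _
  · refine ⟨by simp, le_rfl, by simp, ?_, by simpa using hc, ?_⟩
    · simp
      exact hz.congr (by simp) (by simp) (by simp) rfl
    · exact ((Frame.refl ..).setReg (by omega) _).setReg (by omega) _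
  · rintro ν' ⟨-, -, -, hst, hlt, hF⟩
    exact Runs.block_nil ⟨by simpa [hk] using hst, hlt, hF⟩
  · simp only [Ex.cost_ofNat, Ex.cost_reg]
    generalize G.length * (400 * P + 660) = A
    rw [show A + 10 + 1 = A + 11 from rfl]
    omega

/-- Writes the spread text between the fixed prefix `10` and the gadgets of all patterns. -/
def buildString (o : ℕ) (G : List (List Bool × List Bool)) : Program := block [
  assign 10 0,
  assign 11 0,
  assign 12 0,
  assign 21 0,
  emitConst o [true, false],
  emitSpread o 0 0 8,
  emitGadgets o G,
  finish o]

theorem runs_buildString {w s b h b' N o m : ℕ} {x : List Bool} {D : List (List Bool)} {ν : NState}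
    (hL : Layout w s b h b' N) (hC : Config b h b' ν) (ho : 3 ≤ o) (hout : ∀ i, ν.mem o i = 0)
    (hD : ∀ p ∈ D, p.length = m) (h₀ : ν.reg 0 = x.length) (h₁ : ν.reg 1 = m)
    (h₂ : ν.reg 2 = D.length) (h₈ : ν.reg 8 = packedLength b x.length)
    (h₉ : ν.reg 9 = packedLength b m)
    (hmem₀ : ∀ i < packedLength b x.length, ν.mem 0 i = packedWord b x i)
    (hmem₁ : ∀ i < D.length * packedLength b m, ν.mem 1 i =
      packedWord b (D.getD (i / packedLength b m) []) (i % packedLength b m))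
    (hps₀ : packedLength b x.length ≤ s) (hpw₀ : packedLength b x.length < 2 ^ w)
    (hps : D.length * packedLength b m ≤ s) (hpw : D.length * packedLength b m < 2 ^ w)
    (G : List (List Bool × List Bool)) (hG : ∀ c ∈ G, c.1.length ≤ 12 ∧ c.2.length ≤ 12)
    (hN : ([true, false] ++ spread x ++ D.flatMap (gadget G)).length ≤ N) :
    Runs w s (buildString o G) (400 * packedLength b x.length +
      D.length * (G.length * (400 * packedLength b m + 660) + 11) + 360) ν (fun ν' =>
        (∀ i, ν'.mem o i = packedWord b' ([true, false] ++ spread x ++ D.flatMap (gadget G)) i) ∧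
        Frame 10 22 o ν ν') := by
  have hw := hL.word
  have hb := hL.pos
  have hbb := hL.le
  have hw5 : 2 ^ 5 ≤ 2 ^ w := Nat.pow_le_pow_right (by norm_num) (by omega)
  have hN' := hN
  simp only [List.length_append] at hN'
  set A := D.length * (G.length * (400 * packedLength b m + 660) + 11) with hA
  refine Runs.mono (Runs.block_assign_of_eq (v := 0) (by omega) (by simp) (by simp) <|
    Runs.block_assign_of_eq (v := 0) (by omega) (by simp) (by simp) <|
    Runs.block_assign_of_eq (v := 0) (by omega) (by simp) (by simp) <|
    Runs.block_assign_of_eq (v := 0) (by omega) (by simp) (by simp) <|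
    Runs.block_cons (t' := 400 * packedLength b x.length + 10 + (A + 6 + (10 + 1)))
      (Runs.mono (runs_emitConst (z := []) (y := [true, false]) (o := o) hL
      ⟨by simp [hC.reg₃], by simp [hC.reg₄], by simp [hC.reg₅], by simp [hC.reg₆],
        by simp [hC.reg₇], hC.table⟩ ⟨by simp [val], by simp, by simp, by simp [hout]⟩
      (by simp; omega) (by simp) (by simp only [List.length_append, List.length_nil]; omega))
      le_rfl ?_)) ?_ (fun _ h => h)
  · rintro ν₁ ⟨hz₁, hc₁, hF₁'⟩
    have hF₁ : Frame 10 22 o ν ν₁ := (((((Frame.refl 10 22 o ν).setReg (by omega) _).setReg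
      (by omega) _).setReg (by omega) _).setReg (d := 21) (by omega) _).trans
      (hF₁'.mono le_rfl (by omega))
    refine Runs.block_cons (Runs.mono (runs_emitSpread (x := x) (p := 0) hL
      (hC.of_frame (by omega) hF₁) hz₁ hc₁ (by omega) (by omega) (by norm_num) (by norm_num)
      (by rw [hF₁'.reg 21 (by omega)]; simp) (by rw [hF₁.reg 0 (by omega), h₀])
      (by rw [hF₁.reg 8 (by omega), h₈])
      (by rw [hF₁.mem 0 (by omega)]; simpa using hmem₀) (by simpa using hps₀) (by simpa using hpw₀)
      (by simp only [List.length_append, List.length_nil]; omega)) le_rfl ?_)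
    rintro ν₂ ⟨hz₂, hc₂, hF₂'⟩
    have hF₂ := hF₁.trans (hF₂'.mono le_rfl (by norm_num : 20 ≤ 22))
    refine Runs.block_cons (Runs.mono (runs_emitGadgets (D := D) (m := m) hL
      (hC.of_frame (by omega) hF₂) hz₂ hc₂ (by omega) (by omega) hD
      (by rw [hF₂.reg 1 (by omega), h₁]) (by rw [hF₂.reg 2 (by omega), h₂])
      (by rw [hF₂.reg 9 (by omega), h₉]) (by rw [hF₂.mem 1 (by omega)]; exact hmem₁) hps hpw G hG
      (by simpa using hN)) le_rfl ?_)
    rintro ν₃ ⟨hz₃, hc₃, hF₃'⟩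
    have hF₃ := hF₂.trans hF₃'
    refine Runs.block_cons (Runs.mono (runs_finish (by omega) (by omega) hz₃ hc₃
      ((Nat.div_le_div_right (by simpa using hN)).trans_lt hL.space)) le_rfl ?_)
    rintro ν₄ ⟨h₄, hF₄⟩
    exact Runs.block_nil ⟨by simpa using h₄, hF₃.trans (hF₄.mono le_rfl (by norm_num))⟩
  · simp
    omega

/-- Computes the parameters and the lookup table: registers 3 and 6 receive the block sizes of the
input and of the output, register 23 the length of the output, registers 8 and 9 the number of words
of the text and of a pattern. The lookup table is for half a block of symbols, which makes it small
enough to be computed in the time it takes to read the text. -/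
def prepare : Program := block [
  bitLength 3 0,
  assign 23 (2 + 3 * .reg 0 + .reg 2 * (15 * .reg 1 + 65)),
  bitLength 6 23,
  assign 4 ((.reg 3 + 1) / 2),
  assign 5 (.bin .shl 1 (.reg 4)),
  assign 7 (.bin .shl 1 (.reg 6)),
  assign 8 ((.reg 0 + (.reg 3 - 1)) / .reg 3),
  assign 9 ((.reg 1 + (.reg 3 - 1)) / .reg 3),
  fillTable 3]

theorem runs_prepare {w s n m k : ℕ} {ν : NState} (h₀ : ν.reg 0 = n) (h₁ : ν.reg 1 = m)
    (h₂ : ν.reg 2 = k) (hn : 0 < n)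
    (hmem : ν.mem 2 0 = 0)
    (hL : Layout w s (blockSize n) ((blockSize n + 1) / 2)
      (blockSize (2 + 3 * n + k * (15 * m + 65))) (2 + 3 * n + k * (15 * m + 65)))
    (hmw : 15 * m + 65 + blockSize n < 2 ^ w) :
    Runs w s prepare (20 * blockSize (2 + 3 * n + k * (15 * m + 65)) +
      24 * 2 ^ ((blockSize n + 1) / 2) + 100) ν (fun ν' =>
        Config (blockSize n) ((blockSize n + 1) / 2)
          (blockSize (2 + 3 * n + k * (15 * m + 65))) ν' ∧
        ν'.reg 23 = 2 + 3 * n + k * (15 * m + 65) ∧ ν'.reg 8 = packedLength (blockSize n) n ∧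
        ν'.reg 9 = packedLength (blockSize n) m ∧
        (∀ r, r < 3 ∨ 31 < r → ν'.reg r = ν.reg r) ∧ ∀ a, a ≠ 2 → ν'.mem a = ν.mem a) := by
  have hb := hL.pos
  have hbb := hL.le
  have hhb := hL.half_le
  have hw := hL.word
  have hNw := hL.len
  have hsp := hL.table
  set b := blockSize n with hbd
  set N := 2 + 3 * n + k * (15 * m + 65) with hNd
  set b' := blockSize N with hbd'
  set h := (b + 1) / 2 with hhd
  have hw5 : 2 ^ 5 ≤ 2 ^ w := Nat.pow_le_pow_right (by norm_num) (by omega)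
  have hww : w < 2 ^ w := Nat.lt_two_pow_self
  have hhw : 2 ^ h < 2 ^ w := Nat.pow_lt_pow_right (by norm_num) (by omega)
  have hbw : 2 ^ b' < 2 ^ w := Nat.pow_lt_pow_right (by norm_num) (by omega)
  refine Runs.mono (Runs.block_cons (t := 10 * b + 6) (t' := 10 * b' + 24 * 2 ^ h + 90)
    (Runs.mono (runs_bitLength (by omega) (by omega) (by omega) (by omega) (by omega)
      (by rw [h₀, ← hbd]; omega)) (by rw [h₀]) ?_)) (by omega) (fun _ h => h)
  rintro ν₁ ⟨e₃, er, em⟩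
  rw [h₀, ← hbd] at e₃
  have e₀ : ν₁.reg 0 = n := by rw [er 0 (by omega) (by omega), h₀]
  have e₁ : ν₁.reg 1 = m := by rw [er 1 (by omega) (by omega), h₁]
  have e₂ : ν₁.reg 2 = k := by rw [er 2 (by omega) (by omega), h₂]
  refine Runs.mono (Runs.block_assign_of_eq (v := N) (by omega)
    (by simp [IsTemp, e₀, e₁, e₂]; omega) (by simp [e₀, e₁, e₂, hNd]) <|
    Runs.block_cons (t := 10 * b' + 6) (t' := 24 * 2 ^ h + 60)
    (Runs.mono (runs_bitLength (by omega) (by omega) (by omega) (by omega)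
      (by simp [hNd]) (by simp [← hbd']; omega)) (by simp [← hbd']) ?_))
    (by simp; omega) (fun _ h => h)
  rintro ν₂ ⟨f₆, fr, fm⟩
  have hN₆ : (ν₁.setReg 23 N).reg 23 = N := by simp
  rw [hN₆, ← hbd'] at f₆
  have f₀ := fr 0 (by omega) (by omega)
  have f₁ := fr 1 (by omega) (by omega)
  have f₃ := fr 3 (by omega) (by omega)
  have f₂₃ := fr 23 (by omega) (by omega)
  simp [e₀, e₁, e₃] at f₀ f₁ f₃ f₂₃
  set ν₃ := ((((ν₂.setReg 4 h).setReg 5 (2 ^ h)).setReg 7 (2 ^ b')).setReg 8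
    (packedLength b n)).setReg 9 (packedLength b m) with hν₃
  have hfin := runs_fillTable (w := w) (s := s) (e := 3) (h := h) (ν := ν₃) (by omega) (by omega)
    (by simp [hν₃]) hsp (by simp [hν₃, fm, em, hmem])
  refine Runs.mono (Runs.block_assign_of_eq (v := h) (by omega)
      (by simp [IsTemp, f₃]; omega) (by simp [f₃, hhd]) <|
    Runs.block_assign_of_eq (v := 2 ^ h) (by omega)
      (by simp [IsTemp, BinOp.Fits]; omega) (by simp [BinOp.natEval]) <|
    Runs.block_assign_of_eq (v := 2 ^ b') (by omega)
      (by simp [IsTemp, BinOp.Fits, f₆]; omega) (by simp [BinOp.natEval, f₆]) <|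
    Runs.block_assign_of_eq (v := packedLength b n) (by omega)
      (by simp [IsTemp, f₀, f₃]; omega) (by simp [f₀, f₃, packedLength]) <|
    Runs.block_assign_of_eq (v := packedLength b m) (by omega)
      (by simp [IsTemp, f₁, f₃]; omega) (by simp [f₁, f₃, packedLength]) <|
    Runs.block_cons (t' := 1) (Runs.mono hfin le_rfl ?_))
    (by simp; omega) (fun _ h => h)
  rintro ν₄ ⟨gt, gF⟩
  have gr := gF.reg
  refine Runs.block_nil ⟨⟨?_, ?_, ?_, ?_, ?_, gt⟩, ?_, ?_, ?_, fun r hr => ?_, fun a ha => ?_⟩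
  · rw [gr 3 (by omega)]; simp [hν₃, f₃]
  · rw [gr 4 (by omega)]; simp [hν₃]
  · rw [gr 5 (by omega)]; simp [hν₃]
  · rw [gr 6 (by omega)]; simp [hν₃, f₆]
  · rw [gr 7 (by omega)]; simp [hν₃]
  · rw [gr 23 (by omega)]; simp [hν₃, f₂₃]
  · rw [gr 8 (by omega)]; simp [hν₃]
  · rw [gr 9 (by omega)]; simp [hν₃]
  · rw [gr r (by omega), ← er r (by omega) (by omega)]
    simp only [hν₃, NState.setReg_reg]
    rw [if_neg (by omega), if_neg (by omega), if_neg (by omega), if_neg (by omega),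
      if_neg (by omega), fr r (by omega) (by omega), NState.setReg_reg, if_neg (by omega)]
  · rw [gF.mem a ha]
    simp [hν₃, fm, em]

theorem gadget₁_eq : gadget₁ = gadget [([true, false], zeros 7 ++ ones 4),
    ([false, false], zeros 6 ++ ones 5), ([false, false], ones 3 ++ zeros 3 ++ ones 5),
    ([false, false], ones 4 ++ zeros 3 ++ ones 4), ([false, false], zeros 8 ++ ones 3)] := by
  funext p
  simp [gadget₁, gadget]

theorem gadget₂_eq : gadget₂ = gadget [([true, false], zeros 6 ++ ones 5),
    ([false, false], zeros 7 ++ ones 4), ([false, false], ones 3 ++ zeros 3 ++ ones 5),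
    ([false, false], ones 4 ++ zeros 3 ++ ones 4), ([false, false], zeros 8 ++ ones 3)] := by
  funext p
  simp [gadget₂, gadget]

/-- The common length of the two strings of the reduction, for a text of length `n` and `k`
patterns of length `m`. -/
def outLength (n m k : ℕ) : ℕ := 2 + 3 * n + k * (15 * m + 65)

theorem length_flatMap_of_forall {D : List (List Bool)} {m c : ℕ} {g : List Bool → List Bool}
    (hD : ∀ p ∈ D, p.length = m) (hg : ∀ p, p.length = m → (g p).length = c) :
    (D.flatMap g).length = D.length * c := by
  induction D with
  | nil => simp
  | cons p D ih =>
    obtain ⟨h₁, h₂⟩ := List.forall_mem_cons.1 hD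
    rw [List.flatMap_cons, List.length_append, ih h₂, hg p h₁, List.length_cons]
    ring

theorem length_string₁ {x : List Bool} {D : List (List Bool)} {m : ℕ}
    (hD : ∀ p ∈ D, p.length = m) : (string₁ x D).length = outLength x.length m D.length := by
  have hg : ∀ p : List Bool, p.length = m → (gadget₁ p).length = 15 * m + 65 := by
    intro p hp
    simp [gadget₁, zeros, ones, length_spread, hp]
    omega
  simp [string₁, length_spread, length_flatMap_of_forall hD hg, outLength]
  omega

theorem length_string₂ {x : List Bool} {D : List (List Bool)} {m : ℕ}
    (hD : ∀ p ∈ D, p.length = m) : (string₂ x D).length = outLength x.length m D.length := by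
  have hg : ∀ p : List Bool, p.length = m → (gadget₂ p).length = 15 * m + 65 := by
    intro p hp
    simp [gadget₂, zeros, ones, length_spread, hp]
    omega
  simp [string₂, length_spread, length_flatMap_of_forall hD hg, outLength]
  omega

/-- The values of the words of a machine state. -/
def State.toNState {w : ℕ} (σ : State w) : NState :=
  ⟨fun r => (σ.reg r).toNat, fun a i => (σ.mem a (BitVec.ofNat w i)).toNat⟩

theorem represents_toNState {w : ℕ} (σ : State w) : Represents σ σ.toNState :=
  ⟨fun _ _ => rfl, fun a i => by simp [State.toNState]⟩

/-- Writes both strings of the reduction, as inputs for two copies of a program: one that uses the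
registers `41, 44, …` and the arrays `10, 12, …`, and one that uses the registers `42, 45, …` and
the arrays `11, 13, …`. -/
def buildInputs : Program := block [
  prepare,
  buildString 10 [([true, false], zeros 7 ++ ones 4),
    ([false, false], zeros 6 ++ ones 5), ([false, false], ones 3 ++ zeros 3 ++ ones 5),
    ([false, false], ones 4 ++ zeros 3 ++ ones 4), ([false, false], zeros 8 ++ ones 3)],
  buildString 11 [([true, false], zeros 6 ++ ones 5),
    ([false, false], zeros 7 ++ ones 4), ([false, false], ones 3 ++ zeros 3 ++ ones 5),
    ([false, false], ones 4 ++ zeros 3 ++ ones 4), ([false, false], zeros 8 ++ ones 3)],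
  assign 41 (.reg 23),
  assign 42 (.reg 23)]

theorem runs_buildInputs {w s m : ℕ} {x : List Bool} {D : List (List Bool)}
    (hx : x ≠ []) (hD : ∀ p ∈ D, p.length = m)
    (hL : Layout w s (blockSize x.length) ((blockSize x.length + 1) / 2)
      (blockSize (outLength x.length m D.length)) (outLength x.length m D.length))
    (hm : 15 * m + 65 + blockSize x.length < 2 ^ w)
    (hps₀ : packedLength (blockSize x.length) x.length ≤ s)
    (hps : D.length * packedLength (blockSize x.length) m ≤ s)
    (hpw : D.length * packedLength (blockSize x.length) m < 2 ^ w) :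
    Runs w s buildInputs (20 * blockSize (outLength x.length m D.length) +
      24 * 2 ^ ((blockSize x.length + 1) / 2) + 800 * packedLength (blockSize x.length) x.length +
      D.length * (4000 * packedLength (blockSize x.length) m + 6622) + 900)
      (dictInput w x D m).toNState (fun ν' =>
        ν'.reg 2 = D.length ∧ ν'.reg 41 = outLength x.length m D.length ∧
        ν'.reg 42 = outLength x.length m D.length ∧ (∀ r, 42 < r → ν'.reg r = 0) ∧
        (∀ i, ν'.mem 10 i = packedWord (blockSize (outLength x.length m D.length))
          (string₁ x D) i) ∧
        (∀ i, ν'.mem 11 i = packedWord (blockSize (outLength x.length m D.length))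
          (string₂ x D) i) ∧
        ∀ a, 11 < a → ∀ i, ν'.mem a i = 0) := by
  have hn : 0 < x.length := List.length_pos_iff.2 hx
  have hNdef : outLength x.length m D.length =
    2 + 3 * x.length + D.length * (15 * m + 65) := rfl
  have hl₁ := length_string₁ (x := x) hD
  have hl₂ := length_string₂ (x := x) hD
  set n := x.length with hnd
  set k := D.length with hkd
  set N := outLength n m k with hN
  set b := blockSize n with hb
  have hNw := hL.len
  have hww := hL.word
  have hbb := hL.le
  have hb0 := hL.pos
  have hkN : k ≤ N := by
    rw [hNdef]; nlinarith [Nat.zero_le (k * m)]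
  have hmw : m < 2 ^ w := by omega
  have hbw : 2 ^ b ≤ 2 ^ w := Nat.pow_le_pow_right (by norm_num) (by omega)
  have hpx : packedLength b n ≤ n := packedLength_le_self hb0
  set ν := (dictInput w x D m).toNState with hν
  have e₀ : ν.reg 0 = n := by
    simp [hν, State.toNState, dictInput, Nat.mod_eq_of_lt (show x.length < 2 ^ w by omega), hnd]
  have e₁ : ν.reg 1 = m := by
    simp [hν, State.toNState, dictInput, Nat.mod_eq_of_lt hmw]
  have e₂ : ν.reg 2 = k := by
    simp [hν, State.toNState, dictInput, Nat.mod_eq_of_lt (show D.length < 2 ^ w by omega), hkd]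
  have er : ∀ r, 2 < r → ν.reg r = 0 := by
    intro r hr
    simp [hν, State.toNState, dictInput, show r ≠ 0 by omega, show r ≠ 1 by omega,
      show r ≠ 2 by omega]
  have em₀ : ∀ i < packedLength b n, ν.mem 0 i = packedWord b x i := by
    intro i hi
    have := packedWord_lt b x i
    simp [hν, State.toNState, dictInput, Nat.mod_eq_of_lt (show i < 2 ^ w by omega), ← hnd, ← hb]
    exact Nat.mod_eq_of_lt (by omega)
  have em₁ : ∀ i < k * packedLength b m, ν.mem 1 i =
      packedWord b (D.getD (i / packedLength b m) []) (i % packedLength b m) := by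
    intro i hi
    have := packedWord_lt b (D.getD (i / packedLength b m) []) (i % packedLength b m)
    simp only [hν, State.toNState, dictInput, BitVec.toNat_ofNat,
      Nat.mod_eq_of_lt (show i < 2 ^ w by omega), ← hnd, ← hb]
    norm_num
    norm_num at this
    exact Nat.mod_eq_of_lt (by omega)
  have em : ∀ a, 1 < a → ∀ i, ν.mem a i = 0 := by
    intro a ha i
    simp [hν, State.toNState, dictInput, show a ≠ 0 by omega, show a ≠ 1 by omega]
  have hpxw : packedLength b n < 2 ^ w := by omega
  set Px := packedLength b n
  set Pm := packedLength b m
  set B := 400 * Px + (k * (5 * (400 * Pm + 660) + 11) + 360) with hB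
  refine Runs.mono (Runs.block_cons (t' := B + (B + 10)) (Runs.mono (runs_prepare e₀ e₁ e₂ hn
    (em 2 (by omega) 0) hL hm) le_rfl ?_)) ?_ (fun _ h => h)
  · rintro ν₁ ⟨hC, f₂₃, f₈, f₉, fr, fm⟩
    refine Runs.block_cons (t := B) (t' := B + 10) (Runs.mono (runs_buildString (x := x) (D := D)
      (m := m) hL hC (by norm_num) (by rw [fm _ (by omega)]; exact em _ (by omega)) hD
      (by rw [fr _ (by omega), e₀]) (by rw [fr _ (by omega), e₁]) (by rw [fr _ (by omega), e₂])
      f₈ f₉ (by rw [fm _ (by omega)]; exact em₀) (by rw [fm _ (by omega)]; exact em₁)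
      hps₀ hpxw hps hpw _ (by simp [zeros, ones]) ?_) (Nat.add_assoc _ _ _).le ?_)
    · rw [← gadget₁_eq]
      exact hl₁.le
    rw [← gadget₁_eq]
    rintro ν₂ ⟨g₁, gF⟩
    refine Runs.block_cons (t := B) (t' := 10) (Runs.mono (runs_buildString (x := x) (D := D)
      (m := m) hL (hC.of_frame (by omega) gF) (by norm_num)
      (by rw [gF.mem _ (by omega), fm _ (by omega)]; exact em _ (by omega)) hD
      (by rw [gF.reg _ (by omega), fr _ (by omega), e₀])
      (by rw [gF.reg _ (by omega), fr _ (by omega), e₁])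
      (by rw [gF.reg _ (by omega), fr _ (by omega), e₂])
      (by rw [gF.reg _ (by omega), f₈]) (by rw [gF.reg _ (by omega), f₉])
      (by rw [gF.mem _ (by omega), fm _ (by omega)]; exact em₀)
      (by rw [gF.mem _ (by omega), fm _ (by omega)]; exact em₁)
      hps₀ hpxw hps hpw _ (by simp [zeros, ones]) ?_) (Nat.add_assoc _ _ _).le ?_)
    · rw [← gadget₂_eq]
      exact hl₂.le
    rw [← gadget₂_eq]
    rintro ν₃ ⟨g₂, gF₃⟩
    have i₂₃ : ν₃.reg 23 = N := by rw [gF₃.reg _ (by omega), gF.reg _ (by omega), f₂₃, hNdef]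
    refine Runs.mono (Runs.block_assign_of_eq (v := N) (by omega) (by simp [IsTemp])
      (by simp [i₂₃]) <| Runs.block_assign_of_eq (v := N) (by omega) (by simp [IsTemp])
      (by simp [i₂₃]) <| Runs.block_nil ⟨?_, ?_, ?_, ?_, ?_, ?_, ?_⟩) (by simp) (fun _ h => h)
    · simp
      rw [gF₃.reg _ (by omega), gF.reg _ (by omega), fr _ (by omega), e₂]
    · simp
    · simp
    · intro r hr
      simp [show r ≠ 41 by omega, show r ≠ 42 by omega]
      rw [gF₃.reg _ (by omega), gF.reg _ (by omega), fr _ (by omega), er r (by omega)]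
    · intro i
      simp only [NState.setReg_mem]
      rw [gF₃.mem _ (by omega)]
      exact g₁ i
    · exact g₂
    · intro a ha i
      simp only [NState.setReg_mem]
      rw [gF₃.mem _ (by omega), gF.mem _ (by omega), fm _ (by omega), em a (by omega)]
  · have h₂ : k * (4000 * Pm + 6622) = 2 * (k * (5 * (400 * Pm + 660) + 11)) := by ring
    rw [hB, ← hNdef, ← hb, h₂]
    omega

/-! ### Asymptotic bounds -/

/-- The number of words of the packed representation of a string of length `n`, which is
`Θ(n / log n)`. -/
def wordCount (n : ℕ) : ℕ := packedLength (blockSize n) n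

theorem le_packedLength_mul {b : ℕ} (hb : 0 < b) (n : ℕ) : n ≤ packedLength b n * b := by
  by_contra h
  exact lt_irrefl _ ((lt_packedLength_iff hb).2 (not_le.1 h))

theorem packedLength_le {b n c : ℕ} (hb : 0 < b) (h : n ≤ c * b) : packedLength b n ≤ c := by
  by_contra h'
  have := (lt_packedLength_iff hb).1 (not_le.1 h')
  omega

theorem wordCount_pos {n : ℕ} (hn : 0 < n) : 0 < wordCount n :=
  (lt_packedLength_iff (blockSize_pos n)).2 (by omega)

theorem two_pow_blockSize_le {n : ℕ} (hn : 0 < n) : 2 ^ blockSize n ≤ 2 * n := by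
  have := two_pow_le_of_blockSize hn (j := Nat.log 2 n) (by simp [blockSize])
  rw [blockSize, pow_succ]
  omega

/-- The size of the lookup table is `O(n / log n)`, as it is about `√n`. -/
theorem two_pow_half_blockSize_le {n : ℕ} (hn : 0 < n) :
    2 ^ ((blockSize n + 1) / 2) ≤ 4 * wordCount n := by
  have hb := blockSize_pos n
  set b := blockSize n with hbd
  set h := (b + 1) / 2 with hh
  have h₁ : n ≤ wordCount n * b := le_packedLength_mul hb n
  have h₂ : b ≤ 2 ^ h := by
    have h₃ : h < 2 ^ h := Nat.lt_two_pow_self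
    have h₄ : 2 * h ≤ 2 ^ h := by
      obtain ⟨g, hg⟩ : ∃ g, h = g + 1 := ⟨h - 1, by omega⟩
      have : g < 2 ^ g := Nat.lt_two_pow_self
      rw [hg, pow_succ]
      omega
    omega
  have h₃ : 2 ^ h * 2 ^ h ≤ 2 * 2 ^ b := by
    rw [← pow_add, ← pow_succ']
    exact Nat.pow_le_pow_right (by norm_num) (by omega)
  have h₄ : 2 ^ b ≤ 2 * n := two_pow_blockSize_le hn
  have h₅ : 2 ^ h * b ≤ 4 * wordCount n * b := by
    calc 2 ^ h * b ≤ 2 ^ h * 2 ^ h := Nat.mul_le_mul_left _ h₂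
      _ ≤ 4 * n := by omega
      _ ≤ 4 * wordCount n * b := by rw [mul_assoc]; omega
  exact Nat.le_of_mul_le_mul_right h₅ hb

theorem blockSize_le_wordCount {n : ℕ} (hn : 0 < n) : blockSize n ≤ 4 * wordCount n := by
  refine le_trans ?_ (two_pow_half_blockSize_le hn)
  set b := blockSize n
  obtain ⟨g, hg⟩ : ∃ g, (b + 1) / 2 = g + 1 := ⟨(b + 1) / 2 - 1, by
    have := blockSize_pos n
    omega⟩
  have : g < 2 ^ g := Nat.lt_two_pow_self
  rw [hg, pow_succ]
  omega

theorem two_pow_mul_le {i j : ℕ} (hi : 0 < i) (hij : i ≤ j) : 2 ^ i * j ≤ 2 ^ j * i := by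
  induction j, hij using Nat.le_induction with
  | base => rfl
  | succ j hj ih =>
    calc 2 ^ i * (j + 1) ≤ 2 ^ i * (j + j) := Nat.mul_le_mul_left _ (by omega)
      _ = 2 * (2 ^ i * j) := by ring
      _ ≤ 2 * (2 ^ j * i) := Nat.mul_le_mul_left _ ih
      _ = 2 ^ (j + 1) * i := by ring

/-- Strings of length `O(u)` have `O(u / log u)` words. -/
theorem wordCount_le {n u C : ℕ} (hu : 0 < u) (h : n ≤ C * u) :
    wordCount n ≤ (C + 2) * wordCount u := by
  have hbn := blockSize_pos n
  have hbu := blockSize_pos u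
  have hu' : u ≤ wordCount u * blockSize u := le_packedLength_mul hbu u
  refine packedLength_le hbn ?_
  rcases le_total (blockSize u) (blockSize n) with hle | hle
  · calc n ≤ C * u := h
      _ ≤ C * (wordCount u * blockSize n) := Nat.mul_le_mul_left _
          (hu'.trans (Nat.mul_le_mul_left _ hle))
      _ ≤ (C + 2) * wordCount u * blockSize n := by
          rw [mul_assoc]; exact Nat.mul_le_mul_right _ (by omega)
  · -- a string that is much shorter than `u`, but has few symbols per word
    have h₁ := two_pow_mul_le hbn hle
    have h₂ := two_pow_blockSize_le hu
    have h₃ : 2 ^ blockSize n * blockSize u ≤ 2 * wordCount u * blockSize n * blockSize u := by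
      calc 2 ^ blockSize n * blockSize u ≤ 2 ^ blockSize u * blockSize n := h₁
        _ ≤ 2 * (wordCount u * blockSize u) * blockSize n := Nat.mul_le_mul_right _ (by omega)
        _ = 2 * wordCount u * blockSize n * blockSize u := by ring
    have h₄ := Nat.le_of_mul_le_mul_right h₃ hbu
    have h₅ := lt_two_pow_blockSize n
    have h₆ : 2 * wordCount u * blockSize n ≤ (C + 2) * wordCount u * blockSize n :=
      Nat.mul_le_mul_right _ (Nat.mul_le_mul_right _ (by omega))
    omega

theorem blockSize_le_add {n N C : ℕ} (hN : 0 < N) (h : N ≤ C * n) :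
    blockSize N ≤ blockSize n + C := by
  have h₁ := two_pow_blockSize_le hN
  have h₂ := lt_two_pow_blockSize n
  have h₃ : C < 2 ^ C := Nat.lt_two_pow_self
  have h₄ : 2 ^ blockSize N < 2 ^ (blockSize n + C + 1) := by
    have h₅ : C * n ≤ 2 ^ C * n := Nat.mul_le_mul_right _ h₃.le
    have h₆ : 2 ^ C * n < 2 ^ C * 2 ^ blockSize n := Nat.mul_lt_mul_of_pos_left h₂ (by positivity)
    rw [pow_succ, pow_add, mul_comm (2 ^ blockSize n)]
    omega
  have := (Nat.pow_lt_pow_iff_right (by norm_num)).1 h₄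
  omega

/-- Bounds with natural numbers as constants for the size of Dictionary Matching instances. The text
has at least two symbols, since otherwise its logarithm would be zero and the patterns empty. -/
theorem IsDMInstance.bounds {a b : ℝ} {B : ℕ} (hB : b ≤ B) {x : List Bool} {D : List (List Bool)}
    {m : ℕ} (h : IsDMInstance a b x D m) :
    2 ≤ x.length ∧ D.length ≤ 2 * B * wordCount x.length ∧ m ≤ B * blockSize x.length ∧
      outLength x.length m D.length ≤ (4 + 15 * (B * B) + 65 * B) * x.length := by
  have hn0 : 0 < x.length := List.length_pos_iff.2 h.text_ne
  have hm := h.pos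
  have hcard := h.card_le
  have hlen := h.length_le
  set n := x.length with hn
  set k := D.length with hk
  set L := Real.logb 2 n with hL
  have hm' : (1 : ℝ) ≤ m := by exact_mod_cast hm
  have hn2 : 2 ≤ n := by
    by_contra hlt
    have : n = 1 := by omega
    rw [hL, this] at hlen
    simp at hlen
    omega
  have hn2' : (2 : ℝ) ≤ n := by exact_mod_cast hn2
  have hL1 : 1 ≤ L := by
    rw [hL, Real.le_logb_iff_rpow_le (by norm_num) (by positivity)]
    simpa using hn2'
  have hLb : L ≤ blockSize n := by
    rw [hL, Real.logb_le_iff_le_rpow (by norm_num) (by positivity), Real.rpow_natCast]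
    exact_mod_cast (lt_two_pow_blockSize n).le
  have hbL : (blockSize n : ℝ) ≤ 2 * L := by
    have : (Nat.log 2 n : ℝ) ≤ L := by
      rw [hL, Real.le_logb_iff_rpow_le (by norm_num) (by positivity), Real.rpow_natCast]
      exact_mod_cast Nat.pow_log_le_self 2 hn0.ne'
    rw [blockSize]
    push_cast
    linarith
  have hL0 : 0 < L := by linarith
  have hkL : (k : ℝ) * L ≤ B * n := by
    calc (k : ℝ) * L ≤ b * (n / L) * L := by gcongr
      _ = b * n := by field_simp
      _ ≤ B * n := by gcongr
  have hmL : (m : ℝ) ≤ B * L := hlen.trans (by gcongr)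
  have hkn : k ≤ B * n := by
    have : (k : ℝ) ≤ B * n := by nlinarith [(Nat.cast_nonneg k : (0 : ℝ) ≤ k)]
    exact_mod_cast this
  have hkm : k * m ≤ B * B * n := by
    have : (k : ℝ) * m ≤ B * B * n := by
      calc (k : ℝ) * m ≤ k * (B * L) := by gcongr
        _ = B * (k * L) := by ring
        _ ≤ B * (B * n) := by gcongr
        _ = B * B * n := by ring
    exact_mod_cast this
  refine ⟨hn2, ?_, ?_, ?_⟩
  · have h₁ : k * blockSize n ≤ 2 * B * n := by
      have : (k : ℝ) * blockSize n ≤ 2 * B * n := by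
        calc (k : ℝ) * blockSize n ≤ k * (2 * L) := by gcongr
          _ = 2 * (k * L) := by ring
          _ ≤ 2 * (B * n) := by gcongr
          _ = 2 * B * n := by ring
      exact_mod_cast this
    have h₂ : n ≤ wordCount n * blockSize n := le_packedLength_mul (blockSize_pos n) n
    refine Nat.le_of_mul_le_mul_right (h₁.trans ?_) (blockSize_pos n)
    rw [mul_assoc (2 * B) (wordCount n)]
    exact Nat.mul_le_mul_left _ h₂
  · have : (m : ℝ) ≤ B * blockSize n := hmL.trans (by gcongr)
    exact_mod_cast this
  · have e : outLength n m k = 2 + 3 * n + 15 * (k * m) + 65 * k := by rw [outLength]; ring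
    rw [e]
    nlinarith

/-! ### Dictionary Matching by RLBWT Size -/

theorem State.Embeds.of_agreeOff {w : ℕ} {f g f' g' : ℕ → ℕ} {τ τ' σ : State w}
    (h : State.Embeds f g τ σ) (h' : State.AgreeOff f' g' τ τ') (hf : ∀ r, f r ∉ Set.range f')
    (hg : ∀ a, g a ∉ Set.range g') : State.Embeds f g τ' σ :=
  ⟨fun r => (h'.reg _ (hf r)).trans (h.reg r), fun a => (h'.mem _ (hg a)).trans (h.mem a)⟩

theorem exists_occurs_iff (x : List Bool) (D : List (List Bool)) :
    (∃ p ∈ D, p <:+: x) ↔ D.countP (fun p => ¬ p <:+: x) < D.length := by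
  have h := List.countP_le_length (p := fun p => decide ¬ p <:+: x) (l := D)
  have h' := List.countP_eq_length (p := fun p => decide ¬ p <:+: x) (l := D)
  constructor
  · rintro ⟨p, hp, hpx⟩
    refine lt_of_le_of_ne h fun he => ?_
    simpa [hpx] using h'.1 he p hp
  · intro hlt
    by_contra hno
    push Not at hno
    exact hlt.ne (h'.2 fun p hp => by simpa using hno p hp)

/-- Builds both strings, computes the two numbers of runs, and compares their difference with twice
the number of patterns. -/
def matchBySize (A : Program) : Program :=
  .seq buildInputs <| .seq (A.rename (fun j => 41 + 3 * j) (fun j => 10 + 2 * j)) <|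
    .seq (A.rename (fun j => 42 + 3 * j) (fun j => 11 + 2 * j))
      (assign 0 (.bin .lt (.reg 42) (.reg 41 + 2 * .reg 2)))

/-- A state in which the string `x` has been written for a copy of a program contains a copy of the
initial state of that program on `x`. -/
theorem embeds_stringInput {w f₀ g₀ e : ℕ} {x : List Bool} {σ : State w} {ν : NState}
    (hσ : Represents σ ν) {b : ℕ} (hb : b = blockSize x.length) (hbw : b ≤ w)
    (hlen : x.length < 2 ^ w) (h₀ : ν.reg f₀ = x.length)
    (hreg : ∀ r, f₀ < r → r ≠ 42 → ν.reg r = 0) (hf₀' : f₀ = 41 ∨ f₀ = 42)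
    (hmem₀ : ∀ i, ν.mem g₀ i = packedWord b x i) (hmem : ∀ a, e < a → ∀ i, ν.mem a i = 0)
    (hg₀ : e < g₀ + 2) :
    State.Embeds (fun j => f₀ + 3 * j) (fun j => g₀ + 2 * j) σ (stringInput w x) := by
  refine ⟨fun r => ?_, fun a => funext fun i => ?_⟩
  · rw [← BitVec.toNat_inj, hσ.reg _ (by simp only [IsTemp]; omega)]
    rcases Nat.eq_zero_or_pos r with rfl | hr
    · simp [stringInput, h₀, Nat.mod_eq_of_lt hlen]
    · rw [hreg _ (by omega) (by omega)]
      simp [stringInput, hr.ne']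
  · rw [← BitVec.toNat_inj, hσ.mem]
    rcases Nat.eq_zero_or_pos a with rfl | ha
    · have h₁ := packedWord_lt b x i.toNat
      have h₂ : 2 ^ b ≤ 2 ^ w := Nat.pow_le_pow_right (by norm_num) hbw
      simp [stringInput, hmem₀, ← hb, Nat.mod_eq_of_lt (h₁.trans_le h₂)]
    · rw [hmem _ (by omega)]
      simp [stringInput, ha.ne']

/-- Total correctness of the reduction on a single instance, given executions of `A` on the two
strings. -/
theorem exec_matchBySize {w s m t₁ t₂ : ℕ} {A : Program} {x : List Bool} {D : List (List Bool)}
    {σ₁ σ₂ : State w} (hI : IsDictionary x D m)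
    (hL : Layout w s (blockSize x.length) ((blockSize x.length + 1) / 2)
      (blockSize (outLength x.length m D.length)) (outLength x.length m D.length))
    (hm : 15 * m + 65 + blockSize x.length < 2 ^ w)
    (hps₀ : packedLength (blockSize x.length) x.length ≤ s)
    (hps : D.length * packedLength (blockSize x.length) m ≤ s)
    (h₁ : Exec s A (stringInput w (string₁ x D)) t₁ σ₁)
    (h₂ : Exec s A (stringInput w (string₂ x D)) t₂ σ₂)
    (hr₁ : (σ₁.reg 0).toNat = rlbwtSize (string₁ x D))
    (hr₂ : (σ₂.reg 0).toNat = rlbwtSize (string₂ x D)) :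
    ∃ t ≤ 20 * blockSize (outLength x.length m D.length) +
      24 * 2 ^ ((blockSize x.length + 1) / 2) + 800 * packedLength (blockSize x.length) x.length +
      D.length * (4000 * packedLength (blockSize x.length) m + 6622) + 920 + t₁ + t₂,
      ∃ τ, Exec s (matchBySize A) (dictInput w x D m) t τ ∧
        (τ.reg 0).toNat = if ∃ p ∈ D, p <:+: x then 1 else 0 := by
  have hD := hI.length_eq
  have hl₁ := length_string₁ (x := x) hD
  have hl₂ := length_string₂ (x := x) hD
  have hb0 := hL.pos
  have hww := hL.word
  have hNdef : outLength x.length m D.length =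
    2 + 3 * x.length + D.length * (15 * m + 65) := rfl
  have hkm : D.length * packedLength (blockSize x.length) m ≤ D.length * m :=
    Nat.mul_le_mul_left _ (packedLength_le_self hb0)
  have hN : outLength x.length m D.length =
      2 + 3 * x.length + 15 * (D.length * m) + 65 * D.length := by rw [hNdef]; ring
  set N := outLength x.length m D.length with hNd
  have hNb := lt_two_pow_blockSize N
  have hNw : 2 ^ (blockSize N + 2) ≤ 2 ^ w := Nat.pow_le_pow_right (by norm_num) (by omega)
  rw [pow_add] at hNw
  obtain ⟨t₀, ht₀, τ₀, ν, e₀, r₀, n₂, n₄₁, n₄₂, nr, m₁, m₂, nm⟩ := runs_buildInputs hI.text_ne hD hL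
    hm hps₀ hps (by omega) _ (represents_toNState _)
  have hE₁ := embeds_stringInput (f₀ := 41) (g₀ := 10) (e := 11) (x := string₁ x D) r₀
    (b := blockSize N) (by rw [hl₁]) (by omega) (by omega) (by rw [n₄₁, hl₁])
    (fun r hr hr' => nr r (by omega)) (by simp) m₁ nm (by norm_num)
  have hE₂ := embeds_stringInput (f₀ := 42) (g₀ := 11) (e := 11) (x := string₂ x D) r₀
    (b := blockSize N) (by rw [hl₂]) (by omega) (by omega) (by rw [n₄₂, hl₂])
    (fun r hr hr' => nr r (by omega)) (by simp) m₂ nm (by norm_num)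
  obtain ⟨τ₁, e₁, hA₁, ho₁⟩ := h₁.rename (fun i j h => by simpa using h)
    (fun i j h => by simpa using h) hE₁
  obtain ⟨τ₂, e₂, hA₂, ho₂⟩ := h₂.rename (fun i j h => by simpa using h)
    (fun i j h => by simpa using h) (hE₂.of_agreeOff ho₁
      (by rintro r ⟨j, hj⟩; simp only at hj; omega) (by rintro r ⟨j, hj⟩; simp only at hj; omega))
  have v₄₂ : (τ₂.reg 42).toNat = rlbwtSize (string₂ x D) := by rw [← hr₂, ← hA₂.reg 0]
  have v₄₁ : (τ₂.reg 41).toNat = rlbwtSize (string₁ x D) := by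
    rw [← hr₁, ← hA₁.reg 0, ho₂.reg _ (by rintro ⟨j, hj⟩; simp only at hj; omega)]
  have v₂ : (τ₂.reg 2).toNat = D.length := by
    rw [ho₂.reg _ (by rintro ⟨j, hj⟩; simp only at hj; omega),
      ho₁.reg _ (by rintro ⟨j, hj⟩; simp only at hj; omega), r₀.reg 2 (by decide), n₂]
  have hruns : rlbwtSize (string₁ x D) ≤ N := by
    rw [← hl₁, ← length_bwt (string₁ x D)]
    exact runs_le_length _
  have hmain := rlbwtSize_string₂_sub hI
  obtain ⟨t₃, ht₃, τ₃, ν₃, e₃, r₃, n₀⟩ := Runs.assign (w := w) (s := s) (d := 0) (by omega)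
    (e := .bin .lt (.reg 42) (.reg 41 + 2 * .reg 2)) (ν := τ₂.toNState)
    (Q := fun ν' => ν'.reg 0 = if ∃ p ∈ D, p <:+: x then 1 else 0)
    (by simp [IsTemp, BinOp.Fits, State.toNState, v₄₁, v₂]; omega)
    (by
      simp only [Ex.eval_bin, Ex.eval_reg, Ex.eval_add, Ex.eval_mul, Ex.eval_ofNat, BinOp.natEval,
        State.toNState, v₄₂, v₄₁, v₂, NState.setReg_reg, if_true, exists_occurs_iff]
      refine if_congr ?_ rfl rfl
      omega) τ₂ (represents_toNState _)
  simp at ht₃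
  rw [← hNd] at ht₀
  refine ⟨_, ?_, τ₃, .seq e₀ (.seq e₁ (.seq e₂ e₃)), by rw [r₃.reg 0 (by decide), n₀]⟩
  omega

/-- The time and space of the reduction are dominated by those of `A`, since `A` has to read its
input. -/
theorem solvesDictionaryMatching_matchBySize {A : Program} {T S : ℕ → ℝ}
    (hA : SolvesRLBWTSize A T S) : SolvesDictionaryMatching (matchBySize A) T S := by
  intro a β _ _
  obtain ⟨B, hB⟩ := exists_nat_ge β
  obtain ⟨K₀, hK₀⟩ := packedLength_le_of_solvesRLBWTSize hA
  obtain ⟨cA, hA⟩ := hA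
  obtain ⟨C, hC⟩ : ∃ C, C = 4 + 15 * (B * B) + 65 * B := ⟨_, rfl⟩
  obtain ⟨KA, hA⟩ := hA C
  -- `K₁` bounds the time and `K₂` the space of the reduction itself, per word of the text
  obtain ⟨K₁, hK₁⟩ : ∃ K₁, K₁ = 80 * (1 + C) + 96 + 800 + 2 * B * (4000 * B + 6622) + 920 := ⟨_, rfl⟩
  obtain ⟨K₂, hK₂⟩ : ∃ K₂, K₂ = (C + 2) + 1 + 4 + 1 + 2 * B * B := ⟨_, rfl⟩
  refine ⟨cA * (1 + C) + 4 * (1 + C) + 20 + (15 * B + 66), (K₁ + K₂) * K₀ + 2 * KA,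
    fun x D m hI w hw => ?_⟩
  obtain ⟨hn2, hk, hm, hN⟩ := hI.bounds hB
  rw [← hC] at hN
  have hD := hI.length_eq
  have hl₁ := length_string₁ (x := x) hD
  have hl₂ := length_string₂ (x := x) hD
  set n := x.length with hn
  set k := D.length with hkd
  set N := outLength n m k with hNd
  set b := blockSize n with hb
  have hb0 : 0 < b := blockSize_pos n
  have hN0 : 0 < N := by rw [hNd, outLength]; omega
  have hb' : blockSize N ≤ (1 + C) * b := by
    have := blockSize_le_add hN0 hN
    nlinarith
  have hP := wordCount_pos (n := n) (by omega)
  have hw' : cA * blockSize N ≤ w ∧ 4 * blockSize N + 20 ≤ w ∧ (15 * B + 66) * b ≤ w := by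
    have h₁ : cA * blockSize N ≤ cA * (1 + C) * b := by
      rw [mul_assoc]; exact Nat.mul_le_mul_left _ hb'
    simp only [Nat.add_mul] at hw hb' ⊢
    refine ⟨?_, ?_, ?_⟩ <;> nlinarith
  have hww : w < 2 ^ w := Nat.lt_two_pow_self
  have hbb : b ≤ blockSize N := by
    rw [hb, blockSize, blockSize]
    have := Nat.log_mono_right (b := 2) (show n ≤ N by rw [hNd, outLength]; omega)
    omega
  have hNbw : N < 2 ^ w := (lt_two_pow_blockSize N).trans_le
    (Nat.pow_le_pow_right (by norm_num) (by omega))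
  have hPm : packedLength b m ≤ B := packedLength_le hb0 hm
  have hkP : k * packedLength b m ≤ 2 * B * B * wordCount n := by
    calc k * packedLength b m ≤ (2 * B * wordCount n) * B := Nat.mul_le_mul hk hPm
      _ = 2 * B * B * wordCount n := by ring
  have hH : 2 ^ ((b + 1) / 2) ≤ 4 * wordCount n := two_pow_half_blockSize_le (by omega)
  have hNP : wordCount N ≤ (C + 2) * wordCount n := wordCount_le (by omega) hN
  have hNd' : N / blockSize N ≤ wordCount N := by
    rw [wordCount, packedLength]
    exact Nat.div_le_div_right (by omega)
  set s₀ := K₂ * wordCount n with hs₀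
  have hs₀' : s₀ = (C + 2) * wordCount n + wordCount n + 4 * wordCount n + wordCount n +
    2 * B * B * wordCount n := by rw [hs₀, hK₂]; ring
  have hne : ∀ y : List Bool, y.length = N → y ≠ [] := by
    rintro y hy rfl
    simp at hy
    omega
  obtain ⟨s₁, t₁, σ₁, x₁, ht₁, hs₁, r₁⟩ := hA n hn2 (string₁ x D) (hne _ hl₁) (by rw [hl₁]; exact hN)
    w (by rw [hl₁]; exact hw'.1)
  obtain ⟨s₂, t₂, σ₂, x₂, ht₂, hs₂, r₂⟩ := hA n hn2 (string₂ x D) (hne _ hl₂) (by rw [hl₂]; exact hN)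
    w (by rw [hl₂]; exact hw'.1)
  have hPn : packedLength b n = wordCount n := rfl
  have hNs : N / blockSize N < s₀ + s₁ + s₂ := by omega
  have hHs : 2 ^ ((b + 1) / 2) ≤ s₀ + s₁ + s₂ := by omega
  obtain ⟨t, ht, τ, hexec, hout⟩ := exec_matchBySize (s := s₀ + s₁ + s₂) hI.toIsDictionary
    ⟨hb0, by omega, by omega, hbb, hw'.2.1, hNbw, hNs, hHs⟩
    (by
      have : (15 * B + 66) * b = 15 * (B * b) + 66 * b := by ring
      show 15 * m + 65 + b < 2 ^ w
      omega)
    (by rw [← hn, ← hb, hPn]; omega) (by rw [← hn, ← hb, ← hkd]; omega) (x₁.mono (by omega))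
    (x₂.mono (by omega)) r₁ r₂
  obtain ⟨kT, kS⟩ := hK₀ n hn2
  refine ⟨s₀ + s₁ + s₂, t, τ, hexec, ?_, ?_, hout⟩
  · have h₁ : t ≤ K₁ * wordCount n + t₁ + t₂ := by
      have ht' : t ≤ 20 * blockSize N + 24 * 2 ^ ((b + 1) / 2) + 800 * wordCount n +
        k * (4000 * packedLength b m + 6622) + 920 + t₁ + t₂ := ht
      refine ht'.trans ?_
      have hbW := blockSize_le_wordCount (n := n) (by omega)
      have h₂ : blockSize N ≤ (1 + C) * (4 * wordCount n) :=
        hb'.trans (Nat.mul_le_mul_left _ hbW)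
      have h₃ : k * (4000 * packedLength b m + 6622) ≤
          2 * B * wordCount n * (4000 * B + 6622) := Nat.mul_le_mul hk (by omega)
      have h₄ : K₁ * wordCount n = 20 * ((1 + C) * (4 * wordCount n)) + 24 * (4 * wordCount n) +
        800 * wordCount n + 2 * B * wordCount n * (4000 * B + 6622) + 920 * wordCount n := by
        rw [hK₁]; ring
      omega
    have h₂ : (t : ℝ) ≤ K₁ * wordCount n + t₁ + t₂ := by exact_mod_cast h₁
    have h₃ : (K₁ : ℝ) * wordCount n ≤ K₁ * (K₀ * T n) := by
      gcongr; exact kT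
    have h₄ : (0 : ℝ) ≤ K₂ * (K₀ * T n) :=
      mul_nonneg (Nat.cast_nonneg _) (le_trans (Nat.cast_nonneg _) kT)
    push_cast
    linarith
  · have h₃ : (K₂ : ℝ) * wordCount n ≤ K₂ * (K₀ * S n) := by
      gcongr; exact kS
    have h₄ : (0 : ℝ) ≤ K₁ * (K₀ * S n) :=
      mul_nonneg (Nat.cast_nonneg _) (le_trans (Nat.cast_nonneg _) kS)
    rw [hs₀]
    push_cast
    linarith

/-! ### RLBWT Size by BWT Construction -/

/-- Stores in register 0 the number of runs of the string of length `reg 0` that is stored in packed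
representation in array 12. Register 11 holds the last symbol of the preceding word, and initially
the inverse of the first symbol, so that the first run is counted as well. The table of `stretch 0`
gives the number of ones in half a word. -/
def countRuns : Program := block [
  bitLength 3 0,
  assign 4 ((.reg 3 + 1) / 2),
  assign 5 (.bin .shl 1 (.reg 4)),
  fillTable 0,
  assign 16 0,
  assign 17 (.reg 0),
  assign 18 ((.reg 0 + (.reg 3 - 1)) / .reg 3),
  assign 10 0,
  assign 11 (1 - .load 12 0 % 2),
  .loop 18 (block [
    assign 19 (.load 12 (.reg 16)),
    assign 20 (.reg 17 * .bin .lt (.reg 17) (.reg 3) + .reg 3 * (1 - .bin .lt (.reg 17) (.reg 3))),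
    assign 14 (.bin .xor (.reg 19) (2 * .reg 19 + .reg 11) % .bin .shl 1 (.reg 20)),
    assign 10 (.reg 10 + (.load 2 (.reg 14 % .reg 5) + .load 2 (.reg 14 / .reg 5))),
    assign 11 (.bin .shr (.reg 19) (.reg 20 - 1)),
    assign 16 (.reg 16 + 1),
    assign 17 (.reg 17 - .reg 20),
    assign 18 (.reg 18 - 1)]),
  assign 0 (.reg 10)]

theorem changes_le_length (a : Bool) (x : List Bool) : changes a x ≤ x.length := by
  induction x generalizing a with
  | nil => simp [changes]
  | cons c x ih =>
    have := Bool.toNat_lt (a ^^ c)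
    have := ih c
    simp only [changes, List.length_cons]
    omega

theorem runs_countRuns {w s : ℕ} {y : List Bool} {ν : NState} (hy : y ≠ [])
    (h₀ : ν.reg 0 = y.length) (hw : 4 * blockSize y.length + 20 ≤ w)
    (hmem : ∀ i < wordCount y.length, ν.mem 12 i = packedWord (blockSize y.length) y i)
    (htab : ν.mem 2 0 = 0) (hs : 2 ^ ((blockSize y.length + 1) / 2) ≤ s)
    (hs' : wordCount y.length ≤ s) :
    Runs w s countRuns (10 * blockSize y.length + 24 * 2 ^ ((blockSize y.length + 1) / 2) +
      100 * wordCount y.length + 100) ν (fun ν' => ν'.reg 0 = runs y) := by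
  have hn : 0 < y.length := List.length_pos_iff.2 hy
  have hP := wordCount_pos hn
  have hnb := lt_two_pow_blockSize y.length
  obtain ⟨n, hnd⟩ : ∃ n, n = y.length := ⟨_, rfl⟩
  rw [← hnd] at h₀ hw hmem hs hs' hn hP hnb ⊢
  obtain ⟨b, hb⟩ : ∃ b, b = blockSize n := ⟨_, rfl⟩
  have hb0 := blockSize_pos n
  obtain ⟨P, hPe⟩ : ∃ P, P = wordCount n := ⟨_, rfl⟩
  have hPd : P = packedLength b n := by rw [hPe, hb]; rfl
  rw [← hb] at hw hmem hs hnb hb0 ⊢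
  rw [← hPe] at hmem hs' hP ⊢
  obtain ⟨h, hh⟩ : ∃ h, h = (b + 1) / 2 := ⟨_, rfl⟩
  rw [← hh] at hs ⊢
  have hw5 : 2 ^ 5 ≤ 2 ^ w := Nat.pow_le_pow_right (by norm_num) (by omega)
  have hbw : 2 ^ (b + 2) ≤ 2 ^ w := Nat.pow_le_pow_right (by norm_num) (by omega)
  have hww : w < 2 ^ w := Nat.lt_two_pow_self
  have hhw : 2 ^ h < 2 ^ w := Nat.pow_lt_pow_right (by norm_num) (by omega)
  rw [pow_add] at hbw
  have hPn : P ≤ n := by rw [hPd]; exact packedLength_le_self hb0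
  obtain ⟨c, l, hcl⟩ := List.exists_cons_of_ne_nil hy
  refine Runs.mono (Runs.block_cons (t := 10 * b + 6) (t' := 24 * 2 ^ h + 100 * P + 94)
    (Runs.mono (runs_bitLength (by omega) (by omega) (by omega) (by omega) (by omega)
      (by rw [h₀, ← hb]; omega)) (by rw [h₀, ← hb]) ?_)) (by omega) (fun _ h => h)
  rintro ν₁ ⟨e₃, er, em⟩
  rw [h₀, ← hb] at e₃
  have e₀ : ν₁.reg 0 = n := by rw [er 0 (by omega) (by omega), h₀]
  have hfin := runs_fillTable (w := w) (s := s) (e := 0) (h := h)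
    (ν := (ν₁.setReg 4 h).setReg 5 (2 ^ h)) (by omega) (by omega)
    (by simp) hs (by simp [em, htab])
  refine Runs.mono (Runs.block_assign_of_eq (v := h) (by omega)
      (by simp [IsTemp, e₃]; omega) (by simp [e₃, hh]) <|
    Runs.block_assign_of_eq (v := 2 ^ h) (by omega)
      (by simp [IsTemp, BinOp.Fits]; omega) (by simp [BinOp.natEval]) <|
    Runs.block_cons (t' := 100 * P + 70) (Runs.mono hfin le_rfl ?_))
    (by simp; omega) (fun _ h => h)
  rintro ν₂ ⟨htable, hF⟩
  have f₀ := hF.reg 0 (by omega)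
  have f₃ := hF.reg 3 (by omega)
  have f₅ := hF.reg 5 (by omega)
  have fm := hF.mem 12 (by omega)
  simp [e₀, e₃, em] at f₀ f₃ f₅ fm
  rw [← fm] at hmem
  have hfirst : ν₂.mem 12 0 % 2 = c.toNat := by
    have := Bool.toNat_lt c
    obtain ⟨b₀, hb₀⟩ : ∃ b₀, b = b₀ + 1 := ⟨b - 1, by omega⟩
    rw [hmem 0 hP, packedWord_eq_val, hcl, hb₀]
    simp only [zero_mul, List.drop_zero, List.take_succ_cons, val]
    omega
  have hnot : 1 - c.toNat = (!c).toNat := by cases c <;> rfl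
  refine Runs.mono (Runs.block_assign_of_eq (v := 0) (by omega) (by simp) (by simp) <|
    Runs.block_assign_of_eq (v := n) (by omega) (by simp [IsTemp]) (by simp [f₀]) <|
    Runs.block_assign_of_eq (v := P) (by omega)
      (by simp [IsTemp, f₀, f₃]; omega) (by simp [f₀, f₃, hPd, packedLength]) <|
    Runs.block_assign_of_eq (v := 0) (by omega) (by simp) (by simp) <|
    Runs.block_assign_of_eq (v := (!c).toNat) (by omega)
      (by simp [hfirst]; have := Bool.toNat_lt c; omega) (by simp [hfirst, hnot]) <|
    Runs.block_cons (t' := 10) (Runs.mono (Runs.loop (t := 90) (by decide) (fun j ν' =>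
      ν'.reg 18 = j ∧ j ≤ P ∧ ν'.reg 16 = P - j ∧ ν'.reg 17 = n - (P - j) * b ∧
      ν'.reg 10 = changes (!c) (y.take ((P - j) * b)) ∧
      ν'.reg 11 = (((!c) :: y.take ((P - j) * b)).getLast (by simp)).toNat ∧
      ν'.reg 3 = b ∧ ν'.reg 5 = 2 ^ h ∧ ν'.mem = ν₂.mem)
      ?_ (fun _ h => h.1) P ?_) le_rfl ?_)) (by simp; omega) (fun _ h => h)
  · rintro j ν' ⟨h₁₈, hj, h₁₆, h₁₇, h₁₀, h₁₁, h₃, h₅, hm⟩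
    refine ⟨by omega, ?_⟩
    obtain ⟨i, hi⟩ : ∃ i, i = P - (j + 1) := ⟨_, rfl⟩
    rw [← hi] at h₁₆ h₁₇
    have hiP : i < P := by omega
    have hij : P - j = i + 1 := by omega
    have hix : i * b < n := (lt_packedLength_iff hb0).1 (hPd ▸ hiP)
    obtain ⟨z, hz⟩ : ∃ z, z = (y.drop (i * b)).take b := ⟨_, rfl⟩
    have hzl : z.length = min b (n - i * b) := by simp [hz, hnd]
    have hz0 : z ≠ [] := by
      rintro rfl
      simp at hzl
      omega
    have htake : y.take ((i + 1) * b) = y.take (i * b) ++ z := by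
      rw [Nat.add_mul, one_mul, List.take_add, hz]
    obtain ⟨d, hd⟩ : ∃ d, d = ((!c) :: y.take (i * b)).getLast (by simp) := ⟨_, rfl⟩
    have h₁₁' : ν'.reg 11 = d.toNat := by rw [h₁₁, hd]; simp only [hi]
    have h₁₀' : ν'.reg 10 = changes (!c) (y.take (i * b)) := by rw [h₁₀, hi]
    have hd2 := Bool.toNat_lt d
    have hchanges : changes (!c) (y.take ((i + 1) * b)) =
        changes (!c) (y.take (i * b)) + changes d z := by
      rw [htake, changes_append, hd]
    have hlast : (((!c) :: y.take ((i + 1) * b)).getLast (by simp)).toNat =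
        val z / 2 ^ (z.length - 1) := by
      rw [val_div_eq_getLast z hz0]
      congr 1
      have gen : ∀ t, t = y.take (i * b) ++ z → ((!c) :: t).getLast (by simp) = z.getLast hz0 := by
        rintro t rfl
        rw [List.getLast_cons (by simp [hz0]), List.getLast_append_of_ne_nil _ hz0]
      exact gen _ htake
    have hword : ν'.mem 12 i = val z := by rw [hm, hmem i hiP, packedWord_eq_val, hz]
    have hvz := val_lt z
    have hzb : 2 ^ z.length ≤ 2 ^ b := Nat.pow_le_pow_right (by norm_num) (by omega)
    obtain ⟨u, hu⟩ : ∃ u, u = (val z ^^^ (2 * val z + d.toNat)) % 2 ^ z.length := ⟨_, rfl⟩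
    have hul : u < 2 ^ h * 2 ^ h := by
      rw [← pow_add]
      refine lt_of_lt_of_le (hu ▸ Nat.mod_lt _ (by positivity)) ?_
      exact Nat.pow_le_pow_right (by norm_num) (by omega)
    have hu₁ : u % 2 ^ h < 2 ^ h := Nat.mod_lt _ (by positivity)
    have hu₂ : u / 2 ^ h < 2 ^ h := (Nat.div_lt_iff_lt_mul (by positivity)).2 hul
    have hlook : ν'.mem 2 (u % 2 ^ h) + ν'.mem 2 (u / 2 ^ h) = changes d z := by
      rw [hm, htable _ hu₁, htable _ hu₂, changes_eq_stretch, ← hu, ← stretch_mod_add_div 0 u h]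
      simp
    have hcl := changes_le_length (!c) (y.take ((i + 1) * b))
    rw [hchanges, List.length_take, ← hnd] at hcl
    have hell : (n - i * b) * (if n - i * b < b then 1 else 0) +
        b * (1 - if n - i * b < b then 1 else 0) = z.length := by
      split_ifs <;> simp <;> omega
    have hbi : ∀ q : Prop, [Decidable q] → (if q then 1 else 0) ≤ 1 ∧
        b * (1 - if q then 1 else 0) ≤ b ∧ (n - i * b) * (if q then 1 else 0) ≤ n := by
      intro q _
      split_ifs <;> simp
    refine Runs.mono (Runs.block_assign_of_eq (v := val z) (by omega) (by simp [IsTemp, h₁₆]; omega)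
        (by simp [h₁₆, hword]) <|
      Runs.block_assign_of_eq (v := z.length) (by omega) ?_ (by
        simpa [BinOp.natEval, h₁₇, h₃] using hell) <|
      Runs.block_assign_of_eq (v := u) (by omega)
        (by simp [IsTemp, BinOp.Fits, h₁₁']; omega) (by simp [BinOp.natEval, h₁₁', hu]) <|
      Runs.block_assign_of_eq (v := changes (!c) (y.take ((i + 1) * b))) (by omega)
        (by simp [IsTemp, h₁₀', h₅, hlook]; omega) (by simp [h₁₀', h₅, hlook, hchanges]) <|
      Runs.block_assign_of_eq (v := val z / 2 ^ (z.length - 1)) (by omega)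
        (by simp [IsTemp, BinOp.Fits]; omega) (by simp [BinOp.natEval]) <|
      Runs.block_assign_of_eq (v := i + 1) (by omega)
        (by simp [IsTemp, h₁₆]; omega) (by simp [h₁₆]) <|
      Runs.block_assign_of_eq (v := n - (i + 1) * b) (by omega)
        (by simp [IsTemp, h₁₇]; omega) (by simp [h₁₇, Nat.add_mul]; omega) <|
      Runs.block_assign_of_eq (v := j) (by omega)
        (by simp [IsTemp, h₁₈]; omega) (by simp [h₁₈]) <|
      Runs.block_nil ?_) (by simp) (fun _ h => h)
    · have := hbi (n - i * b < b)
      simp only [Ex.valid_add, Ex.valid_mul, Ex.valid_reg, Ex.valid_bin, Ex.valid_sub,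
        Ex.valid_ofNat, BinOp.Fits, BinOp.natEval, Ex.eval_mul, Ex.eval_reg,
        Ex.eval_bin, Ex.eval_sub, Ex.eval_ofNat, NState.setReg_reg, h₁₇, h₃]
      simp [IsTemp]
      simp at this hell
      omega
    · simp only [hij]
      refine ⟨by simp, by omega, by simp, by simp, by simp, ?_, by simp [h₃], by simp [h₅],
        by simp [hm]⟩
      rw [hlast]
      simp
  · exact ⟨by simp, le_rfl, by simp, by simp, by simp [changes], by simp, by simp [f₃], by simp [f₅],
      by simp⟩
  · rintro ν' ⟨-, -, -, -, h₁₀, -⟩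
    refine Runs.mono (Runs.block_assign_of_eq (v := runs y) (by omega) (by simp [IsTemp]) ?_ <|
      Runs.block_nil (by simp)) (by simp) (fun _ h => h)
    have hle : y.length ≤ P * b := by rw [hPd, ← hnd]; exact le_packedLength_mul hb0 n
    simp only [Ex.eval_reg, h₁₀, Nat.sub_zero, List.take_of_length_le hle]
    rw [hcl, runs_cons_eq_changes]

/-- Computes the transform by a copy of `A` that uses the registers `41, 44, …` and the arrays
`0, 12, 14, …`, and counts its runs. The copy reads the input in place and leaves its output, the
array 1 of `A`, in array 12. -/
def sizeByBWT (A : Program) : Program :=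
  .seq (assign 41 (.reg 0)) <|
    .seq (A.rename (fun j => 41 + 3 * j) (fun j => if j = 0 then 0 else 10 + 2 * j)) countRuns

theorem exec_sizeByBWT {w s t₁ : ℕ} {A : Program} {x : List Bool} {σ₁ : State w} (hx : x ≠ [])
    (hw : 4 * blockSize x.length + 20 ≤ w) (hs : 2 ^ ((blockSize x.length + 1) / 2) ≤ s)
    (hs' : wordCount x.length ≤ s) (h₁ : Exec s A (stringInput w x) t₁ σ₁)
    (hout : ∀ i < packedLength (blockSize x.length) x.length,
      (σ₁.mem 1 (BitVec.ofNat w i)).toNat = packedWord (blockSize x.length) (bwt x) i) :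
    ∃ t ≤ 10 * blockSize x.length + 24 * 2 ^ ((blockSize x.length + 1) / 2) +
      100 * wordCount x.length + 110 + t₁, ∃ τ, Exec s (sizeByBWT A) (stringInput w x) t τ ∧
        (τ.reg 0).toNat = rlbwtSize x := by
  have hlen : x.length < 2 ^ w := (lt_two_pow_blockSize _).trans_le
    (Nat.pow_le_pow_right (by norm_num) (by omega))
  have hbl := length_bwt x
  set g : ℕ → ℕ := fun j => if j = 0 then 0 else 10 + 2 * j with hg
  have hgi : g.Injective := by
    intro i j hij
    simp only [hg] at hij
    split_ifs at hij <;> omega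
  obtain ⟨t₀, ht₀, τ₀, ν, e₀, r₀, nr, nm⟩ := Runs.assign (w := w) (s := s) (d := 41) (by omega)
    (e := .reg 0) (ν := (stringInput w x).toNState)
    (Q := fun ν' => (∀ r, ν'.reg r = if r = 41 then x.length else if r = 0 then x.length else 0) ∧
      ν'.mem = (stringInput w x).toNState.mem) (by simp [IsTemp])
    (by
      refine ⟨fun r => ?_, rfl⟩
      simp only [NState.setReg_reg, Ex.eval_reg, State.toNState, stringInput]
      split_ifs <;> simp [Nat.mod_eq_of_lt hlen]) _ (represents_toNState _)
  have hE : State.Embeds (fun j => 41 + 3 * j) g τ₀ (stringInput w x) := by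
    refine ⟨fun r => ?_, fun a => funext fun i => ?_⟩
    · rw [← BitVec.toNat_inj, r₀.reg _ (by simp only [IsTemp]; omega), nr]
      rcases Nat.eq_zero_or_pos r with rfl | hr
      · simp [stringInput, Nat.mod_eq_of_lt hlen]
      · simp [stringInput, hr.ne']
    · rw [← BitVec.toNat_inj, r₀.mem, nm]
      rcases Nat.eq_zero_or_pos a with rfl | ha
      · simp [State.toNState, hg]
      · simp [State.toNState, stringInput, hg, ha.ne']
  obtain ⟨τ₁, e₁, hA₁, ho₁⟩ := h₁.rename (fun i j h => by simpa using h) hgi hE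
  obtain ⟨t₂, ht₂, τ₂, ν₂, e₂, r₂, n₀⟩ := runs_countRuns (w := w) (s := s) (y := bwt x)
    (ν := τ₁.toNState) (by rintro h; rw [h] at hbl; exact hx (List.length_eq_zero_iff.1 hbl.symm))
    (by
      rw [hbl]
      have : τ₁.reg 0 = τ₀.reg 0 := ho₁.reg 0 (by rintro ⟨j, hj⟩; simp only at hj; omega)
      simp only [State.toNState]
      rw [this, r₀.reg 0 (by decide), nr]
      simp)
    (by rwa [hbl])
    (by
      intro i hi
      rw [hbl] at hi ⊢
      rw [← hout i hi, ← hA₁.mem 1]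
      rfl)
    (by
      have : τ₁.mem 2 = τ₀.mem 2 := ho₁.mem 2 (by
        rintro ⟨j, hj⟩
        simp only [hg] at hj
        split_ifs at hj
        omega)
      simp only [State.toNState]
      rw [this, r₀.mem, nm]
      simp [State.toNState, stringInput])
    (by rwa [hbl]) (by rwa [hbl]) τ₁ (represents_toNState _)
  rw [hbl] at ht₂
  simp at ht₀
  exact ⟨_, by omega, τ₂, .seq e₀ (.seq e₁ e₂), by rw [r₂.reg 0 (by decide), n₀]; rfl⟩

/-- The overhead for counting the runs is dominated by the time and space of `A`, which has to read
its input. -/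
theorem solvesRLBWTSize_sizeByBWT {A : Program} {T S : ℕ → ℝ}
    (hA : SolvesBWTConstruction A T S) : SolvesRLBWTSize (sizeByBWT A) T S := by
  obtain ⟨K₀, hK₀⟩ := packedLength_le_of_solvesBWTConstruction hA
  obtain ⟨cA, hA⟩ := hA
  refine ⟨cA + 24, fun C => ?_⟩
  obtain ⟨KA, hA⟩ := hA C
  obtain ⟨K₁, hK₁⟩ : ∃ K, K = (C + 2) * 346 := ⟨_, rfl⟩
  refine ⟨K₁ * K₀ + KA, fun u hu x hx hxu w hw => ?_⟩
  have hn : 0 < x.length := List.length_pos_iff.2 hx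
  have hb0 := blockSize_pos x.length
  have hbW := blockSize_le_wordCount hn
  have hHW := two_pow_half_blockSize_le hn
  have hPW := wordCount_pos hn
  have hWu : wordCount x.length ≤ (C + 2) * wordCount u := wordCount_le (by omega) hxu
  rw [Nat.add_mul] at hw
  obtain ⟨s₁, t₁, σ₁, x₁, ht₁, hs₁, r₁⟩ := hA u hu x hx hxu w (by omega)
  obtain ⟨t, ht, τ, hexec, hout⟩ := exec_sizeByBWT (s := 5 * wordCount x.length + s₁) hx (by omega)
    (by omega) (by omega) (x₁.mono (by omega)) r₁
  obtain ⟨kT, kS⟩ := hK₀ u hu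
  have hK : ∀ q : ℕ, q ≤ 346 * wordCount x.length → q ≤ K₁ * wordCount u := by
    intro q hq
    refine hq.trans ?_
    calc 346 * wordCount x.length ≤ 346 * ((C + 2) * wordCount u) := Nat.mul_le_mul_left _ hWu
      _ = K₁ * wordCount u := by rw [hK₁]; ring
  have hKR : ∀ {R : ℝ}, (packedLength (blockSize u) u : ℝ) ≤ K₀ * R →
      (K₁ : ℝ) * wordCount u ≤ K₁ * (K₀ * R) := by
    intro R hR
    exact mul_le_mul_of_nonneg_left hR (Nat.cast_nonneg _)
  refine ⟨_, t, τ, hexec, ?_, ?_, hout⟩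
  · have h₁ : t ≤ K₁ * wordCount u + t₁ := by
      have := hK (346 * wordCount x.length) le_rfl
      omega
    have h₂ : (t : ℝ) ≤ K₁ * wordCount u + t₁ := by exact_mod_cast h₁
    have := hKR kT
    push_cast
    linarith
  · have h₁ := hK (5 * wordCount x.length) (by omega)
    have h₂ : ((5 * wordCount x.length : ℕ) : ℝ) ≤ K₁ * wordCount u := by exact_mod_cast h₁
    have := hKR kS
    push_cast at h₂ ⊢
    linarith

end BWTReduction

theorem mainTheorem4 :
    -- the combinatorial reduction
    (∀ (x : List Bool) (D : List (List Bool)) (m : ℕ), BWTReduction.IsDictionary x D m →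
      (BWTReduction.rlbwtSize (BWTReduction.string₂ x D) : ℤ) -
          (BWTReduction.rlbwtSize (BWTReduction.string₁ x D) : ℤ) =
        2 * (D.countP (fun p => ¬ p <:+: x) : ℤ)) ∧
    -- Dictionary Matching reduces to RLBWT Size
    (∀ (A : BWTReduction.Program) (T S : ℕ → ℝ), BWTReduction.SolvesRLBWTSize A T S →
      ∃ P : BWTReduction.Program, BWTReduction.SolvesDictionaryMatching P T S) ∧
    -- Dictionary Matching reduces to BWT Construction
    (∀ (A : BWTReduction.Program) (T S : ℕ → ℝ), BWTReduction.SolvesBWTConstruction A T S →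
      ∃ P : BWTReduction.Program, BWTReduction.SolvesDictionaryMatching P T S) := by
  refine ⟨fun x D m hD => BWTReduction.rlbwtSize_string₂_sub hD,
    fun A T S hA => ⟨_, BWTReduction.solvesDictionaryMatching_matchBySize hA⟩,
    fun A T S hA => ⟨_, BWTReduction.solvesDictionaryMatching_matchBySize
      (BWTReduction.solvesRLBWTSize_sizeByBWT hA)⟩⟩
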